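/- Let $0=n_0<n_1<\dots<n_r<n_{r+1}=n$ be integers, and let $\lambda_1\ge\dots\ge\lambda_n$ be real numbers that are constant on each block $n_{j-1}<i\le n_j$ and strictly decrease from each block to the next. Let $\mathcal O_\lambda$ be the $U(n)$-conjugation orbit of $\mathrm{diag}(\lambda_1,\dots,\lambda_n)$ in the Hermitian $n\times n$ matrices, with the Kirillov–Kostant–Souriau form $\omega_h([X,h],[Y,h])=\mathrm{tr}(ih[X,Y])$, $X,Y\in\mathfrak u(n)$. For $i,j\ge1$ with $i+j\le n+1$ let $\Phi^{i,j}_\lambda(x)$ be the $i$-th largest eigenvalue of the leading principal $(i+j-1)\times(i+j-1)$ submatrix of $x\in\mathcal O_\lambda$, and let $\Phi_\lambda=(\Phi_\lambda^{i,j})$ be the Gelfand–Cetlin system. The Gelfand–Cetlin polytope $\Delta_\lambda$ is the set of $u=(u_{i,j})$ with $u_{j,n+1-j}=\lambda_j$ and $u_{i,j+1}\ge u_{i,j}\ge u_{i+1,j}$. The ladder diagram $\Gamma_\lambda$ is the subgraph of the square grid on $\mathbb Z^2$ induced by the vertices in $\bigcup_{j=0}^r[n_j,n_{j+1}]\times[0,n-n_{j+1}]$.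 Its top vertices are those with $a+b=n$, a positive path is a shortest path in $\Gamma_\lambda$ from the origin to a top vertex, and a face $\gamma$ of $\Gamma_\lambda$ is a subgraph that is a union of positive paths and contains all top vertices. Put $u_{i,j}$ in the unit box with top-right vertex $(i,j)$. The face $f_\gamma$ of $\Delta_\lambda$ is the set of $u\in\Delta_\lambda$ such that the entries in any two adjacent boxes whose common edge is not in $\gamma$ are equal. For $k\ge1$ let $W_k$ be the union of the unit boxes with top-right vertex $(a,b)$, $a,b\ge1$, $k+1\le a+b\le k+2$. Its bottom vertices are its lattice points closest to the origin in the taxicab metric. Let $M_k$ be $W_k$ without the boxes at $(k+1,1)$ and $(1,k+1)$, taken up to translation. The edges of $\gamma$ interior to $W_k$ cut $W_k$ into regions $D$. Put $S_k(D)=S^{2\ell-1}$ if $D$ is an $M_\ell$-block containing a bottom vertex of $W_k$, let $S_k(D)$ be a point otherwise, and put $S_k(\gamma)=\prod_D S_k(D)$. Theorem. Every $u\in\Delta_\lambda$ lies in the relative interior of $f_\gamma$ for some face $\gamma$ of $\Gamma_\lambda$. If $\gamma$ is a face of $\Gamma_\lambda$ and $u$ lies in the relative interior of $f_\gamma$,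 then the fiber $\Phi_\lambda^{-1}(u)$ is an isotropic submanifold of $(\mathcal O_\lambda,\omega_\lambda)$ of dimension $\sum_{k=1}^{n-1}\dim S_k(\gamma)$, and it is the total space of an iterated bundle \[ \Phi_\lambda^{-1}(u)\cong E_{n-1}\xrightarrow{p_{n-1}}E_{n-2}\to\dots\xrightarrow{p_2}E_1\xrightarrow{p_1}E_0=\mathrm{point}, \] in which $p_k$ is a smooth fiber bundle with fiber $S_k(\gamma)$ for $k=1,\dots,n-1$. Two fibers $\Phi_\lambda^{-1}(u_1)$, $\Phi_\lambda^{-1}(u_2)$ are diffeomorphic whenever $u_1,u_2$ lie in the relative interior of the same face of $\Delta_\lambda$ (the same $f_\gamma$, or the same exposed face). -/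

import Mathlib

open Set Filter Topology
open scoped ContDiff Matrix

attribute [local instance] Matrix.normedAddCommGroup Matrix.normedSpace

noncomputable section

/-! ### Smooth manifolds as subsets of normed spaces

All manifolds here are embedded in finite-dimensional real vector spaces.  A map between subsets is
smooth when it is `C^∞` on the source subset (for submanifolds this is the same as being the
restriction of a smooth map near each point). -/

/-- Two subsets of normed spaces are diffeomorphic: there are mutually inverse bijections between
them that are smooth in both directions. -/
def Diffeomorphic {V W : Type*} [NormedAddCommGroup V] [NormedSpace ℝ V]
    [NormedAddCommGroup W] [NormedSpace ℝ W] (S : Set V) (T : Set W) : Prop :=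
  ∃ (f : V → W) (g : W → V), ContDiffOn ℝ ∞ f S ∧ ContDiffOn ℝ ∞ g T ∧
    MapsTo f S T ∧ MapsTo g T S ∧ LeftInvOn g f S ∧ RightInvOn g f T

/-- `S` is a smooth embedded submanifold of dimension `d`: every point of `S` has a neighbourhood in
`S` that is diffeomorphic to an open subset of `ℝ^d`. -/
def IsSmoothSubmanifold {V : Type*} [NormedAddCommGroup V] [NormedSpace ℝ V]
    (d : ℕ) (S : Set V) : Prop :=
  ∀ x ∈ S, ∃ U : Set V, IsOpen U ∧ x ∈ U ∧
    ∃ O : Set (EuclideanSpace ℝ (Fin d)), IsOpen O ∧ Diffeomorphic (S ∩ U) O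

/-- `v` is tangent to `S` at `x`: it is the velocity at time `0` of a smooth curve in `S` that is at
`x` at time `0`. -/
def IsTangentVector {V : Type*} [NormedAddCommGroup V] [NormedSpace ℝ V]
    (S : Set V) (x v : V) : Prop :=
  ∃ c : ℝ → V, ContDiffAt ℝ ∞ c 0 ∧ c 0 = x ∧ (∀ᶠ t in 𝓝 0, c t ∈ S) ∧ HasDerivAt c v 0

/-- `p : E → B` is a smooth fibre bundle with fibre `F`: it is smooth, and over a neighbourhood of
each point of `B` there is a diffeomorphism `E|_U ≅ U × F` over `U`. -/
def IsSmoothFiberBundle {V W Z : Type*} [NormedAddCommGroup V] [NormedSpace ℝ V]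
    [NormedAddCommGroup W] [NormedSpace ℝ W] [NormedAddCommGroup Z] [NormedSpace ℝ Z]
    (p : V → W) (E : Set V) (B : Set W) (F : Set Z) : Prop :=
  ContDiffOn ℝ ∞ p E ∧ MapsTo p E B ∧
    ∀ b ∈ B, ∃ U : Set W, IsOpen U ∧ b ∈ U ∧
      ∃ (f : V → W × Z) (g : W × Z → V),
        ContDiffOn ℝ ∞ f (E ∩ p ⁻¹' U) ∧ ContDiffOn ℝ ∞ g ((B ∩ U) ×ˢ F) ∧
        MapsTo f (E ∩ p ⁻¹' U) ((B ∩ U) ×ˢ F) ∧ MapsTo g ((B ∩ U) ×ˢ F) (E ∩ p ⁻¹' U) ∧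
        LeftInvOn g f (E ∩ p ⁻¹' U) ∧ RightInvOn g f ((B ∩ U) ×ˢ F) ∧
        ∀ x ∈ E ∩ p ⁻¹' U, (f x).1 = p x

/-- `X` is the total space of an iterated bundle `X ≅ E_m → E_{m-1} → ⋯ → E_1 → E_0 = point` of
smooth manifolds, where `E_k → E_{k-1}` is a smooth `F_k`-bundle for `1 ≤ k ≤ m`. -/
def IsIteratedBundle {V : Type*} [NormedAddCommGroup V] [NormedSpace ℝ V] (X : Set V) (m : ℕ)
    {W : ℕ → Type*} [∀ k, NormedAddCommGroup (W k)] [∀ k, NormedSpace ℝ (W k)]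
    (F : ∀ k, Set (W k)) : Prop :=
  ∃ (A : ℕ → Type) (_ : ∀ k, NormedAddCommGroup (A k)) (_ : ∀ k, NormedSpace ℝ (A k))
    (E : ∀ k, Set (A k)) (p : ∀ k, A (k + 1) → A k),
    (∀ k, FiniteDimensional ℝ (A k)) ∧
    (∀ k ≤ m, ∃ d, IsSmoothSubmanifold d (E k)) ∧
    (∃ pt, E 0 = {pt}) ∧
    (∀ k < m, IsSmoothFiberBundle (p k) (E (k + 1)) (E k) (F (k + 1))) ∧
    Diffeomorphic X (E m)

/-! ### Coadjoint orbits and the Kirillov-Kostant-Souriau form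

The dual of `𝔲(n)` is identified with the Hermitian matrices, with `U(n)` acting by conjugation. -/

/-- The coadjoint orbit `O_λ`: the `U(n)`-orbit of the diagonal matrix `diag(λ_1, …, λ_n)`. -/
def coadjointOrbit {n : ℕ} (lam : Fin n → ℝ) : Set (Matrix (Fin n) (Fin n) ℂ) :=
  {x | ∃ g ∈ Matrix.unitaryGroup (Fin n) ℂ,
    x = g * Matrix.diagonal (fun i => (lam i : ℂ)) * gᴴ}

open Classical in
/-- The KKS form at `h`: `ω_h([X,h], [Y,h]) = tr(i h [X,Y])` for `X, Y ∈ 𝔲(n)`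
(see `kksForm_apply`; vectors not tangent to the orbit get the value `0`). -/
def kksForm {n : ℕ} (h v w : Matrix (Fin n) (Fin n) ℂ) : ℝ :=
  if H : (∃ X : Matrix (Fin n) (Fin n) ℂ, Xᴴ = -X ∧ X * h - h * X = v) ∧
      (∃ Y : Matrix (Fin n) (Fin n) ℂ, Yᴴ = -Y ∧ Y * h - h * Y = w) then
    (Complex.I * (h * (H.1.choose * H.2.choose - H.2.choose * H.1.choose)).trace).re
  else 0

/-- The KKS form is well defined. -/
theorem kksForm_apply {n : ℕ} (h X Y : Matrix (Fin n) (Fin n) ℂ) (hX : Xᴴ = -X) (hY : Yᴴ = -Y) :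
    kksForm h (X * h - h * X) (Y * h - h * Y) =
      (Complex.I * (h * (X * Y - Y * X)).trace).re := by
  have key : ∀ A B : Matrix (Fin n) (Fin n) ℂ,
      (h * (A * B - B * A)).trace = -((A * h - h * A) * B).trace := by
    intro A B
    have h1 : (h * (B * A)).trace = (A * h * B).trace := by
      rw [← Matrix.mul_assoc, Matrix.trace_mul_comm, Matrix.mul_assoc]
    simp only [Matrix.mul_sub, Matrix.sub_mul, Matrix.trace_sub, h1, Matrix.mul_assoc]
    ring
  have key2 : ∀ A B : Matrix (Fin n) (Fin n) ℂ,
      (h * (A * B - B * A)).trace = ((B * h - h * B) * A).trace := by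
    intro A B
    have := key B A
    rw [← neg_sub, Matrix.mul_neg, Matrix.trace_neg, this, neg_neg]
  have H : (∃ X' : Matrix (Fin n) (Fin n) ℂ, X'ᴴ = -X' ∧ X' * h - h * X' = X * h - h * X) ∧
      (∃ Y' : Matrix (Fin n) (Fin n) ℂ, Y'ᴴ = -Y' ∧ Y' * h - h * Y' = Y * h - h * Y) :=
    ⟨⟨X, hX, rfl⟩, ⟨Y, hY, rfl⟩⟩
  rw [kksForm, dif_pos H, key, H.1.choose_spec.2, ← key, key2, H.2.choose_spec.2, ← key2]

/-- `S` is a `d`-dimensional isotropic submanifold of `(O_λ, ω_λ)`.  (A subset of the submanifold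
`O_λ` is a submanifold of it exactly when it is a submanifold of the ambient vector space.) -/
def IsIsotropicSubmanifold {n : ℕ} (lam : Fin n → ℝ) (d : ℕ)
    (S : Set (Matrix (Fin n) (Fin n) ℂ)) : Prop :=
  S ⊆ coadjointOrbit lam ∧ IsSmoothSubmanifold d S ∧
    ∀ x ∈ S, ∀ v w, IsTangentVector S x v → IsTangentVector S x w → kksForm x v w = 0

/-! ### The Gelfand-Cetlin system and polytope -/

/-- The index set `{(i,j) | i, j ≥ 1, i + j ≤ n + 1}`. -/
abbrev GCIndex (n : ℕ) : Type := {p : ℕ × ℕ // 1 ≤ p.1 ∧ 1 ≤ p.2 ∧ p.1 + p.2 ≤ n + 1}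

/-- The `k × k` leading principal submatrix `x^{(k)}`. -/
def leadingSubmatrix {n : ℕ} (x : Matrix (Fin n) (Fin n) ℂ) (k : ℕ) (hk : k ≤ n) :
    Matrix (Fin k) (Fin k) ℂ :=
  x.submatrix (Fin.castLE hk) (Fin.castLE hk)

open Classical in
/-- The eigenvalues of a Hermitian matrix in descending order (so index `0` is the largest), with
multiplicity. -/
def sortedEigenvalue {k : ℕ} (A : Matrix (Fin k) (Fin k) ℂ) (i : Fin k) : ℝ :=
  if hA : A.IsHermitian then hA.eigenvalues₀ (Fin.cast (Fintype.card_fin k).symm i) else 0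

/-- The Gelfand-Cetlin system: `Φ^{i,j}(x)` is the `i`-th largest eigenvalue of `x^{(i+j-1)}`. -/
def gcSystem {n : ℕ} (x : Matrix (Fin n) (Fin n) ℂ) (p : GCIndex n) : ℝ :=
  sortedEigenvalue
    (leadingSubmatrix x (p.1.1 + p.1.2 - 1) (by have := p.2; omega))
    ⟨p.1.1 - 1, by have := p.2; omega⟩

/-- The fibre `Φ_λ^{-1}(u)` of the Gelfand-Cetlin system on `O_λ`. -/
def gcFiber {n : ℕ} (lam : Fin n → ℝ) (u : GCIndex n → ℝ) : Set (Matrix (Fin n) (Fin n) ℂ) :=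
  {x ∈ coadjointOrbit lam | gcSystem x = u}

/-- The Gelfand-Cetlin polytope `Δ_λ`: all `u` with `u_{j,n+1-j} = λ_j` and
`u_{i,j+1} ≥ u_{i,j} ≥ u_{i+1,j}`. -/
def gcPolytope {n : ℕ} (lam : Fin n → ℝ) : Set (GCIndex n → ℝ) :=
  {u | (∀ (j : Fin n) (p : GCIndex n), p.1 = ((j : ℕ) + 1, n - (j : ℕ)) → u p = lam j) ∧
    (∀ p q : GCIndex n, q.1 = (p.1.1, p.1.2 + 1) → u p ≤ u q) ∧
    (∀ p q : GCIndex n, q.1 = (p.1.1 + 1, p.1.2) → u q ≤ u p)}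

/-! ### Ladder diagrams and their faces -/

/-- The square grid graph on `ℤ²`. -/
def gridGraph : SimpleGraph (ℤ × ℤ) where
  Adj v w := |v.1 - w.1| + |v.2 - w.2| = 1
  symm := ⟨fun v w h => by rw [abs_sub_comm w.1, abs_sub_comm w.2]; exact h⟩
  loopless := ⟨fun v h => by simp at h⟩

/-- The vertices of the ladder diagram `Γ(n_1, …, n_r; n)`, where `0 = n_0 < n_1 < ⋯ < n_{r+1} = n`
is the sequence `N`. -/
def ladderVertices {r : ℕ} (n : ℕ) (N : Fin (r + 2) → ℕ) : Set (ℤ × ℤ) :=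
  {v | ∃ j : Fin (r + 1), (N j.castSucc : ℤ) ≤ v.1 ∧ v.1 ≤ N j.succ ∧
    0 ≤ v.2 ∧ v.2 ≤ (n : ℤ) - N j.succ}

/-- The ladder diagram, as an induced subgraph of the grid. -/
def ladderDiagram {r : ℕ} (n : ℕ) (N : Fin (r + 2) → ℕ) : gridGraph.Subgraph :=
  (⊤ : gridGraph.Subgraph).induce (ladderVertices n N)

/-- Top vertices of the ladder diagram. -/
def IsTopVertex {r : ℕ} (n : ℕ) (N : Fin (r + 2) → ℕ) (v : ℤ × ℤ) : Prop :=
  v ∈ ladderVertices n N ∧ v.1 + v.2 = n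

/-- A positive path: a shortest path in the ladder diagram from the origin to a top vertex. -/
def IsPositivePath {r : ℕ} (n : ℕ) (N : Fin (r + 2) → ℕ) {t : ℤ × ℤ}
    (P : gridGraph.Walk (0, 0) t) : Prop :=
  IsTopVertex n N t ∧ P.toSubgraph ≤ ladderDiagram n N ∧
    ∀ Q : gridGraph.Walk (0, 0) t, Q.toSubgraph ≤ ladderDiagram n N → P.length ≤ Q.length

/-- A face of the ladder diagram: a union of positive paths containing all top vertices. -/
def IsLadderFace {r : ℕ} (n : ℕ) (N : Fin (r + 2) → ℕ) (γ : gridGraph.Subgraph) : Prop :=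
  (∀ t, IsTopVertex n N t → t ∈ γ.verts) ∧
    ∃ paths : Set (Σ t : ℤ × ℤ, gridGraph.Walk (0, 0) t),
      (∀ P ∈ paths, IsPositivePath n N P.2) ∧ γ = ⨆ P ∈ paths, P.2.toSubgraph

/-- The unit boxes with top-right vertices `p` and `q` share an edge, `q` being to the right of `p`
or above `p`, and this common edge does not belong to `γ`. -/
def Undivided (γ : gridGraph.Subgraph) (p q : ℤ × ℤ) : Prop :=
  (q = (p.1 + 1, p.2) ∧ ¬ γ.Adj (p.1, p.2 - 1) (p.1, p.2)) ∨
    (q = (p.1, p.2 + 1) ∧ ¬ γ.Adj (p.1 - 1, p.2) (p.1, p.2))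

/-- The box of the plane that carries the variable `u_{i,j}`. -/
def GCIndex.box {n : ℕ} (p : GCIndex n) : ℤ × ℤ := ((p.1.1 : ℤ), (p.1.2 : ℤ))

/-- The face `f_γ = Ψ(γ)` of `Δ_λ`: the variables in adjacent boxes not divided by `γ` agree. -/
def gcFace {n : ℕ} (lam : Fin n → ℝ) (γ : gridGraph.Subgraph) : Set (GCIndex n → ℝ) :=
  {u ∈ gcPolytope lam | ∀ p q : GCIndex n, Undivided γ p.box q.box → u p = u q}

/-! ### `W`-shaped blocks, `M`-shaped blocks and the spaces `S_k(γ)`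

A union of unit boxes is recorded by the set of the top-right vertices of the boxes. -/

/-- The block `W_k`. -/
def wBlock (k : ℕ) : Set (ℤ × ℤ) :=
  {p | 1 ≤ p.1 ∧ 1 ≤ p.2 ∧ (k : ℤ) + 1 ≤ p.1 + p.2 ∧ p.1 + p.2 ≤ (k : ℤ) + 2}

/-- The block `M_l`, in its standard position. -/
def mBlock (l : ℕ) : Set (ℤ × ℤ) :=
  {p | 1 ≤ p.1 ∧ 1 ≤ p.2 ∧ (l : ℤ) + 1 ≤ p.1 + p.2 ∧ p.1 + p.2 ≤ (l : ℤ) + 2 ∧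
    p ≠ ((l : ℤ) + 1, 1) ∧ p ≠ (1, (l : ℤ) + 1)}

/-- The lattice points lying in a union of boxes. -/
def latticePoints (D : Set (ℤ × ℤ)) : Set (ℤ × ℤ) :=
  {v | ∃ p ∈ D, (v.1 = p.1 - 1 ∨ v.1 = p.1) ∧ (v.2 = p.2 - 1 ∨ v.2 = p.2)}

/-- The bottom vertices of `W_k`: its lattice points closest to the origin. -/
def bottomVertices (k : ℕ) : Set (ℤ × ℤ) :=
  {v ∈ latticePoints (wBlock k) | ∀ w ∈ latticePoints (wBlock k), |v.1| + |v.2| ≤ |w.1| + |w.2|}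

/-- Boxes of `W_k`, joined when they share an edge that is not a wall. -/
def wallGraph (γ : gridGraph.Subgraph) (k : ℕ) : SimpleGraph (wBlock k) where
  Adj p q := Undivided γ p.1 q.1 ∨ Undivided γ q.1 p.1
  symm := ⟨fun _ _ h => h.symm⟩
  loopless := ⟨fun p h => by
    have aux : ¬ Undivided γ p.1 p.1 := by
      rintro (⟨h, -⟩ | ⟨h, -⟩)
      · have := congrArg Prod.fst h; simp at this
      · have := congrArg Prod.snd h; simp at this
    exact h.elim aux aux⟩

/-- The regions into which the walls of `γ` divide `W_k`. -/
abbrev Region (γ : gridGraph.Subgraph) (k : ℕ) : Type := (wallGraph γ k).ConnectedComponent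

/-- The set of boxes of a region. -/
def Region.boxes {γ : gridGraph.Subgraph} {k : ℕ} (D : Region γ k) : Set (ℤ × ℤ) :=
  Subtype.val '' D.supp

instance wBlock_finite (k : ℕ) : Finite (wBlock k) := by
  refine Set.Finite.to_subtype ((Set.finite_Icc ((0 : ℤ), (0 : ℤ)) ((k : ℤ) + 2, (k : ℤ) + 2)).subset ?_)
  rintro ⟨a, b⟩ ⟨h1, h2, h3, h4⟩
  simp only [Set.mem_Icc, Prod.mk_le_mk] at *
  omega

instance Region.fintype (γ : gridGraph.Subgraph) (k : ℕ) : Fintype (Region γ k) :=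
  @Fintype.ofFinite _ (Finite.of_surjective _ Quot.mk_surjective)

/-- `D` is (a translate of) the block `M_l`, and it contains a bottom vertex of `W_k`. -/
def Region.IsSphereBlock {γ : gridGraph.Subgraph} {k : ℕ} (D : Region γ k) (l : ℕ) : Prop :=
  1 ≤ l ∧ (∃ t : ℤ × ℤ, D.boxes = (fun p => p + t) '' mBlock l) ∧
    (latticePoints D.boxes ∩ bottomVertices k).Nonempty

/-- The number `l` for which `D` is an `M_l`-block containing a bottom vertex of `W_k`, and `0` if
there is none. -/
def Region.size {γ : gridGraph.Subgraph} {k : ℕ} (D : Region γ k) : ℕ :=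
  sInf {l | D.IsSphereBlock l}

/-- The space `S_k(D)`: the sphere `S^{2l-1}` in `ℝ^{2l}` if `D` is an `M_l`-block containing a
bottom vertex of `W_k`, and otherwise the one-point space `ℝ^0`. -/
def Region.space {γ : gridGraph.Subgraph} {k : ℕ} (D : Region γ k) :
    Set (EuclideanSpace ℝ (Fin (2 * D.size))) :=
  {z | D.size ≠ 0 → ‖z‖ = 1}

/-- The ambient vector space of `S_k(γ)`. -/
abbrev BlockAmbient (γ : gridGraph.Subgraph) (k : ℕ) : Type :=
  ∀ D : Region γ k, EuclideanSpace ℝ (Fin (2 * D.size))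

/-- The space `S_k(γ) = ∏_D S_k(D)`. -/
def blockSpace (γ : gridGraph.Subgraph) (k : ℕ) : Set (BlockAmbient γ k) :=
  {z | ∀ D, z D ∈ D.space}

/-- The dimension of `S_k(γ)`; a one-point factor has size `0` and contributes `2 * 0 - 1 = 0`. -/
def blockDim (γ : gridGraph.Subgraph) (k : ℕ) : ℕ :=
  ∑ D : Region γ k, (2 * D.size - 1)

end

/-! ### Smooth sets -/

section SmoothSets

variable {V W Z : Type*} [NormedAddCommGroup V] [NormedSpace ℝ V]
  [NormedAddCommGroup W] [NormedSpace ℝ W] [NormedAddCommGroup Z] [NormedSpace ℝ Z]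

/-! The fibre over `u` is the top of a tower: it consists of the Hermitian matrices all of whose
leading blocks have prescribed spectra (`gcFiber_eq_gcTower`), and deleting the last row and column
descends one level. Consecutive levels are compared by a Schur complement. If `y` has spectrum `ν`
and is bordered by a column `b` and a corner `d`, the new characteristic polynomial is that of `y`
times `t - d - ∑ |P_c b|² / (t - c)`, with `P_c` the spectral projections
(`HasSpectrum.eval_charpoly_bordered`). By uniqueness of partial fractions, prescribing the new
spectrum `μ` fixes `d` and every `|P_c b|² = R c`. Interlacing gives `R c > 0` when `c` is more
frequent in `ν` than in `μ`, and `R c = 0` otherwise (`Interlacing.exists_weights`). Hence the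
possible `b` form a product of spheres `S^{2l-1}`, one in each eigenspace of positive weight, `l`
being its complex dimension; transporting eigenspaces makes this locally trivial in `y`
(`isSmoothFiberBundle_lead`).

The combinatorics identifies these spheres with `M_l`-blocks. In the relative interior of `f_γ` the
walls of `γ` separate exactly the unequal neighbouring entries
(`wall_iff_of_mem_intrinsicInterior`), so the regions of `W_k` are the level sets of rows `k` and `k
+ 1` together. An `M_l`-block at the bottom of `W_k` is a value occurring `l` times in row `k` and
`l - 1` times in row `k + 1`. Conversely, the level curves of any point of the polytope form a
suitable `γ`.

Isotropy is an induction on the size: a tangent vector to the fibre at `x` has the form `[X, x]`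
with `X` in the smaller unitary Lie algebra (`exists_skew_of_tangent`), so the KKS pairing reduces
to that of the leading blocks.

For the diffeomorphisms, equal patterns of equalities give a polynomial `p` carrying two consecutive
rows of one array to those of the other. The matrix `p(x)` has the right spectrum, but its leading
block need not be `p` of the leading block. The discrepancy lives on the span of the last basis
vector and the components of `b` of positive weight, where `x` acts by an arrow matrix not depending
on `x`. One constant unitary `T` on that span corrects it (`exists_arrow_transform`), and the
leading block is treated recursively (`Intertwines`). -/

theorem Diffeomorphic.refl (S : Set V) : Diffeomorphic S S :=
  ⟨id, id, contDiffOn_id, contDiffOn_id, mapsTo_id _, mapsTo_id _, fun _ _ => rfl, fun _ _ => rfl⟩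

theorem Diffeomorphic.trans {S : Set V} {T : Set W} {R : Set Z} (h : Diffeomorphic S T)
    (h' : Diffeomorphic T R) : Diffeomorphic S R := by
  obtain ⟨f, g, hf, hg, mf, mg, l, r⟩ := h
  obtain ⟨f', g', hf', hg', mf', mg', l', r'⟩ := h'
  refine ⟨f' ∘ f, g ∘ g', hf'.comp hf mf, hg.comp hg' mg', mf'.comp mf, mg.comp mg', ?_, ?_⟩
  · intro x hx
    simp only [Function.comp]
    rw [l' (mf hx), l hx]
  · intro x hx
    simp only [Function.comp]
    rw [r (mg' hx), r' hx]

theorem Diffeomorphic.prod {V' W' : Type*} [NormedAddCommGroup V'] [NormedSpace ℝ V']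
    [NormedAddCommGroup W'] [NormedSpace ℝ W'] {S : Set V} {T : Set W} {S' : Set V'} {T' : Set W'}
    (h : Diffeomorphic S T) (h' : Diffeomorphic S' T') : Diffeomorphic (S ×ˢ S') (T ×ˢ T') := by
  obtain ⟨f, g, hf, hg, mf, mg, l, r⟩ := h
  obtain ⟨f', g', hf', hg', mf', mg', l', r'⟩ := h'
  refine ⟨Prod.map f f', Prod.map g g', ?_, ?_, ?_, ?_, ?_, ?_⟩
  · exact (hf.comp contDiffOn_fst fun x hx => hx.1).prodMk
      (hf'.comp contDiffOn_snd fun x hx => hx.2)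
  · exact (hg.comp contDiffOn_fst fun x hx => hx.1).prodMk
      (hg'.comp contDiffOn_snd fun x hx => hx.2)
  · exact fun x hx => ⟨mf hx.1, mf' hx.2⟩
  · exact fun x hx => ⟨mg hx.1, mg' hx.2⟩
  · exact fun x hx => Prod.ext (l hx.1) (l' hx.2)
  · exact fun x hx => Prod.ext (r hx.1) (r' hx.2)

theorem Diffeomorphic.exists_inter_open {S : Set V} {T : Set W} (h : Diffeomorphic S T)
    {U : Set V} (hU : IsOpen U) : ∃ U' : Set W, IsOpen U' ∧ Diffeomorphic (S ∩ U) (T ∩ U') := by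
  obtain ⟨f, g, hf, hg, mf, mg, l, r⟩ := h
  obtain ⟨U', hU', e⟩ := (continuousOn_iff'.1 hg.continuousOn) U hU
  have e' : ∀ y ∈ T, (y ∈ U' ↔ g y ∈ U) := fun y hy => by
    have := congrArg (y ∈ ·) e
    simpa [hy] using this.symm
  refine ⟨U', hU', f, g, hf.mono inter_subset_left, hg.mono inter_subset_left, ?_, ?_, ?_, ?_⟩
  · intro x hx
    refine ⟨mf hx.1, (e' _ (mf hx.1)).2 ?_⟩
    rw [l hx.1]; exact hx.2
  · exact fun y hy => ⟨mg hy.1, (e' _ hy.1).1 hy.2⟩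
  · exact fun x hx => l hx.1
  · exact fun x hx => r hx.1

theorem Diffeomorphic.exists_euclidean [FiniteDimensional ℝ Z] {d : ℕ}
    (hd : Module.finrank ℝ Z = d) {S : Set V} {O : Set Z} (hO : IsOpen O) (D : Diffeomorphic S O) :
    ∃ O' : Set (EuclideanSpace ℝ (Fin d)), IsOpen O' ∧ Diffeomorphic S O' := by
  let e : Z ≃L[ℝ] EuclideanSpace ℝ (Fin d) := ContinuousLinearEquiv.ofFinrankEq (by simp [hd])
  refine ⟨e.symm ⁻¹' O, hO.preimage e.symm.continuous, D.trans ?_⟩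
  refine ⟨e, e.symm, e.contDiff.contDiffOn, e.symm.contDiff.contDiffOn, ?_, ?_, ?_, ?_⟩
  · intro y hy; simpa using hy
  · intro y hy; exact hy
  · intro y _; simp
  · intro y _; simp

theorem isSmoothSubmanifold_of_charts [FiniteDimensional ℝ Z] {d : ℕ}
    (hd : Module.finrank ℝ Z = d) {S : Set V}
    (h : ∀ x ∈ S, ∃ U : Set V, IsOpen U ∧ x ∈ U ∧ ∃ O : Set Z, IsOpen O ∧ Diffeomorphic (S ∩ U) O) :
    IsSmoothSubmanifold d S := by
  intro x hx
  obtain ⟨U, hU, hxU, O, hO, D⟩ := h x hx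
  exact ⟨U, hU, hxU, D.exists_euclidean hd hO⟩

/-- A local trivialisation followed by a chart of the base times a chart of the fibre is a chart of
the total space. The domains involved are open only relative to `E` or to the trivialised part, so
continuity is used to produce the ambient open sets `A` and `A'`. -/
theorem IsSmoothFiberBundle.isSmoothSubmanifold {p : V → W} {E : Set V} {B : Set W} {F : Set Z}
    (h : IsSmoothFiberBundle p E B F) {d e : ℕ} (hB : IsSmoothSubmanifold d B)
    (hF : IsSmoothSubmanifold e F) : IsSmoothSubmanifold (d + e) E := by
  obtain ⟨hp, mp, h⟩ := h
  refine isSmoothSubmanifold_of_charts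
    (Z := EuclideanSpace ℝ (Fin d) × EuclideanSpace ℝ (Fin e)) (by simp) ?_
  intro x hx
  obtain ⟨U, hU, hbU, f, g, hf, hg, mf, mg, l, r, hfp⟩ := h (p x) (mp hx)
  have hxU : x ∈ E ∩ p ⁻¹' U := ⟨hx, hbU⟩
  obtain ⟨U₁, hU₁, h₁, O₁, hO₁, D₁⟩ := hB (p x) (mp hx)
  obtain ⟨U₂, hU₂, h₂, O₂, hO₂, D₂⟩ := hF (f x).2 (mf hxU).2
  obtain ⟨A, hA, eA⟩ := (continuousOn_iff'.1 hp.continuousOn) U hU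
  obtain ⟨A', hA', eA'⟩ := (continuousOn_iff'.1 hf.continuousOn) (U₁ ×ˢ U₂) (hU₁.prod hU₂)
  obtain ⟨U', hU', D⟩ := (D₁.prod D₂).exists_inter_open (hU.prod isOpen_univ)
  have hAx : ∀ y ∈ E, (y ∈ A ↔ p y ∈ U) := fun y hy => by
    have := congrArg (y ∈ ·) eA
    simpa [hy] using this.symm
  have hAx' : ∀ y ∈ E ∩ p ⁻¹' U, (y ∈ A' ↔ f y ∈ U₁ ×ˢ U₂) := fun y hy => by
    have := congrArg (y ∈ ·) eA'
    simpa [hy.1, mem_preimage.1 hy.2] using this.symm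
  refine ⟨A ∩ A', hA.inter hA', ⟨(hAx x hx).2 hbU, (hAx' x hxU).2 ⟨?_, h₂⟩⟩, _,
    (hO₁.prod hO₂).inter hU', Diffeomorphic.trans ?_ D⟩
  · rw [hfp x hxU]; exact h₁
  have hsub : E ∩ (A ∩ A') ⊆ E ∩ p ⁻¹' U := fun y hy => ⟨hy.1, (hAx y hy.1).1 hy.2.1⟩
  have hsub' : (B ∩ U₁) ×ˢ (F ∩ U₂) ∩ U ×ˢ univ ⊆ (B ∩ U) ×ˢ F :=
    fun y hy => ⟨⟨hy.1.1.1, hy.2.1⟩, hy.1.2.1⟩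
  refine ⟨f, g, hf.mono hsub, hg.mono hsub', ?_, ?_, fun y hy => l (hsub hy),
    fun y hy => r (hsub' hy)⟩
  · intro y hy
    have h3 := mf (hsub hy)
    have h4 := (hAx' y (hsub hy)).1 hy.2.2
    exact ⟨⟨⟨h3.1.1, h4.1⟩, ⟨h3.2, h4.2⟩⟩, ⟨h3.1.2, mem_univ _⟩⟩
  · intro y hy
    have h3 := mg (hsub' hy)
    refine ⟨h3.1, (hAx _ h3.1).2 h3.2, (hAx' _ h3).2 ?_⟩
    rw [r (hsub' hy)]
    exact ⟨hy.1.1.2, hy.1.2.2⟩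

theorem isSmoothSubmanifold_pi {ι : Type*} [Fintype ι] {V : ι → Type*}
    [∀ i, NormedAddCommGroup (V i)] [∀ i, NormedSpace ℝ (V i)] {S : ∀ i, Set (V i)} {d : ι → ℕ}
    (h : ∀ i, IsSmoothSubmanifold (d i) (S i)) :
    IsSmoothSubmanifold (∑ i, d i) {z : ∀ i, V i | ∀ i, z i ∈ S i} := by
  refine isSmoothSubmanifold_of_charts (Z := ∀ i, EuclideanSpace ℝ (Fin (d i)))
    (by simp [Module.finrank_pi_fintype]) ?_
  intro x hx
  choose U hU hxU O hO f g hf hg mf mg l r using fun i => h i (x i) (hx i)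
  refine ⟨univ.pi U, isOpen_set_pi finite_univ fun i _ => hU i, fun i _ => hxU i,
    univ.pi O, isOpen_set_pi finite_univ fun i _ => hO i,
    fun z i => f i (z i), fun z i => g i (z i), ?_, ?_, ?_, ?_, ?_, ?_⟩
  · exact contDiffOn_pi.2 fun i => (hf i).comp (contDiffOn_pi.1 contDiffOn_id i)
      fun z hz => ⟨hz.1 i, hz.2 i trivial⟩
  · exact contDiffOn_pi.2 fun i => (hg i).comp (contDiffOn_pi.1 contDiffOn_id i)
      fun z hz => hz i trivial
  · exact fun z hz i _ => mf i ⟨hz.1 i, hz.2 i trivial⟩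
  · exact fun z hz => ⟨fun i => (mg i (hz i trivial)).1, fun i _ => (mg i (hz i trivial)).2⟩
  · exact fun z hz => funext fun i => l i ⟨hz.1 i, hz.2 i trivial⟩
  · exact fun z hz => funext fun i => r i (hz i trivial)

open scoped RealInnerProductSpace in
-- The open hemisphere around `z` projects orthogonally onto the unit ball of `zᗮ`; the inverse adds
-- `√(1 - ‖y‖²) • z`, which is smooth because the radicand is positive on the open ball.
theorem isSmoothSubmanifold_sphere {V : Type*} [NormedAddCommGroup V] [InnerProductSpace ℝ V]
    [FiniteDimensional ℝ V] {d : ℕ} (hd : Module.finrank ℝ V = d + 1) :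
    IsSmoothSubmanifold d {z : V | ‖z‖ = 1} := by
  intro z hz
  have hz : ‖z‖ = 1 := hz
  have hz0 : z ≠ 0 := by rintro rfl; simp at hz
  have hzz : ⟪z, z⟫ = 1 := by rw [real_inner_self_eq_norm_sq, hz]; norm_num
  have : Fact (Module.finrank ℝ V = d + 1) := ⟨hd⟩
  let K : Submodule ℝ V := (ℝ ∙ z)ᗮ
  have hfin : Module.finrank ℝ K = d := Submodule.finrank_orthogonal_span_singleton hz0
  have hK : ∀ y : K, ⟪z, (y : V)⟫ = 0 := fun y => Submodule.mem_orthogonal_singleton_iff_inner_right.1 y.2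
  have hpr : ∀ w : V, w - ⟪z, w⟫ • z ∈ K := fun w => by
    rw [Submodule.mem_orthogonal_singleton_iff_inner_right, inner_sub_right, inner_smul_right, hzz]
    ring
  have key : ∀ w : V, ‖w - ⟪z, w⟫ • z‖ ^ 2 = ‖w‖ ^ 2 - ⟪z, w⟫ ^ 2 := fun w => by
    rw [@norm_sub_sq_real, inner_smul_right, norm_smul, hz, real_inner_comm z w, mul_one,
      Real.norm_eq_abs, sq_abs]
    ring
  let P : V →L[ℝ] K := LinearMap.toContinuousLinearMap
    { toFun := fun w => ⟨w - ⟪z, w⟫ • z, hpr w⟩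
      map_add' := fun a b => by
        ext; simp only [inner_add_right, add_smul, Submodule.coe_add]; abel
      map_smul' := fun c a => by
        ext
        simp only [inner_smul_right, mul_smul, smul_sub, RingHom.id_apply, Submodule.coe_smul] }
  have hP : ∀ w, ((P w : K) : V) = w - ⟪z, w⟫ • z := fun _ => rfl
  refine ⟨{w | 0 < ⟪z, w⟫}, isOpen_lt continuous_const (continuous_const.inner continuous_id),
    by simp [hz], ?_⟩
  refine Diffeomorphic.exists_euclidean hfin (O := Metric.ball (0 : K) 1) Metric.isOpen_ball ?_
  have hball : ∀ y ∈ Metric.ball (0 : K) 1, 0 < 1 - ‖y‖ ^ 2 := fun y hy => by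
    have := mem_ball_zero_iff.1 hy
    nlinarith [norm_nonneg y]
  refine ⟨P, fun y => (y : V) + √(1 - ‖y‖ ^ 2) • z, P.contDiff.contDiffOn, ?_, ?_, ?_, ?_, ?_⟩
  · refine K.subtypeL.contDiff.contDiffOn.add (ContDiffOn.smul ?_ contDiffOn_const)
    refine ContDiffOn.sqrt ?_ fun y hy => (hball y hy).ne'
    exact contDiffOn_const.sub (contDiff_norm_sq ℝ).contDiffOn
  · rintro w ⟨hw, hw'⟩
    have hw : ‖w‖ = 1 := hw
    have hw' : 0 < ⟪z, w⟫ := hw'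
    have : ‖P w‖ ^ 2 = 1 - ⟪z, w⟫ ^ 2 := by
      rw [Submodule.coe_norm, hP, key, hw]; norm_num
    rw [mem_ball_zero_iff]
    nlinarith [norm_nonneg (P w)]
  · intro y hy
    have h1 := hball y hy
    constructor
    · have : ‖(y : V) + √(1 - ‖y‖ ^ 2) • z‖ ^ 2 = 1 := by
        rw [@norm_add_sq_real, inner_smul_right, real_inner_comm, hK, norm_smul, hz,
          Real.norm_eq_abs, mul_one, sq_abs, Real.sq_sqrt h1.le, Submodule.coe_norm]
        ring
      exact (pow_eq_one_iff_of_nonneg (norm_nonneg _) two_ne_zero).1 this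
    · change 0 < ⟪z, (y : V) + √(1 - ‖y‖ ^ 2) • z⟫
      rw [inner_add_right, hK, inner_smul_right, hzz, zero_add, mul_one]
      exact Real.sqrt_pos.2 h1
  · rintro w ⟨hw, hw'⟩
    have hw : ‖w‖ = 1 := hw
    have hw' : 0 < ⟪z, w⟫ := hw'
    have : ‖P w‖ ^ 2 = 1 - ⟪z, w⟫ ^ 2 := by
      rw [Submodule.coe_norm, hP, key, hw]; norm_num
    simp only [this, sub_sub_cancel, Real.sqrt_sq hw'.le, hP, sub_add_cancel]
  · intro y hy
    ext
    simp only [hP, inner_add_right, hK, inner_smul_right, hzz, zero_add, mul_one, add_sub_cancel_right]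

end SmoothSets

/-! ### Smooth matrix-valued maps -/

section MatrixSmooth

variable {V : Type*} [NormedAddCommGroup V] [NormedSpace ℝ V] {s : Set V}
  {l m n : Type*} [Fintype l] [Fintype m] [Fintype n] {N : WithTop ℕ∞}

theorem contDiffOn_matrix {f : V → Matrix m n ℂ} :
    ContDiffOn ℝ N f s ↔ ∀ i j, ContDiffOn ℝ N (fun x => f x i j) s :=
  contDiffOn_pi.trans (forall_congr' fun _ => contDiffOn_pi)

theorem ContDiffOn.entry {f : V → Matrix m n ℂ} (hf : ContDiffOn ℝ N f s) (i : m) (j : n) :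
    ContDiffOn ℝ N (fun x => f x i j) s :=
  contDiffOn_matrix.1 hf i j

theorem ContDiffOn.complex_star {f : V → ℂ} (hf : ContDiffOn ℝ N f s) :
    ContDiffOn ℝ N (fun x => star (f x)) s :=
  Complex.conjCLE.contDiff.comp_contDiffOn hf

theorem ContDiffOn.matrix_mul {f : V → Matrix l m ℂ} {g : V → Matrix m n ℂ}
    (hf : ContDiffOn ℝ N f s) (hg : ContDiffOn ℝ N g s) :
    ContDiffOn ℝ N (fun x => f x * g x) s :=
  contDiffOn_matrix.2 fun i j => by
    simp only [Matrix.mul_apply]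
    exact ContDiffOn.sum fun k _ => (hf.entry i k).mul (hg.entry k j)

theorem ContDiffOn.matrix_mulVec {f : V → Matrix l m ℂ} {g : V → m → ℂ}
    (hf : ContDiffOn ℝ N f s) (hg : ContDiffOn ℝ N g s) :
    ContDiffOn ℝ N (fun x => f x *ᵥ g x) s :=
  contDiffOn_pi.2 fun i => by
    simp only [Matrix.mulVec, dotProduct]
    exact ContDiffOn.sum fun k _ => (hf.entry i k).mul (contDiffOn_pi.1 hg k)

theorem ContDiffOn.matrix_conjTranspose {f : V → Matrix m n ℂ} (hf : ContDiffOn ℝ N f s) :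
    ContDiffOn ℝ N (fun x => (f x)ᴴ) s :=
  contDiffOn_matrix.2 fun i j => (hf.entry j i).complex_star

theorem ContDiffOn.matrix_pow [DecidableEq n] {f : V → Matrix n n ℂ} (hf : ContDiffOn ℝ N f s) (k : ℕ) :
    ContDiffOn ℝ N (fun x => f x ^ k) s := by
  induction k with
  | zero => simpa using contDiffOn_const
  | succ k ih => simp only [pow_succ]; exact ih.matrix_mul hf

theorem ContDiffOn.matrix_aeval [DecidableEq n] {f : V → Matrix n n ℂ} (hf : ContDiffOn ℝ N f s)
    (p : Polynomial ℝ) : ContDiffOn ℝ N (fun x => Polynomial.aeval (f x) p) s := by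
  induction p using Polynomial.induction_on' with
  | add p q hp hq => simp only [map_add]; exact hp.add hq
  | monomial k a =>
    simp only [Polynomial.aeval_monomial]
    exact contDiffOn_const.matrix_mul (hf.matrix_pow k)

theorem ContDiffOn.matrix_det [DecidableEq n] {f : V → Matrix n n ℂ} (hf : ContDiffOn ℝ N f s) :
    ContDiffOn ℝ N (fun x => (f x).det) s := by
  simp only [Matrix.det_apply']
  exact ContDiffOn.sum fun σ _ => contDiffOn_const.mul
    (contDiffOn_prod fun i _ => hf.entry _ _)

theorem ContDiffOn.matrix_inv [DecidableEq n] {f : V → Matrix n n ℂ} (hf : ContDiffOn ℝ N f s)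
    (h : ∀ x ∈ s, (f x).det ≠ 0) : ContDiffOn ℝ N (fun x => (f x)⁻¹) s := by
  refine contDiffOn_matrix.2 fun i j => ?_
  simp only [Matrix.inv_def, Ring.inverse_eq_inv, Matrix.smul_apply, Matrix.adjugate_apply,
    smul_eq_mul]
  refine (hf.matrix_det.inv h).mul (ContDiffOn.matrix_det (contDiffOn_matrix.2 fun a b => ?_))
  by_cases hab : a = j
  · subst hab; simpa using contDiffOn_const
  · simpa [Matrix.updateRow_apply, hab] using hf.entry a b

end MatrixSmooth

/-! ### Bordered matrices -/

section Bordered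

variable {k m l : ℕ}

/-- The matrix with leading block `A`, last column `b`, last row `r` and last entry `d`. -/
def bordered (A : Matrix (Fin k) (Fin m) ℂ) (b : Fin k → ℂ) (r : Fin m → ℂ) (d : ℂ) :
    Matrix (Fin (k + 1)) (Fin (m + 1)) ℂ :=
  Matrix.of fun i j => Fin.lastCases (motive := fun _ => ℂ)
    (Fin.lastCases (motive := fun _ => ℂ) d r j)
    (fun i' => Fin.lastCases (motive := fun _ => ℂ) (b i') (A i') j) i

@[simp] theorem bordered_castSucc_castSucc (A : Matrix (Fin k) (Fin m) ℂ) (b : Fin k → ℂ)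
    (r : Fin m → ℂ) (d : ℂ) (i : Fin k) (j : Fin m) :
    bordered A b r d i.castSucc j.castSucc = A i j := by simp [bordered]

@[simp] theorem bordered_castSucc_last (A : Matrix (Fin k) (Fin m) ℂ) (b : Fin k → ℂ)
    (r : Fin m → ℂ) (d : ℂ) (i : Fin k) : bordered A b r d i.castSucc (Fin.last m) = b i := by
  simp [bordered]

@[simp] theorem bordered_last_castSucc (A : Matrix (Fin k) (Fin m) ℂ) (b : Fin k → ℂ)
    (r : Fin m → ℂ) (d : ℂ) (j : Fin m) : bordered A b r d (Fin.last k) j.castSucc = r j := by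
  simp [bordered]

@[simp] theorem bordered_last_last (A : Matrix (Fin k) (Fin m) ℂ) (b : Fin k → ℂ)
    (r : Fin m → ℂ) (d : ℂ) : bordered A b r d (Fin.last k) (Fin.last m) = d := by
  simp [bordered]

/-- The matrix without its last row and column. -/
def lead (x : Matrix (Fin (k + 1)) (Fin (m + 1)) ℂ) : Matrix (Fin k) (Fin m) ℂ :=
  x.submatrix Fin.castSucc Fin.castSucc

/-- The last column without its last entry. -/
def lastCol (x : Matrix (Fin (k + 1)) (Fin (m + 1)) ℂ) : Fin k → ℂ :=
  fun i => x i.castSucc (Fin.last m)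

@[simp] theorem lead_bordered (A : Matrix (Fin k) (Fin m) ℂ) (b : Fin k → ℂ)
    (r : Fin m → ℂ) (d : ℂ) : lead (bordered A b r d) = A := by
  ext; simp [lead]

@[simp] theorem lastCol_bordered (A : Matrix (Fin k) (Fin m) ℂ) (b : Fin k → ℂ)
    (r : Fin m → ℂ) (d : ℂ) : lastCol (bordered A b r d) = b := by
  ext; simp [lastCol]

theorem matrix_ext_lastCases {x y : Matrix (Fin (k + 1)) (Fin (m + 1)) ℂ}
    (h₁ : ∀ i j, x (Fin.castSucc i) (Fin.castSucc j) = y i.castSucc j.castSucc)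
    (h₂ : ∀ i, x (Fin.castSucc i) (Fin.last m) = y i.castSucc (Fin.last m))
    (h₃ : ∀ j, x (Fin.last k) (Fin.castSucc j) = y (Fin.last k) j.castSucc)
    (h₄ : x (Fin.last k) (Fin.last m) = y (Fin.last k) (Fin.last m)) : x = y := by
  ext i j
  induction i using Fin.lastCases with
  | last =>
    induction j using Fin.lastCases with
    | last => exact h₄
    | cast j => exact h₃ j
  | cast i =>
    induction j using Fin.lastCases with
    | last => exact h₂ i
    | cast j => exact h₁ i j

theorem bordered_mul (A : Matrix (Fin k) (Fin m) ℂ) (b : Fin k → ℂ) (r : Fin m → ℂ) (d : ℂ)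
    (A' : Matrix (Fin m) (Fin l) ℂ) (b' : Fin m → ℂ) (r' : Fin l → ℂ) (d' : ℂ) :
    bordered A b r d * bordered A' b' r' d' =
      bordered (A * A' + Matrix.vecMulVec b r') (A *ᵥ b' + d' • b) (r ᵥ* A' + d • r')
        (r ⬝ᵥ b' + d * d') := by
  apply matrix_ext_lastCases <;> intros <;>
    simp [Matrix.mul_apply, Fin.sum_univ_castSucc, Matrix.vecMulVec_apply, Matrix.mulVec,
      Matrix.vecMul, dotProduct, mul_comm]

theorem bordered_conjTranspose (A : Matrix (Fin k) (Fin m) ℂ) (b : Fin k → ℂ) (r : Fin m → ℂ)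
    (d : ℂ) : (bordered A b r d)ᴴ = bordered Aᴴ (star r) (star b) (star d) := by
  apply matrix_ext_lastCases <;> intros <;> simp

theorem bordered_add (A A' : Matrix (Fin k) (Fin m) ℂ) (b b' : Fin k → ℂ) (r r' : Fin m → ℂ)
    (d d' : ℂ) : bordered A b r d + bordered A' b' r' d' =
      bordered (A + A') (b + b') (r + r') (d + d') := by
  apply matrix_ext_lastCases <;> intros <;> simp

theorem bordered_sub (A A' : Matrix (Fin k) (Fin m) ℂ) (b b' : Fin k → ℂ) (r r' : Fin m → ℂ)
    (d d' : ℂ) : bordered A b r d - bordered A' b' r' d' =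
      bordered (A - A') (b - b') (r - r') (d - d') := by
  apply matrix_ext_lastCases <;> intros <;> simp

theorem bordered_one : bordered (1 : Matrix (Fin k) (Fin k) ℂ) 0 0 1 = 1 := by
  apply matrix_ext_lastCases <;> intros <;> simp [Matrix.one_apply, Fin.ext_iff] <;> omega

theorem eq_bordered (x : Matrix (Fin (k + 1)) (Fin (m + 1)) ℂ) :
    x = bordered (lead x) (lastCol x) (fun j => x (Fin.last k) j.castSucc)
      (x (Fin.last k) (Fin.last m)) := by
  apply matrix_ext_lastCases <;> intros <;> simp [lead, lastCol]

theorem Matrix.IsHermitian.eq_bordered {x : Matrix (Fin (k + 1)) (Fin (k + 1)) ℂ}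
    (hx : x.IsHermitian) :
    x = bordered (lead x) (lastCol x) (star (lastCol x)) (x (Fin.last k) (Fin.last k)) := by
  apply matrix_ext_lastCases <;> intros <;> simp [lead, lastCol, hx.apply]

theorem trace_bordered (A : Matrix (Fin k) (Fin k) ℂ) (b r : Fin k → ℂ) (d : ℂ) :
    (bordered A b r d).trace = A.trace + d := by
  simp [Matrix.trace, Fin.sum_univ_castSucc]

theorem ContDiffOn.bordered {V : Type*} [NormedAddCommGroup V] [NormedSpace ℝ V] {s : Set V}
    {N : WithTop ℕ∞} {A : V → Matrix (Fin k) (Fin m) ℂ} {b : V → Fin k → ℂ} {r : V → Fin m → ℂ}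
    {d : V → ℂ} (hA : ContDiffOn ℝ N A s) (hb : ContDiffOn ℝ N b s) (hr : ContDiffOn ℝ N r s)
    (hd : ContDiffOn ℝ N d s) : ContDiffOn ℝ N (fun x => _root_.bordered (A x) (b x) (r x) (d x)) s := by
  refine contDiffOn_matrix.2 fun i j => ?_
  induction i using Fin.lastCases with
  | last =>
    induction j using Fin.lastCases with
    | last => simpa using hd
    | cast j => simpa using contDiffOn_pi.1 hr j
  | cast i =>
    induction j using Fin.lastCases with
    | last => simpa using contDiffOn_pi.1 hb i
    | cast j => simpa using hA.entry i j

theorem ContDiffOn.lead {V : Type*} [NormedAddCommGroup V] [NormedSpace ℝ V] {s : Set V}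
    {N : WithTop ℕ∞} {f : V → Matrix (Fin (k + 1)) (Fin (m + 1)) ℂ} (hf : ContDiffOn ℝ N f s) :
    ContDiffOn ℝ N (fun x => _root_.lead (f x)) s :=
  contDiffOn_matrix.2 fun _ _ => hf.entry _ _

theorem ContDiffOn.lastCol {V : Type*} [NormedAddCommGroup V] [NormedSpace ℝ V] {s : Set V}
    {N : WithTop ℕ∞} {f : V → Matrix (Fin (k + 1)) (Fin (m + 1)) ℂ} (hf : ContDiffOn ℝ N f s) :
    ContDiffOn ℝ N (fun x => _root_.lastCol (f x)) s :=
  contDiffOn_pi.2 fun _ => hf.entry _ _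

end Bordered

/-! ### Interlacing sequences and partial fractions -/

section Interlacing

open Polynomial

/-- The multiplicity of `c` among the values of `f`. -/
noncomputable def mult {k : ℕ} (f : Fin k → ℝ) (c : ℝ) : ℕ :=
  Multiset.count c (Finset.univ.val.map f)

/-- `μ` and `ν` interlace: `μ 0 ≥ ν 0 ≥ μ 1 ≥ ν 1 ≥ ⋯`. -/
def Interlacing {k : ℕ} (ν : Fin k → ℝ) (μ : Fin (k + 1) → ℝ) : Prop :=
  ∀ i, ν i ≤ μ i.castSucc ∧ μ i.succ ≤ ν i

theorem mult_eq_card {k : ℕ} (f : Fin k → ℝ) (c : ℝ) :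
    mult f c = (Finset.univ.filter fun i => f i = c).card := by
  rw [mult, Multiset.count_map]
  simp only [eq_comm (a := c)]
  rfl

theorem mult_add_card_gt {k : ℕ} (f : Fin k → ℝ) (c : ℝ) :
    mult f c + (Finset.univ.filter fun i => c < f i).card =
      (Finset.univ.filter fun i => c ≤ f i).card := by
  rw [mult_eq_card, ← Finset.card_union_of_disjoint]
  · congr 1
    ext i
    simp only [Finset.mem_union, Finset.mem_filter, Finset.mem_univ, true_and, le_iff_lt_or_eq,
      eq_comm (a := c), or_comm]
  · exact Finset.disjoint_filter.2 fun i _ h => by simp [h]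

/-- Interlacing, read as counting: for an upward closed set of values, `μ` has as many entries in it
as `ν`, or one more. All comparisons of multiplicities follow from the cases `c < ·` and `c ≤ ·`. -/
theorem Interlacing.card_filter {k : ℕ} {ν : Fin k → ℝ} {μ : Fin (k + 1) → ℝ}
    (h : Interlacing ν μ) (P : ℝ → Prop) [DecidablePred P] (hP : ∀ a b, a ≤ b → P a → P b) :
    (Finset.univ.filter fun i => P (ν i)).card ≤ (Finset.univ.filter fun i => P (μ i)).card ∧
    (Finset.univ.filter fun i => P (μ i)).card ≤
      (Finset.univ.filter fun i => P (ν i)).card + 1 := by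
  constructor
  · refine Finset.card_le_card_of_injOn Fin.castSucc ?_ (Fin.castSucc_injective k).injOn
    intro i hi
    simp only [Finset.coe_filter, Finset.mem_univ, true_and, mem_ofPred_eq] at hi ⊢
    exact hP _ _ (h i).1 hi
  · have : (Finset.univ.filter fun i : Fin k => P (μ i.succ)).card ≤
        (Finset.univ.filter fun i => P (ν i)).card :=
      Finset.card_le_card fun i => by
        simp only [Finset.mem_filter, Finset.mem_univ, true_and]
        exact hP _ _ (h i).2
    rw [Fin.card_filter_univ_succ]
    split_ifs <;> omega

theorem Interlacing.mult_le {k : ℕ} {ν : Fin k → ℝ} {μ : Fin (k + 1) → ℝ}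
    (h : Interlacing ν μ) (c : ℝ) : mult ν c ≤ mult μ c + 1 := by
  have h1 := mult_add_card_gt ν c
  have h2 := mult_add_card_gt μ c
  have h3 := h.card_filter (c < ·) fun a b hab ha => ha.trans_le hab
  have h4 := h.card_filter (c ≤ ·) fun a b hab ha => ha.trans hab
  omega

/-- A multiplicity is the count of entries `≥ c` minus that of entries `> c`. It can drop from `ν`
to `μ` only if the first count stays and the second rises by one. -/
theorem Interlacing.card_gt_of_mult_lt {k : ℕ} {ν : Fin k → ℝ} {μ : Fin (k + 1) → ℝ}
    (h : Interlacing ν μ) {c : ℝ} (hc : mult μ c < mult ν c) :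
    (Finset.univ.filter fun i => c < μ i).card = (Finset.univ.filter fun i => c < ν i).card + 1 := by
  have h1 := mult_add_card_gt ν c
  have h2 := mult_add_card_gt μ c
  have h3 := h.card_filter (c < ·) fun a b hab ha => ha.trans_le hab
  have h4 := h.card_filter (c ≤ ·) fun a b hab ha => ha.trans hab
  omega

theorem neg_one_pow_mul_prod_sub_pos (s : Multiset ℝ) (c : ℝ) (hc : c ∉ s) :
    0 < (-1) ^ (s.countP (c < ·)) * (s.map (c - ·)).prod := by
  induction s using Multiset.induction_on with
  | empty => simp
  | cons a s ih =>
    have h1 := ih fun h => hc (Multiset.mem_cons_of_mem h)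
    have h2 : c ≠ a := fun h => hc (h ▸ Multiset.mem_cons_self a s)
    rw [Multiset.map_cons, Multiset.prod_cons]
    rcases lt_or_gt_of_ne h2 with h3 | h3
    · rw [Multiset.countP_cons_of_pos _ h3, pow_succ]
      nlinarith [mul_pos h1 (sub_pos.2 h3)]
    · rw [Multiset.countP_cons_of_neg _ (not_lt.2 h3.le)]
      nlinarith [mul_pos h1 (sub_pos.2 h3)]

theorem prod_sub_erase_ne_zero (S : Finset ℝ) (c : ℝ) : ∏ x ∈ S.erase c, (c - x) ≠ 0 :=
  Finset.prod_ne_zero_iff.2 fun _ hx => sub_ne_zero.2 (Finset.ne_of_mem_erase hx).symm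

/-- Clearing denominators gives a polynomial with infinitely many zeros; its value at a pole `c` is
`r c` times a nonzero product. -/
theorem eq_zero_of_partialFraction_eq_zero (S : Finset ℝ) (d : ℝ) (r : ℝ → ℝ)
    (h : ∀ t ∉ S, d + ∑ c ∈ S, r c / (t - c) = 0) : d = 0 ∧ ∀ c ∈ S, r c = 0 := by
  set Q : ℝ[X] := C d * ∏ c ∈ S, (X - C c) + ∑ c ∈ S, C (r c) * ∏ x ∈ S.erase c, (X - C x) with hQ
  have hev : ∀ t, Q.eval t = d * ∏ c ∈ S, (t - c) + ∑ c ∈ S, r c * ∏ x ∈ S.erase c, (t - x) := by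
    intro t
    simp [hQ, eval_prod, eval_finsetSum]
  have hQ0 : Q = 0 := by
    refine eq_zero_of_infinite_isRoot Q ((S.finite_toSet.infinite_compl).mono fun t ht => ?_)
    have ht' : t ∉ S := ht
    change Q.eval t = 0
    rw [hev]
    have : ∀ c ∈ S, r c * ∏ x ∈ S.erase c, (t - x) = r c / (t - c) * ∏ x ∈ S, (t - x) := by
      intro c hc
      rw [← Finset.mul_prod_erase S (fun x => t - x) hc]
      have : t - c ≠ 0 := sub_ne_zero.2 fun e => ht' (e ▸ hc)
      field_simp
    rw [Finset.sum_congr rfl this, ← Finset.sum_mul, ← add_mul, h t ht', zero_mul]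
  have hr : ∀ c ∈ S, r c = 0 := by
    intro c hc
    have h1 := hev c
    rw [hQ0, eval_zero, Finset.prod_eq_zero hc (sub_self c), mul_zero, zero_add,
      Finset.sum_eq_single c] at h1
    · exact (mul_eq_zero.1 h1.symm).resolve_right (prod_sub_erase_ne_zero S c)
    · intro b _ hbc
      rw [Finset.prod_eq_zero (Finset.mem_erase.2 ⟨hbc.symm, hc⟩) (sub_self c), mul_zero]
    · exact fun h => absurd hc h
  refine ⟨?_, hr⟩
  obtain ⟨t, ht⟩ := Infinite.exists_notMem_finset S
  have h1 := h t ht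
  rwa [Finset.sum_eq_zero fun c hc => by rw [hr c hc, zero_div], add_zero] at h1

/-- The quotient of the polynomials with roots `μ` and `ν` has only simple poles, because no
multiplicity drops by more than one. It is therefore a monic linear polynomial plus simple
fractions, and counting the roots above a pole gives the sign of its residue. -/
theorem Interlacing.exists_weights {k : ℕ} {ν : Fin k → ℝ} {μ : Fin (k + 1) → ℝ}
    (h : Interlacing ν μ) : ∃ (d : ℝ) (R : ℝ → ℝ), (∀ c, mult μ c < mult ν c → 0 < R c) ∧
      (∀ c, ¬ mult μ c < mult ν c → R c = 0) ∧
      ∀ t ∉ Finset.univ.image ν, ∏ i, (t - μ i) =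
        (∏ i, (t - ν i)) * (t - d - ∑ c ∈ Finset.univ.image ν, R c / (t - c)) := by
  set S := Finset.univ.image ν with hS
  set sν : Multiset ℝ := Finset.univ.val.map ν with hsν
  set sμ : Multiset ℝ := Finset.univ.val.map μ with hsμ
  have hmem : ∀ c, c ∈ S ↔ 0 < sν.count c := fun c => by
    rw [Multiset.count_pos]; simp [hS, hsν]
  have hle : sν ≤ sμ + S.val := by
    rw [Multiset.le_iff_count]
    intro c
    rw [Multiset.count_add]
    by_cases hc : c ∈ S
    · rw [Multiset.count_eq_one_of_mem S.nodup hc]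
      exact h.mult_le c
    · have := (hmem c).not.1 hc
      omega
  -- The reduced numerator: after multiplication by `∏ (t - c)` over the distinct values of `ν`, the
  -- quotient becomes `∏ (t - a)` over `A`. A value of `ν` is missing from `A` exactly when its
  -- multiplicity drops.
  obtain ⟨A, hA⟩ := Multiset.le_iff_exists_add.1 hle
  set Pol : Multiset ℝ → ℝ[X] := fun s => (s.map fun a => X - C a).prod with hPol
  have Pmonic : ∀ s, (Pol s).Monic := fun s => monic_multiset_prod_of_monic _ _ fun a _ => monic_X_sub_C a
  have Pdeg : ∀ s, (Pol s).natDegree = Multiset.card s := fun s => natDegree_multiset_prod_X_sub_C_eq_card s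
  have Peval : ∀ s t, (Pol s).eval t = (s.map (t - ·)).prod := fun s t => by
    rw [hPol, eval_multiset_prod, Multiset.map_map]; simp
  have hcardA : Multiset.card A = S.card + 1 := by
    have := congrArg Multiset.card hA
    simp [hsν, hsμ] at this
    omega
  set q := Pol A /ₘ Pol S.val with hq
  have hdegle : (Pol S.val).degree ≤ (Pol A).degree := by
    rw [degree_eq_natDegree (Pmonic _).ne_zero, degree_eq_natDegree (Pmonic _).ne_zero, Pdeg, Pdeg,
      hcardA, Finset.card_val]
    exact_mod_cast Nat.le_succ _
  have hqm : q.Monic := by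
    rw [Monic, hq, leadingCoeff_divByMonic_of_monic (Pmonic _) hdegle]
    exact Pmonic _
  have hqd : q.natDegree = 1 := by
    rw [hq, natDegree_divByMonic _ (Pmonic _), Pdeg, Pdeg, hcardA, Finset.card_val]
    omega
  have hq1 := hqm.eq_X_add_C hqd
  set d := -q.coeff 0 with hd
  have hrem := modByMonic_add_div (Pol A) (Pol S.val)
  set rem := Pol A %ₘ Pol S.val with hremdef
  have hremdeg : rem.degree < S.card := by
    have := degree_modByMonic_lt (Pol A) (Pmonic S.val)
    rwa [degree_eq_natDegree (Pmonic _).ne_zero, Pdeg, Finset.card_val] at this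
  have hremev : ∀ c ∈ S, rem.eval c = (Pol A).eval c := by
    intro c hc
    rw [← hrem, eval_add, eval_mul, Peval S.val]
    have : (Multiset.map (c - ·) S.val).prod = ∏ x ∈ S, (c - x) := rfl
    rw [this, Finset.prod_eq_zero hc (sub_self c), zero_mul, add_zero]
  -- Minus the residue at `c`, read off from Lagrange interpolation of the remainder; zero away from
  -- the poles.
  set R : ℝ → ℝ := fun c => if c ∈ S then - (Pol A).eval c / ∏ x ∈ S.erase c, (c - x) else 0 with hR
  have hremsum : rem = ∑ c ∈ S, C (- R c) * ∏ x ∈ S.erase c, (X - C x) := by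
    refine eq_of_degrees_lt_of_eval_finset_eq S hremdeg ?_ ?_
    · refine (degree_sum_le _ _).trans_lt ?_
      rw [Finset.sup_lt_iff (by exact WithBot.bot_lt_coe _)]
      intro c hc
      refine (degree_mul_le _ _).trans_lt ?_
      have h1 : (∏ x ∈ S.erase c, (X - C x) : ℝ[X]).degree = ((S.card - 1 : ℕ) : WithBot ℕ) := by
        rw [degree_prod, Finset.sum_congr rfl fun x _ => degree_X_sub_C x]
        simp [Finset.card_erase_of_mem hc]
      have h2 : 0 < S.card := Finset.card_pos.2 ⟨c, hc⟩
      calc _ ≤ (0 : WithBot ℕ) + ((S.card - 1 : ℕ) : WithBot ℕ) := by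
            rw [h1]; exact add_le_add degree_C_le le_rfl
        _ < _ := by rw [zero_add]; exact_mod_cast Nat.sub_lt h2 one_pos
    · intro c hc
      rw [hremev c hc, eval_finsetSum, Finset.sum_eq_single c]
      · simp only [hR, if_pos hc, eval_mul, eval_C, eval_prod, eval_sub, eval_X]
        field_simp [prod_sub_erase_ne_zero S c]
      · intro b _ hbc
        rw [eval_mul, eval_prod, Finset.prod_eq_zero (Finset.mem_erase.2 ⟨hbc.symm, hc⟩) (by simp),
          mul_zero]
      · exact fun h => absurd hc h
  refine ⟨d, R, ?_, ?_, ?_⟩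
  · intro c hc
    have hcS : c ∈ S := (hmem c).2 (Nat.zero_lt_of_lt hc)
    have hcA : c ∉ A := by
      have h1 := congrArg (Multiset.count c) hA
      rw [Multiset.count_add, Multiset.count_add, Multiset.count_eq_one_of_mem S.nodup hcS] at h1
      have : sμ.count c < sν.count c := hc
      exact Multiset.count_eq_zero.1 (by omega)
    have h1 := neg_one_pow_mul_prod_sub_pos A c hcA
    have h2 := neg_one_pow_mul_prod_sub_pos (S.erase c).val c (Finset.notMem_erase c S)
    -- Above `c`, numerator and denominator differ by exactly one root, so their signs at `c` are
    -- opposite and `R c` is positive.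
    have h3 : A.countP (c < ·) = (S.erase c).val.countP (c < ·) + 1 := by
      have h4 := congrArg (Multiset.countP (c < ·)) hA
      have h5 := h.card_gt_of_mult_lt hc
      have h6 : S.val.countP (c < ·) = (S.erase c).val.countP (c < ·) := by
        rw [Finset.erase_val]
        conv_lhs => rw [← Multiset.cons_erase (show c ∈ S.val from hcS)]
        rw [Multiset.countP_cons_of_neg _ (lt_irrefl c)]
      have h7 : sν.countP (c < ·) = (Finset.univ.filter fun i => c < ν i).card := by
        rw [hsν, Multiset.countP_map]; rfl
      have h8 : sμ.countP (c < ·) = (Finset.univ.filter fun i => c < μ i).card := by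
        rw [hsμ, Multiset.countP_map]; rfl
      rw [Multiset.countP_add, Multiset.countP_add] at h4
      omega
    have h9 : R c = - (A.map (c - ·)).prod / ((S.erase c).val.map (c - ·)).prod := by
      simp only [hR, if_pos hcS, Peval]; rfl
    rw [h9]
    set a := (A.map (c - ·)).prod
    set b := ((S.erase c).val.map (c - ·)).prod
    rw [h3, pow_succ] at h1
    rcases neg_one_pow_eq_or ℝ ((S.erase c).val.countP (c < ·)) with h10 | h10 <;> rw [h10] at h1 h2
    · exact div_pos (by linarith) (by linarith)
    · exact div_pos_of_neg_of_neg (by linarith) (by linarith)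
  · intro c hc
    by_cases hcS : c ∈ S
    · simp only [hR, if_pos hcS, Peval]
      have hcA : c ∈ A := by
        have h1 := congrArg (Multiset.count c) hA
        rw [Multiset.count_add, Multiset.count_add, Multiset.count_eq_one_of_mem S.nodup hcS] at h1
        have : ¬ sμ.count c < sν.count c := hc
        exact Multiset.count_pos.1 (by omega)
      rw [Multiset.prod_eq_zero (Multiset.mem_map.2 ⟨c, hcA, sub_self c⟩), neg_zero, zero_div]
    · simp [hR, hcS]
  · intro t ht
    have h1 : ∏ i, (t - μ i) = (sμ.map (t - ·)).prod := by rw [hsμ, Multiset.map_map]; rfl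
    have h2 : ∏ i, (t - ν i) = (sν.map (t - ·)).prod := by rw [hsν, Multiset.map_map]; rfl
    have h3 := congrArg (fun s => (s.map (t - ·)).prod) hA
    simp only [Multiset.map_add, Multiset.prod_add] at h3
    have h4 : (S.val.map (t - ·)).prod = ∏ x ∈ S, (t - x) := rfl
    have h5 : ∏ x ∈ S, (t - x) ≠ 0 :=
      Finset.prod_ne_zero_iff.2 fun x hx => sub_ne_zero.2 fun e => ht (e ▸ hx)
    have h6 : (A.map (t - ·)).prod =
        (∏ x ∈ S, (t - x)) * (t - d - ∑ c ∈ S, R c / (t - c)) := by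
      rw [← Peval, ← hrem, ← hq, hq1, hremsum]
      simp only [eval_add, eval_mul, eval_finsetSum, eval_prod, eval_sub, eval_X, eval_C, Peval,
        h4, mul_sub, hd, Finset.mul_sum]
      have : ∀ c ∈ S, -R c * ∏ x ∈ S.erase c, (t - x) = - ((∏ x ∈ S, (t - x)) * (R c / (t - c))) := by
        intro c hc
        rw [← Finset.mul_prod_erase S (fun x => t - x) hc]
        have : t - c ≠ 0 := sub_ne_zero.2 fun e => ht (e ▸ hc)
        field_simp
      rw [Finset.sum_congr rfl this, Finset.sum_neg_distrib]
      ring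
    rw [h1, h2]
    rw [h4, h6] at h3
    apply mul_right_cancel₀ h5
    rw [h3]; ring

end Interlacing

/-! ### Hermitian matrices with prescribed spectrum -/

section Spectrum

open Polynomial

variable {k : ℕ}

theorem mul_conjTranspose_of_mem {g : Matrix (Fin k) (Fin k) ℂ}
    (hg : g ∈ Matrix.unitaryGroup (Fin k) ℂ) : g * gᴴ = 1 := Matrix.mem_unitaryGroup_iff.1 hg

theorem conjTranspose_mul_of_mem {g : Matrix (Fin k) (Fin k) ℂ}
    (hg : g ∈ Matrix.unitaryGroup (Fin k) ℂ) : gᴴ * g = 1 := Matrix.mem_unitaryGroup_iff'.1 hg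

theorem conjTranspose_mem {g : Matrix (Fin k) (Fin k) ℂ}
    (hg : g ∈ Matrix.unitaryGroup (Fin k) ℂ) : gᴴ ∈ Matrix.unitaryGroup (Fin k) ℂ :=
  Matrix.mem_unitaryGroup_iff.2 (by
    rw [Matrix.star_eq_conjTranspose, Matrix.conjTranspose_conjTranspose,
      conjTranspose_mul_of_mem hg])

/-- The Hermitian matrix `y` has eigenvalues `ν`, with multiplicity. -/
def HasSpectrum (y : Matrix (Fin k) (Fin k) ℂ) (ν : Fin k → ℝ) : Prop :=
  y.IsHermitian ∧ y.charpoly = ∏ i, (X - C (ν i : ℂ))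

/-- The spectral theorem diagonalises both matrices. Equal characteristic polynomials make the two
diagonal matrices literally equal, so the conjugating matrix is one eigenvector matrix times the
adjoint of the other. -/
theorem Matrix.IsHermitian.exists_conj_of_charpoly_eq {A B : Matrix (Fin k) (Fin k) ℂ}
    (hA : A.IsHermitian) (hB : B.IsHermitian) (h : A.charpoly = B.charpoly) :
    ∃ g ∈ Matrix.unitaryGroup (Fin k) ℂ, A = g * B * gᴴ := by
  have h1 := hA.spectral_theorem
  have h2 := hB.spectral_theorem
  rw [(hA.eigenvalues_eq_eigenvalues_iff hB).2 h, Unitary.conjStarAlgAut_apply] at h1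
  rw [Unitary.conjStarAlgAut_apply] at h2
  set U : Matrix (Fin k) (Fin k) ℂ := ↑hA.eigenvectorUnitary with hU
  set V : Matrix (Fin k) (Fin k) ℂ := ↑hB.eigenvectorUnitary with hV
  have mU : U ∈ Matrix.unitaryGroup (Fin k) ℂ := hA.eigenvectorUnitary.2
  have mV : V ∈ Matrix.unitaryGroup (Fin k) ℂ := hB.eigenvectorUnitary.2
  have sV : star V * V = 1 := conjTranspose_mul_of_mem mV
  refine ⟨U * Vᴴ, mul_mem mU (conjTranspose_mem mV), ?_⟩
  rw [Matrix.conjTranspose_mul, Matrix.conjTranspose_conjTranspose]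
  simp only [← Matrix.star_eq_conjTranspose]
  conv_rhs => rw [h2]
  conv_lhs => rw [h1]
  simp only [Matrix.mul_assoc]
  rw [← Matrix.mul_assoc (star V) V, sV, Matrix.one_mul, ← Matrix.mul_assoc (star V) V, sV,
    Matrix.one_mul]

theorem charpoly_conj {g : Matrix (Fin k) (Fin k) ℂ} (hg : g ∈ Matrix.unitaryGroup (Fin k) ℂ)
    (y : Matrix (Fin k) (Fin k) ℂ) : (g * y * gᴴ).charpoly = y.charpoly := by
  rw [Matrix.charpoly_mul_comm, ← Matrix.mul_assoc, conjTranspose_mul_of_mem hg, Matrix.one_mul]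

theorem isHermitian_conj (g : Matrix (Fin k) (Fin k) ℂ) {y : Matrix (Fin k) (Fin k) ℂ}
    (hy : y.IsHermitian) : (g * y * gᴴ).IsHermitian :=
  Matrix.isHermitian_mul_mul_conjTranspose g hy

theorem HasSpectrum.conj {g y : Matrix (Fin k) (Fin k) ℂ} {ν : Fin k → ℝ}
    (hg : g ∈ Matrix.unitaryGroup (Fin k) ℂ) (h : HasSpectrum y ν) : HasSpectrum (g * y * gᴴ) ν :=
  ⟨isHermitian_conj g h.1, by rw [charpoly_conj hg, h.2]⟩

theorem hasSpectrum_diagonal (ν : Fin k → ℝ) :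
    HasSpectrum (Matrix.diagonal fun i => (ν i : ℂ)) ν := by
  refine ⟨?_, by rw [Matrix.charpoly_diagonal]⟩
  rw [Matrix.IsHermitian, Matrix.diagonal_conjTranspose]
  congr 1; ext i; simp

theorem hasSpectrum_iff {y : Matrix (Fin k) (Fin k) ℂ} {ν : Fin k → ℝ} :
    HasSpectrum y ν ↔ ∃ g ∈ Matrix.unitaryGroup (Fin k) ℂ,
      y = g * Matrix.diagonal (fun i => (ν i : ℂ)) * gᴴ := by
  constructor
  · intro h
    exact h.1.exists_conj_of_charpoly_eq (hasSpectrum_diagonal ν).1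
      (h.2.trans (hasSpectrum_diagonal ν).2.symm)
  · rintro ⟨g, hg, rfl⟩
    exact (hasSpectrum_diagonal ν).conj hg

theorem aeval_conj_unitary {g : Matrix (Fin k) (Fin k) ℂ} (hg : g ∈ Matrix.unitaryGroup (Fin k) ℂ)
    (y : Matrix (Fin k) (Fin k) ℂ) (p : ℝ[X]) :
    aeval (g * y * gᴴ) p = g * aeval y p * gᴴ := by
  have hpow : ∀ m : ℕ, (g * y * gᴴ) ^ m = g * y ^ m * gᴴ := by
    intro m
    induction m with
    | zero => simp [mul_conjTranspose_of_mem hg]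
    | succ m ih =>
      rw [pow_succ, ih, pow_succ]
      simp only [Matrix.mul_assoc]
      rw [← Matrix.mul_assoc gᴴ g, conjTranspose_mul_of_mem hg, Matrix.one_mul]
  induction p using Polynomial.induction_on' with
  | add p q hp hq => simp only [map_add, hp, hq, Matrix.mul_add, Matrix.add_mul]
  | monomial m a =>
    simp only [aeval_monomial, hpow, Algebra.algebraMap_eq_smul_one, Matrix.smul_mul,
      Matrix.one_mul, Matrix.mul_smul]

theorem aeval_diagonal_ofReal (ν : Fin k → ℝ) (p : ℝ[X]) :
    aeval (Matrix.diagonal fun i => (ν i : ℂ)) p = Matrix.diagonal fun i => ((p.eval (ν i) : ℝ) : ℂ) := by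
  induction p using Polynomial.induction_on' with
  | add p q hp hq => simp [map_add, hp, hq, Matrix.diagonal_add]
  | monomial m a =>
    rw [aeval_monomial, Matrix.diagonal_pow, Algebra.algebraMap_eq_smul_one, Matrix.smul_mul,
      Matrix.one_mul, ← Matrix.diagonal_smul]
    congr 1; ext i; simp

theorem aeval_conjTranspose (y : Matrix (Fin k) (Fin k) ℂ) (p : ℝ[X]) :
    (aeval y p)ᴴ = aeval yᴴ p := by
  induction p using Polynomial.induction_on' with
  | add p q hp hq => simp only [map_add, Matrix.conjTranspose_add, hp, hq]
  | monomial m a =>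
    simp [aeval_monomial, Algebra.algebraMap_eq_smul_one, Matrix.conjTranspose_smul,
      Matrix.conjTranspose_pow]

theorem Matrix.IsHermitian.aeval {y : Matrix (Fin k) (Fin k) ℂ} (hy : y.IsHermitian) (p : ℝ[X]) :
    (aeval y p).IsHermitian := by
  rw [Matrix.IsHermitian, aeval_conjTranspose, hy.eq]

/-- After diagonalisation, a polynomial in `y` sees only its values on the spectrum. The identities
for spectral projections below thereby become identities between numbers. -/
theorem HasSpectrum.aeval_congr {y : Matrix (Fin k) (Fin k) ℂ} {ν : Fin k → ℝ}
    (h : HasSpectrum y ν) {p q : ℝ[X]} (hpq : ∀ i, p.eval (ν i) = q.eval (ν i)) :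
    aeval y p = aeval y q := by
  obtain ⟨g, hg, rfl⟩ := hasSpectrum_iff.1 h
  rw [aeval_conj_unitary hg, aeval_conj_unitary hg, aeval_diagonal_ofReal, aeval_diagonal_ofReal]
  simp only [hpq]

theorem HasSpectrum.aeval {y : Matrix (Fin k) (Fin k) ℂ} {ν : Fin k → ℝ}
    (h : HasSpectrum y ν) (p : ℝ[X]) : HasSpectrum (aeval y p) fun i => p.eval (ν i) := by
  obtain ⟨g, hg, rfl⟩ := hasSpectrum_iff.1 h
  rw [aeval_conj_unitary hg, aeval_diagonal_ofReal]
  exact (hasSpectrum_diagonal _).conj hg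

/-- A polynomial that is `1` at `c` and `0` at the other values of `ν`. -/
noncomputable def projPoly (ν : Fin k → ℝ) (c : ℝ) : ℝ[X] :=
  Lagrange.interpolate (Finset.univ.image ν) id fun x => if x = c then 1 else 0

theorem eval_projPoly (ν : Fin k → ℝ) (c : ℝ) (i : Fin k) :
    (projPoly ν c).eval (ν i) = if ν i = c then 1 else 0 :=
  Lagrange.eval_interpolate_at_node (v := id) (r := fun x => if x = c then (1 : ℝ) else 0)
    Function.injective_id.injOn (Finset.mem_image_of_mem ν (Finset.mem_univ i))

/-- The spectral projection of `y` for the eigenvalue `c`. -/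
noncomputable def specProj (ν : Fin k → ℝ) (c : ℝ) (y : Matrix (Fin k) (Fin k) ℂ) :
    Matrix (Fin k) (Fin k) ℂ :=
  Polynomial.aeval y (projPoly ν c)

variable {y : Matrix (Fin k) (Fin k) ℂ} {ν : Fin k → ℝ}

theorem specProj_conj {g : Matrix (Fin k) (Fin k) ℂ} (hg : g ∈ Matrix.unitaryGroup (Fin k) ℂ)
    (c : ℝ) : specProj ν c (g * y * gᴴ) = g * specProj ν c y * gᴴ :=
  aeval_conj_unitary hg y _

theorem specProj_diagonal (ν : Fin k → ℝ) (c : ℝ) :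
    specProj ν c (Matrix.diagonal fun i => (ν i : ℂ)) =
      Matrix.diagonal fun i => if ν i = c then 1 else 0 := by
  rw [specProj, aeval_diagonal_ofReal]
  congr 1; ext i
  rw [eval_projPoly]; split_ifs <;> simp

theorem HasSpectrum.specProj_conjTranspose (h : HasSpectrum y ν) (c : ℝ) :
    (specProj ν c y)ᴴ = specProj ν c y :=
  (h.1.aeval _).eq

theorem HasSpectrum.specProj_mul_self (h : HasSpectrum y ν) (c : ℝ) :
    specProj ν c y * specProj ν c y = specProj ν c y := by
  unfold specProj
  rw [← map_mul]
  refine h.aeval_congr fun i => ?_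
  rw [eval_mul, eval_projPoly]; split_ifs <;> simp

theorem HasSpectrum.specProj_mul_of_ne (h : HasSpectrum y ν) {c c' : ℝ} (hc : c ≠ c') :
    specProj ν c y * specProj ν c' y = 0 := by
  unfold specProj
  rw [← map_mul, ← map_zero (Polynomial.aeval (R := ℝ) y)]
  refine h.aeval_congr fun i => ?_
  rw [eval_mul, eval_projPoly, eval_projPoly]
  split_ifs with h1 h2 <;> simp
  exact hc (h1.symm.trans h2)

theorem HasSpectrum.sum_specProj (h : HasSpectrum y ν) :
    ∑ c ∈ Finset.univ.image ν, specProj ν c y = 1 := by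
  unfold specProj
  rw [← map_sum, ← map_one (Polynomial.aeval (R := ℝ) y)]
  refine h.aeval_congr fun i => ?_
  simp [eval_finsetSum, eval_projPoly]

theorem HasSpectrum.aeval_mul_specProj (h : HasSpectrum y ν) (p : ℝ[X]) (c : ℝ) :
    Polynomial.aeval y p * specProj ν c y = p.eval c • specProj ν c y := by
  unfold specProj
  rw [← map_mul, ← map_smul]
  refine h.aeval_congr fun i => ?_
  rw [eval_mul, eval_smul, eval_projPoly]
  split_ifs with h1 <;> simp [h1]

theorem HasSpectrum.mul_specProj (h : HasSpectrum y ν) (c : ℝ) :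
    y * specProj ν c y = c • specProj ν c y := by
  simpa using h.aeval_mul_specProj X c

theorem HasSpectrum.sum_smul_specProj (h : HasSpectrum y ν) :
    ∑ c ∈ Finset.univ.image ν, c • specProj ν c y = y := by
  calc _ = ∑ c ∈ Finset.univ.image ν, y * specProj ν c y :=
        Finset.sum_congr rfl fun c _ => (h.mul_specProj c).symm
    _ = y := by rw [← Finset.mul_sum, h.sum_specProj, Matrix.mul_one]

/-- The square of the Euclidean norm. -/
def normSqVec (v : Fin k → ℂ) : ℝ := ∑ i, Complex.normSq (v i)

theorem star_dotProduct_self (v : Fin k → ℂ) : star v ⬝ᵥ v = (normSqVec v : ℂ) := by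
  simp [dotProduct, normSqVec, Complex.normSq_eq_conj_mul_self]

theorem normSqVec_nonneg (v : Fin k → ℂ) : 0 ≤ normSqVec v :=
  Finset.sum_nonneg fun _ _ => Complex.normSq_nonneg _

theorem normSqVec_eq_zero {v : Fin k → ℂ} : normSqVec v = 0 ↔ v = 0 := by
  rw [normSqVec, Finset.sum_eq_zero_iff_of_nonneg fun _ _ => Complex.normSq_nonneg _]
  simp [funext_iff]

theorem normSqVec_smul (a : ℝ) (v : Fin k → ℂ) : normSqVec (a • v) = a ^ 2 * normSqVec v := by
  simp [normSqVec, Finset.mul_sum, sq]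

theorem HasSpectrum.star_dotProduct_specProj (h : HasSpectrum y ν) (c : ℝ) (b : Fin k → ℂ) :
    star b ⬝ᵥ (specProj ν c y *ᵥ b) = (normSqVec (specProj ν c y *ᵥ b) : ℂ) := by
  rw [← star_dotProduct_self, Matrix.star_mulVec, h.specProj_conjTranspose,
    ← Matrix.dotProduct_mulVec, Matrix.mulVec_mulVec, h.specProj_mul_self]

theorem det_bordered_zero_col (A : Matrix (Fin k) (Fin k) ℂ) (r : Fin k → ℂ) (d : ℂ) :
    (bordered A 0 r d).det = A.det * d := by
  rw [Matrix.det_succ_column _ (Fin.last k), Fin.sum_univ_castSucc]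
  have : (bordered A 0 r d).submatrix Fin.castSucc Fin.castSucc = A := by
    ext i j; simp
  simp [this, mul_comm]

theorem det_bordered_zero_row (A : Matrix (Fin k) (Fin k) ℂ) (b : Fin k → ℂ) (d : ℂ) :
    (bordered A b 0 d).det = A.det * d := by
  rw [Matrix.det_succ_row _ (Fin.last k), Fin.sum_univ_castSucc]
  have : (bordered A b 0 d).submatrix Fin.castSucc Fin.castSucc = A := by
    ext i j; simp
  simp [this, mul_comm]

/-- Schur complement: multiplying on the right by the unipotent matrix with last column `-G b`
clears the border column. -/
theorem det_bordered_of_mul_eq_one (A G : Matrix (Fin k) (Fin k) ℂ) (b r : Fin k → ℂ) (d : ℂ)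
    (h : A * G = 1) : (bordered A b r d).det = A.det * (d - r ⬝ᵥ (G *ᵥ b)) := by
  have h1 := congrArg Matrix.det (bordered_mul A b r d 1 (-(G *ᵥ b)) 0 1)
  rw [Matrix.det_mul, det_bordered_zero_row] at h1
  have h2 : A *ᵥ (-(G *ᵥ b)) + (1 : ℂ) • b = 0 := by
    rw [Matrix.mulVec_neg, Matrix.mulVec_mulVec, h, Matrix.one_mulVec]; simp
  rw [h2, det_bordered_zero_col] at h1
  simp only [Matrix.det_one, mul_one, Matrix.vecMulVec_zero, add_zero] at h1
  rw [h1, dotProduct_neg]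
  ring

/-- Off the spectrum the resolvent of `y` is `∑ (t - c)⁻¹ P_c`; inserted in the Schur complement it
produces the squared lengths of the components of `b`. -/
theorem HasSpectrum.eval_charpoly_bordered (h : HasSpectrum y ν) (b : Fin k → ℂ) (d t : ℝ)
    (ht : t ∉ Finset.univ.image ν) :
    (bordered y b (star b) d).charpoly.eval (t : ℂ) =
      (((∏ i, (t - ν i)) * (t - d - ∑ c ∈ Finset.univ.image ν,
        normSqVec (specProj ν c y *ᵥ b) / (t - c)) : ℝ) : ℂ) := by
  set S := Finset.univ.image ν
  set G : Matrix (Fin k) (Fin k) ℂ := ∑ c ∈ S, (t - c)⁻¹ • specProj ν c y with hG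
  have hAG : (Matrix.scalar (Fin k) (t : ℂ) - y) * G = 1 := by
    rw [hG, Finset.mul_sum, ← h.sum_specProj]
    refine Finset.sum_congr rfl fun c hc => ?_
    have htc : t - c ≠ 0 := sub_ne_zero.2 fun e => ht (e ▸ hc)
    have h1 : Matrix.scalar (Fin k) (t : ℂ) * specProj ν c y = t • specProj ν c y := by
      ext i j; simp [Matrix.scalar_apply]
    rw [Matrix.mul_smul, Matrix.sub_mul, h.mul_specProj, h1, ← sub_smul, smul_smul,
      inv_mul_cancel₀ htc, one_smul]
  have hsub : Matrix.scalar (Fin (k + 1)) (t : ℂ) - bordered y b (star b) d =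
      bordered (Matrix.scalar (Fin k) (t : ℂ) - y) (-b) (-star b) (t - d) := by
    apply matrix_ext_lastCases <;> intros <;>
      simp [Matrix.scalar_apply, Matrix.diagonal_apply, Fin.ext_iff] <;> omega
  rw [Matrix.eval_charpoly, hsub, det_bordered_of_mul_eq_one _ G _ _ _ hAG, ← Matrix.eval_charpoly,
    h.2, eval_prod]
  have hq : -star b ⬝ᵥ (G *ᵥ -b) = ((∑ c ∈ S, normSqVec (specProj ν c y *ᵥ b) / (t - c) : ℝ) : ℂ) := by
    rw [Matrix.mulVec_neg, dotProduct_neg, neg_dotProduct, neg_neg, hG, Matrix.sum_mulVec,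
      dotProduct_sum]
    push_cast
    refine Finset.sum_congr rfl fun c _ => ?_
    rw [Matrix.smul_mulVec, dotProduct_smul, h.star_dotProduct_specProj, Complex.real_smul]
    push_cast
    rw [div_eq_inv_mul]
  rw [hq]
  push_cast
  simp

theorem polynomial_eq_of_eval_ofReal {p q : ℂ[X]} (S : Finset ℝ)
    (h : ∀ t : ℝ, t ∉ S → p.eval (t : ℂ) = q.eval (t : ℂ)) : p = q := by
  refine eq_of_infinite_eval_eq p q
    (((S.finite_toSet.infinite_compl).image Complex.ofReal_injective.injOn).mono ?_)
  rintro _ ⟨t, ht, rfl⟩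
  exact h t ht

/-- The equation saying that a bordered Hermitian matrix with eigenvalues `ν` of the leading block
has eigenvalues `μ` exactly if its last entry is `d` and the component of its last column in the
`c`-eigenspace has squared length `R c`. -/
def IsWeight {k : ℕ} (ν : Fin k → ℝ) (μ : Fin (k + 1) → ℝ) (d : ℝ) (R : ℝ → ℝ) : Prop :=
  ∀ t ∉ Finset.univ.image ν, ∏ i, (t - μ i) =
    (∏ i, (t - ν i)) * (t - d - ∑ c ∈ Finset.univ.image ν, R c / (t - c))

theorem isHermitian_bordered (hy : y.IsHermitian) (b : Fin k → ℂ) (d : ℝ) :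
    (bordered y b (star b) (d : ℂ)).IsHermitian := by
  rw [Matrix.IsHermitian, bordered_conjTranspose, hy.eq, star_star]
  simp

/-- Two expressions for one characteristic polynomial agree off the spectrum of `y`, so their
partial fractions have equal coefficients. Conversely, agreement at infinitely many real points
determines the polynomial. -/
theorem HasSpectrum.bordered_iff (h : HasSpectrum y ν) {μ : Fin (k + 1) → ℝ} {d₀ : ℝ} {R : ℝ → ℝ}
    (hR : IsWeight ν μ d₀ R) (b : Fin k → ℂ) (d : ℝ) :
    HasSpectrum (bordered y b (star b) (d : ℂ)) μ ↔
      d = d₀ ∧ ∀ c ∈ Finset.univ.image ν, normSqVec (specProj ν c y *ᵥ b) = R c := by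
  have hμ : ∀ t : ℝ, (∏ i, (X - C (μ i : ℂ)) : ℂ[X]).eval (t : ℂ) = ((∏ i, (t - μ i) : ℝ) : ℂ) := by
    intro t; rw [eval_prod]; push_cast; simp
  constructor
  · rintro ⟨-, hc⟩
    have key := eq_zero_of_partialFraction_eq_zero (Finset.univ.image ν) (d₀ - d)
      (fun c => R c - normSqVec (specProj ν c y *ᵥ b)) ?_
    · exact ⟨by linarith [key.1], fun c hc => by linarith [key.2 c hc]⟩
    · intro t ht
      have h1 := h.eval_charpoly_bordered b d t ht
      rw [hc, hμ, Complex.ofReal_inj, hR t ht] at h1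
      have h2 : ∏ i, (t - ν i) ≠ 0 := Finset.prod_ne_zero_iff.2 fun i _ => sub_ne_zero.2 fun e =>
        ht (e ▸ Finset.mem_image_of_mem ν (Finset.mem_univ i))
      have h3 := mul_left_cancel₀ h2 h1
      simp only [sub_div, Finset.sum_sub_distrib]
      linarith
  · rintro ⟨rfl, hc⟩
    refine ⟨isHermitian_bordered h.1 b d, polynomial_eq_of_eval_ofReal (Finset.univ.image ν) ?_⟩
    intro t ht
    rw [h.eval_charpoly_bordered b d t ht, hμ, hR t ht, Finset.sum_congr rfl fun c hc' => by
      rw [hc c hc']]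

theorem Matrix.IsHermitian.eq_bordered_re {x : Matrix (Fin (k + 1)) (Fin (k + 1)) ℂ}
    (hx : x.IsHermitian) :
    x = bordered (_root_.lead x) (lastCol x) (star (lastCol x))
      ((x (Fin.last k) (Fin.last k)).re : ℂ) := by
  have h : ((x (Fin.last k) (Fin.last k)).re : ℂ) = x (Fin.last k) (Fin.last k) :=
    Complex.conj_eq_iff_re.1 (hx.apply _ _)
  rw [h]
  exact hx.eq_bordered

/-- A Hermitian matrix whose leading block has eigenvalues `ν` has eigenvalues `μ` if and only if
its last entry and the components of its last column are as prescribed. -/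
theorem HasSpectrum.iff_of_lead {x : Matrix (Fin (k + 1)) (Fin (k + 1)) ℂ}
    (h : HasSpectrum (lead x) ν) (hx : x.IsHermitian) {μ : Fin (k + 1) → ℝ} {d : ℝ} {R : ℝ → ℝ}
    (hR : IsWeight ν μ d R) :
    HasSpectrum x μ ↔ x = bordered (lead x) (lastCol x) (star (lastCol x)) (d : ℂ) ∧
      ∀ c ∈ Finset.univ.image ν, normSqVec (specProj ν c (lead x) *ᵥ lastCol x) = R c := by
  have h1 := hx.eq_bordered_re
  have h2 := h.bordered_iff hR (lastCol x) (x (Fin.last k) (Fin.last k)).re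
  rw [← h1] at h2
  rw [h2]
  refine and_congr_left fun _ => ⟨fun e => by rw [← e]; exact h1, fun e => ?_⟩
  have h3 := congrFun (congrFun (h1.symm.trans e) (Fin.last k)) (Fin.last k)
  simp only [bordered_last_last] at h3
  exact_mod_cast h3

end Spectrum

/-! ### The tower of isospectral sets and its local triviality -/

section Tower

variable {k : ℕ}

/-- The matrices all of whose leading blocks have the eigenvalues prescribed by the array `a`. -/
def gcTower (a : ℕ → ℕ → ℝ) : ∀ k, Set (Matrix (Fin k) (Fin k) ℂ)
  | 0 => univ
  | k + 1 => {x | HasSpectrum x (fun i => a (k + 1) i) ∧ lead x ∈ gcTower a k}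

theorem hasSpectrum_of_mem_gcTower {a : ℕ → ℕ → ℝ} : ∀ {k : ℕ} {x : Matrix (Fin k) (Fin k) ℂ},
    x ∈ gcTower a k → HasSpectrum x fun i => a k i
  | 0, _, _ => ⟨Subsingleton.elim _ _, by simp [Matrix.charpoly]⟩
  | _ + 1, _, h => h.1

theorem ContDiffOn.normSqVec {V : Type*} [NormedAddCommGroup V] [NormedSpace ℝ V] {s : Set V}
    {f : V → Fin k → ℂ} (hf : ContDiffOn ℝ ∞ f s) : ContDiffOn ℝ ∞ (fun x => normSqVec (f x)) s := by
  simp only [_root_.normSqVec, Complex.normSq_eq_norm_sq]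
  exact ContDiffOn.sum fun i _ => (contDiff_norm_sq ℝ).comp_contDiffOn (contDiffOn_pi.1 hf i)

theorem normSqVec_normalize {v : Fin k → ℂ} (hv : v ≠ 0) {r : ℝ} (hr : 0 ≤ r) :
    normSqVec ((√r / √(normSqVec v)) • v) = r := by
  have h : 0 < normSqVec v := (normSqVec_nonneg v).lt_of_ne fun e => hv (normSqVec_eq_zero.1 e.symm)
  rw [normSqVec_smul, div_pow, Real.sq_sqrt hr, Real.sq_sqrt h.le, div_mul_cancel₀ _ h.ne']

theorem normalize_pos_smul {v : Fin k → ℂ} {r ρ : ℝ} (hr : 0 < r) (hv : normSqVec v = r)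
    (hρ : 0 < ρ) : (√r / √(normSqVec (ρ • v))) • (ρ • v) = v := by
  rw [normSqVec_smul, hv, Real.sqrt_mul (sq_nonneg ρ), Real.sqrt_sq hρ.le, smul_smul]
  have : √r ≠ 0 := (Real.sqrt_pos.2 hr).ne'
  rw [show √r / (ρ * √r) * ρ = 1 by field_simp, one_smul]

/-- Real coordinates on the coordinate subspace `{i | ν i = c}` of complex dimension `s`: `ex`
includes it and `re` projects to it. For `s = 0` both maps are zero, whatever the multiplicity of
`c`; this covers the regions that contribute a point. -/
theorem exists_coordinates (ν : Fin k → ℝ) (c : ℝ) (s : ℕ) (h : s ≠ 0 → mult ν c = s) :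
    ∃ (ex : EuclideanSpace ℝ (Fin (2 * s)) →L[ℝ] (Fin k → ℂ))
      (re : (Fin k → ℂ) →L[ℝ] EuclideanSpace ℝ (Fin (2 * s))), (∀ z, re (ex z) = z) ∧
      (s ≠ 0 → ∀ v, ex (re v) = Matrix.diagonal (fun i => if ν i = c then (1 : ℂ) else 0) *ᵥ v) := by
  by_cases hs : s = 0
  · subst hs
    exact ⟨0, 0, fun z => by ext i; exact absurd i.2 (by omega), fun h => absurd rfl h⟩
  have hfin : Module.finrank ℝ (EuclideanSpace ℝ (Fin (2 * s))) =
      Module.finrank ℝ ({i // ν i = c} → ℂ) := by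
    rw [Module.finrank_pi_fintype]
    simp only [finrank_euclideanSpace, Fintype.card_fin, Complex.finrank_real_complex,
      Finset.sum_const, smul_eq_mul]
    rw [← h hs, mult_eq_card, mul_comm, Finset.card_univ, Fintype.card_subtype]
  let e : EuclideanSpace ℝ (Fin (2 * s)) ≃L[ℝ] ({i // ν i = c} → ℂ) :=
    ContinuousLinearEquiv.ofFinrankEq hfin
  let inc : ({i // ν i = c} → ℂ) →L[ℝ] (Fin k → ℂ) := LinearMap.toContinuousLinearMap
    { toFun := fun v i => if h : ν i = c then v ⟨i, h⟩ else 0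
      map_add' := fun v w => by ext i; by_cases h : ν i = c <;> simp [h]
      map_smul' := fun r v => by ext i; by_cases h : ν i = c <;> simp [h] }
  let res : (Fin k → ℂ) →L[ℝ] ({i // ν i = c} → ℂ) := LinearMap.toContinuousLinearMap
    { toFun := fun v i => v i
      map_add' := fun v w => rfl
      map_smul' := fun r v => rfl }
  have hinc : ∀ v i, inc v i = if h : ν i = c then v ⟨i, h⟩ else 0 := fun _ _ => rfl
  have hres : ∀ v i, res v i = v i := fun _ _ => rfl
  refine ⟨inc.comp e.toContinuousLinearMap, e.symm.toContinuousLinearMap.comp res, ?_, ?_⟩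
  · intro z
    have : res (inc (e z)) = e z := by
      ext i; rw [hres, hinc, dif_pos i.2]
    simp [this]
  · intro _ v
    ext i
    simp only [ContinuousLinearMap.comp_apply, ContinuousLinearEquiv.coe_coe,
      ContinuousLinearEquiv.apply_symm_apply, Matrix.mulVec_diagonal]
    rw [hinc]
    split_ifs <;> simp [hres]

theorem continuousLinearMap_contDiffOn {V W X : Type*} [NormedAddCommGroup V] [NormedSpace ℝ V]
    [NormedAddCommGroup W] [NormedSpace ℝ W] [NormedAddCommGroup X] [NormedSpace ℝ X] (L : W →L[ℝ] X)
    {f : V → W} {s : Set V} (hf : ContDiffOn ℝ ∞ f s) : ContDiffOn ℝ ∞ (fun x => L (f x)) s :=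
  L.contDiff.comp_contDiffOn hf

/-- Over `y`, only the last column is free, and its components in the eigenspaces of positive weight
have prescribed nonzero lengths. Near `y₀` the eigenspaces of `y` are images of fixed coordinate
subspaces under a smooth family `K y` of invertible matrices. Since `K y` need not be isometric,
each component is rescaled radially, in both directions of the trivialisation. The index `D` runs
over eigenvalues `c D`; size zero marks those without a sphere. -/
theorem isSmoothFiberBundle_lead {B : Set (Matrix (Fin k) (Fin k) ℂ)} {ν : Fin k → ℝ}
    {μ : Fin (k + 1) → ℝ} (hB : ∀ y ∈ B, HasSpectrum y ν) (hint : Interlacing ν μ)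
    {ι : Type} [Fintype ι] (size : ι → ℕ) (c : ι → ℝ) (hc : Function.Injective c)
    (h₁ : ∀ D, size D ≠ 0 → mult ν (c D) = size D ∧ mult μ (c D) < mult ν (c D))
    (h₂ : ∀ c₀, mult μ c₀ < mult ν c₀ → ∃ D, size D ≠ 0 ∧ c D = c₀) :
    IsSmoothFiberBundle (lead (k := k) (m := k)) {x | HasSpectrum x μ ∧ lead x ∈ B} B
      {z : ∀ D, EuclideanSpace ℝ (Fin (2 * size D)) | ∀ D, size D ≠ 0 → ‖z D‖ = 1} := by
  classical
  obtain ⟨d₀, R, hRpos, hR0, hR⟩ := hint.exists_weights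
  have hR : IsWeight ν μ d₀ R := hR
  refine ⟨contDiffOn_id.lead, fun x hx => hx.2, fun y₀ hy₀ => ?_⟩
  obtain ⟨g₀, hg₀, hy₀g⟩ := hasSpectrum_iff.1 (hB y₀ hy₀)
  set S := Finset.univ.image ν with hS
  -- `∑ P_c(y) P_c(y₀)` maps eigenspaces of `y₀` into those of `y` and is the identity at `y₀`.
  -- Composed with the diagonalisation `g₀`, it starts from coordinate subspaces. It is polynomial
  -- in `y`, hence smooth.
  set Q : Matrix (Fin k) (Fin k) ℂ → Matrix (Fin k) (Fin k) ℂ :=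
    fun y => ∑ c ∈ S, specProj ν c y * specProj ν c y₀ with hQ
  set K : Matrix (Fin k) (Fin k) ℂ → Matrix (Fin k) (Fin k) ℂ := fun y => Q y * g₀ with hK
  set E : ℝ → Matrix (Fin k) (Fin k) ℂ :=
    fun c => Matrix.diagonal fun i => if ν i = c then (1 : ℂ) else 0 with hE
  have hEE : ∀ c c', c ≠ c' → E c * E c' = 0 := by
    intro c c' hcc
    rw [hE, Matrix.diagonal_mul_diagonal, ← Matrix.diagonal_zero]
    congr 1; ext i
    by_cases h : ν i = c
    · simp [h, hcc]
    · simp [h]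
  have hPg : ∀ c, specProj ν c y₀ * g₀ = g₀ * E c := by
    intro c
    rw [hy₀g, specProj_conj hg₀, specProj_diagonal, Matrix.mul_assoc, conjTranspose_mul_of_mem hg₀,
      Matrix.mul_one]
  have hPQ : ∀ y ∈ B, ∀ c ∈ S, specProj ν c y * Q y = specProj ν c y * specProj ν c y₀ := by
    intro y hy c hcS
    rw [hQ, Finset.mul_sum, Finset.sum_eq_single c]
    · rw [← Matrix.mul_assoc, (hB y hy).specProj_mul_self]
    · intro c' _ hne
      rw [← Matrix.mul_assoc, (hB y hy).specProj_mul_of_ne hne.symm, Matrix.zero_mul]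
    · exact fun h => absurd hcS h
  have hQP : ∀ y, ∀ c ∈ S, Q y * specProj ν c y₀ = specProj ν c y * specProj ν c y₀ := by
    intro y c hcS
    rw [hQ, Finset.sum_mul, Finset.sum_eq_single c]
    · rw [Matrix.mul_assoc, (hB y₀ hy₀).specProj_mul_self]
    · intro c' _ hne
      rw [Matrix.mul_assoc, (hB y₀ hy₀).specProj_mul_of_ne hne, Matrix.mul_zero]
    · exact fun h => absurd hcS h
  have hPK : ∀ y ∈ B, ∀ c ∈ S, ∀ v, specProj ν c y *ᵥ (K y *ᵥ v) = K y *ᵥ (E c *ᵥ v) := by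
    intro y hy c hcS v
    rw [Matrix.mulVec_mulVec, Matrix.mulVec_mulVec, hK, ← Matrix.mul_assoc, hPQ y hy c hcS,
      Matrix.mul_assoc, Matrix.mul_assoc, ← hPg, ← Matrix.mul_assoc, ← Matrix.mul_assoc,
      hQP y c hcS]
  have hKsm : ∀ {V : Type} [NormedAddCommGroup V] [NormedSpace ℝ V] {s : Set V}
      {f : V → Matrix (Fin k) (Fin k) ℂ}, ContDiffOn ℝ ∞ f s → ContDiffOn ℝ ∞ (fun x => K (f x)) s := by
    intro V _ _ s f hf
    refine ContDiffOn.matrix_mul (ContDiffOn.sum fun c _ => ?_) contDiffOn_const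
    exact (hf.matrix_aeval _).matrix_mul contDiffOn_const
  have hKy₀ : K y₀ = g₀ := by
    have : Q y₀ = 1 := by
      rw [hQ, ← (hB y₀ hy₀).sum_specProj]
      exact Finset.sum_congr rfl fun c _ => (hB y₀ hy₀).specProj_mul_self c
    rw [hK]; simp only [this, Matrix.one_mul]
  have hcS : ∀ D, size D ≠ 0 → c D ∈ S := by
    intro D hD
    have h := (h₁ D hD).1
    rw [mult_eq_card] at h
    obtain ⟨i, hi⟩ := Finset.card_pos.1 (h ▸ Nat.pos_of_ne_zero hD)
    exact Finset.mem_image.2 ⟨i, Finset.mem_univ i, (Finset.mem_filter.1 hi).2⟩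
  choose ex re hre hex using fun D => exists_coordinates ν (c D) (size D) fun h => (h₁ D h).1
  have hex0 : ∀ D, size D = 0 → ∀ z, ex D z = 0 := by
    intro D hD z
    have : z = 0 := by
      ext i
      exact absurd i.2 (by omega)
    rw [this, map_zero]
  have hEex : ∀ D z, size D ≠ 0 → E (c D) *ᵥ ex D z = ex D z := by
    intro D z hD
    rw [hE, ← hex D hD, hre]
  have hEex0 : ∀ D z c', c' ≠ c D → E c' *ᵥ ex D z = 0 := by
    intro D z c' hne
    by_cases hD : size D = 0
    · rw [hex0 D hD, Matrix.mulVec_zero]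
    · rw [← hEex D z hD, Matrix.mulVec_mulVec, hEE _ _ hne, Matrix.zero_mulVec]
  -- The trivialising neighbourhood: the determinant is nonzero at `y₀`, where `K y₀ = g₀` is
  -- unitary.
  set U : Set (Matrix (Fin k) (Fin k) ℂ) := {y | (K y).det ≠ 0} with hU
  have hUo : IsOpen U := by
    have : Continuous fun y => (K y).det :=
      continuousOn_univ.1 (hKsm contDiffOn_id).matrix_det.continuousOn
    exact isOpen_ne_fun this continuous_const
  have hKinv : ∀ y ∈ U, ∀ v, (K y)⁻¹ *ᵥ (K y *ᵥ v) = v := by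
    intro y hy v
    rw [Matrix.mulVec_mulVec, Matrix.nonsing_inv_mul _ (isUnit_iff_ne_zero.2 hy), Matrix.one_mulVec]
  have hKinv' : ∀ y ∈ U, ∀ v, K y *ᵥ ((K y)⁻¹ *ᵥ v) = v := by
    intro y hy v
    rw [Matrix.mulVec_mulVec, Matrix.mul_nonsing_inv _ (isUnit_iff_ne_zero.2 hy), Matrix.one_mulVec]
  have hEK : ∀ y ∈ B, y ∈ U → ∀ c ∈ S, ∀ b, K y *ᵥ (E c *ᵥ ((K y)⁻¹ *ᵥ b)) = specProj ν c y *ᵥ b := by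
    intro y hy hyU c hc b
    rw [← hPK y hy c hc, hKinv' y hyU]
  -- the components of a sum of eigenvectors
  have hsum : ∀ y ∈ B, ∀ v : ι → Fin k → ℂ, (∀ D, size D = 0 → v D = 0) →
      (∀ D, size D ≠ 0 → specProj ν (c D) y *ᵥ v D = v D) →
      (∀ D, size D ≠ 0 → specProj ν (c D) y *ᵥ (∑ D, v D) = v D) ∧
      (∀ c' ∈ S, ¬ mult μ c' < mult ν c' → specProj ν c' y *ᵥ (∑ D, v D) = 0) := by
    intro y hy v hv0 hv
    have hne : ∀ D c', c' ≠ c D → specProj ν c' y *ᵥ v D = 0 := by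
      intro D c' hne
      by_cases hD : size D = 0
      · rw [hv0 D hD, Matrix.mulVec_zero]
      · rw [← hv D hD, Matrix.mulVec_mulVec, (hB y hy).specProj_mul_of_ne hne, Matrix.zero_mulVec]
    constructor
    · intro D hD
      rw [Matrix.mulVec_sum, Finset.sum_eq_single D]
      · exact hv D hD
      · exact fun D' _ hD' => hne D' _ fun e => hD' (hc e).symm
      · exact fun h => absurd (Finset.mem_univ D) h
    · intro c' _ hc'
      rw [Matrix.mulVec_sum]
      refine Finset.sum_eq_zero fun D _ => ?_
      by_cases hD : size D = 0
      · rw [hv0 D hD, Matrix.mulVec_zero]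
      · exact hne D c' fun e => hc' (e ▸ (h₁ D hD).2)
  -- the last column with given coordinates
  set col : ∀ D, Matrix (Fin k) (Fin k) ℂ → EuclideanSpace ℝ (Fin (2 * size D)) → Fin k → ℂ :=
    fun D y z => (√(R (c D)) / √(normSqVec (K y *ᵥ ex D z))) • (K y *ᵥ ex D z) with hcol
  have hcol0 : ∀ D y z, size D = 0 → col D y z = 0 := by
    intro D y z hD
    simp only [hcol, hex0 D hD, Matrix.mulVec_zero, smul_zero]
  have hPcol : ∀ y ∈ B, ∀ D z, size D ≠ 0 → specProj ν (c D) y *ᵥ col D y z = col D y z := by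
    intro y hy D z hD
    simp only [hcol]
    rw [Matrix.mulVec_smul, hPK y hy _ (hcS D hD), hEex D z hD]
  have hKex : ∀ y ∈ U, ∀ D z, z ≠ 0 → K y *ᵥ ex D z ≠ 0 := by
    intro y hy D z hz h0
    have : ex D z = 0 := by rw [← hKinv y hy (ex D z), h0, Matrix.mulVec_zero]
    exact hz (by rw [← hre D z, this, map_zero])
  have hRp : ∀ D, size D ≠ 0 → 0 < R (c D) := fun D hD => hRpos _ (h₁ D hD).2
  set wv : ∀ D, Matrix (Fin (k + 1)) (Fin (k + 1)) ℂ → EuclideanSpace ℝ (Fin (2 * size D)) :=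
    fun D x => re D ((K (lead x))⁻¹ *ᵥ lastCol x) with hwv
  have hKw : ∀ x, lead x ∈ B → lead x ∈ U → ∀ D, size D ≠ 0 →
      K (lead x) *ᵥ ex D (wv D x) = specProj ν (c D) (lead x) *ᵥ lastCol x := by
    intro x hxB hxU D hD
    simp only [hwv]
    rw [hex D hD, ← hEK _ hxB hxU _ (hcS D hD)]
  have hxE : ∀ x, HasSpectrum x μ → lead x ∈ B →
      x = bordered (lead x) (lastCol x) (star (lastCol x)) (d₀ : ℂ) ∧
      ∀ c ∈ S, normSqVec (specProj ν c (lead x) *ᵥ lastCol x) = R c :=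
    fun x hx hxB => ((hB _ hxB).iff_of_lead hx.1 hR).1 hx
  have hw0 : ∀ x, HasSpectrum x μ → lead x ∈ B → lead x ∈ U → ∀ D, size D ≠ 0 → wv D x ≠ 0 := by
    intro x hx hxB hxU D hD h0
    have h3 := hKw x hxB hxU D hD
    have h4 := (hxE x hx hxB).2 _ (hcS D hD)
    rw [← h3, h0, map_zero, Matrix.mulVec_zero, normSqVec_eq_zero.2 rfl] at h4
    exact (hRp D hD).ne h4
  -- Forwards, the coordinates of each component of the last column are normalised to the unit
  -- sphere. Backwards, unit vectors are mapped to eigenvectors of length `√(R (c D))`, and the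
  -- corner is forced to be `d₀`.
  refine ⟨U, hUo, ?_, fun x => (lead x, fun D => ‖wv D x‖⁻¹ • wv D x),
    fun q => bordered q.1 (∑ D, col D q.1 (q.2 D)) (star (∑ D, col D q.1 (q.2 D))) (d₀ : ℂ),
    ?_, ?_, ?_, ?_, ?_, ?_, fun x _ => rfl⟩
  · change (K y₀).det ≠ 0
    rw [hKy₀]
    intro h0
    have h3 := congrArg Matrix.det (mul_conjTranspose_of_mem hg₀)
    rw [Matrix.det_mul, h0, zero_mul, Matrix.det_one] at h3
    exact zero_ne_one h3
  · refine contDiffOn_id.lead.prodMk (contDiffOn_pi.2 fun D => ?_)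
    by_cases hD : size D = 0
    · have : (fun x : Matrix (Fin (k + 1)) (Fin (k + 1)) ℂ => ‖wv D x‖⁻¹ • wv D x) = fun _ => 0 := by
        ext x i
        exact absurd i.2 (by omega)
      rw [this]
      exact contDiffOn_const
    · have hwsm : ContDiffOn ℝ ∞ (wv D) ({x | HasSpectrum x μ ∧ lead x ∈ B} ∩ lead ⁻¹' U) :=
        continuousLinearMap_contDiffOn (re D) (((hKsm contDiffOn_id.lead).matrix_inv
          fun x hx => hx.2).matrix_mulVec contDiffOn_id.lastCol)
      have hne : ∀ x ∈ {x | HasSpectrum x μ ∧ lead x ∈ B} ∩ lead ⁻¹' U, wv D x ≠ 0 :=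
        fun x hx => hw0 x hx.1.1 hx.1.2 hx.2 D hD
      exact ((hwsm.norm ℝ hne).inv fun x hx => norm_ne_zero_iff.2 (hne x hx)).smul hwsm
  · have hb : ContDiffOn ℝ ∞ (fun q : Matrix (Fin k) (Fin k) ℂ ×
        (∀ D, EuclideanSpace ℝ (Fin (2 * size D))) => ∑ D, col D q.1 (q.2 D))
        ((B ∩ U) ×ˢ {z | ∀ D, size D ≠ 0 → ‖z D‖ = 1}) := by
      refine ContDiffOn.sum fun D _ => ?_
      by_cases hD : size D = 0
      · simp only [hcol0 D _ _ hD]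
        exact contDiffOn_const
      · have hv : ContDiffOn ℝ ∞ (fun q : Matrix (Fin k) (Fin k) ℂ ×
            (∀ D, EuclideanSpace ℝ (Fin (2 * size D))) => K q.1 *ᵥ ex D (q.2 D))
            ((B ∩ U) ×ˢ {z | ∀ D, size D ≠ 0 → ‖z D‖ = 1}) :=
          (hKsm contDiffOn_fst).matrix_mulVec
            (continuousLinearMap_contDiffOn (ex D) (contDiffOn_pi.1 contDiffOn_snd D))
        have hpos : ∀ q ∈ (B ∩ U) ×ˢ {z : ∀ D, EuclideanSpace ℝ (Fin (2 * size D)) |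
            ∀ D, size D ≠ 0 → ‖z D‖ = 1}, normSqVec (K q.1 *ᵥ ex D (q.2 D)) ≠ 0 := by
          intro q hq h0
          refine hKex q.1 hq.1.2 D (q.2 D) ?_ (normSqVec_eq_zero.1 h0)
          intro hz
          have := hq.2 D hD
          rw [hz, norm_zero] at this
          exact zero_ne_one this
        refine ContDiffOn.smul (contDiffOn_const.div (hv.normSqVec.sqrt hpos) ?_) hv
        intro q hq
        exact (Real.sqrt_pos.2 ((normSqVec_nonneg _).lt_of_ne (hpos q hq).symm)).ne'
    refine contDiffOn_fst.bordered hb ?_ contDiffOn_const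
    exact contDiffOn_pi.2 fun i => (contDiffOn_pi.1 hb i).complex_star
  · rintro x ⟨⟨hx, hxB⟩, hxU⟩
    refine ⟨⟨hxB, hxU⟩, fun D hD => ?_⟩
    have := norm_ne_zero_iff.2 (hw0 x hx hxB hxU D hD)
    simp only [norm_smul, norm_inv, norm_norm]
    exact inv_mul_cancel₀ this
  · rintro ⟨y, z⟩ ⟨⟨hy, hyU⟩, hz⟩
    have hz : ∀ D, size D ≠ 0 → ‖z D‖ = 1 := hz
    have hs := hsum y hy (fun D => col D y (z D)) (fun D hD => hcol0 D y _ hD)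
      (fun D hD => hPcol y hy D _ hD)
    refine ⟨⟨((hB y hy).bordered_iff hR _ d₀).2 ⟨rfl, fun c' hc' => ?_⟩, ?_⟩, ?_⟩
    · by_cases hm : mult μ c' < mult ν c'
      · obtain ⟨D, hD, rfl⟩ := h₂ c' hm
        have hzD : z D ≠ 0 := fun h => by
          have := hz D hD
          rw [h, norm_zero] at this
          exact zero_ne_one this
        rw [hs.1 D hD]
        exact normSqVec_normalize (hKex y hyU D _ hzD) (hRp D hD).le
      · rw [hs.2 c' hc' hm, hR0 c' hm, normSqVec_eq_zero]
    · rw [lead_bordered]; exact hy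
    · change lead _ ∈ U
      rw [lead_bordered]; exact hyU
  · rintro x ⟨⟨hx, hxB⟩, hxU⟩
    have hxx := hxE x hx hxB
    have hcolx : ∀ D, size D ≠ 0 → col D (lead x) (‖wv D x‖⁻¹ • wv D x) =
        specProj ν (c D) (lead x) *ᵥ lastCol x := by
      intro D hD
      simp only [hcol, map_smul, Matrix.mulVec_smul, hKw x hxB hxU D hD]
      exact normalize_pos_smul (hRp D hD) (hxx.2 _ (hcS D hD))
        (inv_pos.2 (norm_pos_iff.2 (hw0 x hx hxB hxU D hD)))
    have hs := hsum (lead x) hxB (fun D => col D (lead x) (‖wv D x‖⁻¹ • wv D x))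
      (fun D hD => hcol0 D _ _ hD) (fun D hD => hPcol _ hxB D _ hD)
    have hb : ∑ D, col D (lead x) (‖wv D x‖⁻¹ • wv D x) = lastCol x := by
      set b' := ∑ D, col D (lead x) (‖wv D x‖⁻¹ • wv D x)
      rw [← Matrix.one_mulVec b', ← Matrix.one_mulVec (lastCol x), ← (hB _ hxB).sum_specProj,
        Matrix.sum_mulVec, Matrix.sum_mulVec]
      refine Finset.sum_congr rfl fun c' hc' => ?_
      by_cases hm : mult μ c' < mult ν c'
      · obtain ⟨D, hD, rfl⟩ := h₂ c' hm
        rw [hs.1 D hD, hcolx D hD]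
      · rw [hs.2 c' hc' hm]
        exact (normSqVec_eq_zero.1 ((hxx.2 c' hc').trans (hR0 c' hm))).symm
    change bordered (lead x) (∑ D, col D (lead x) (‖wv D x‖⁻¹ • wv D x))
      (star (∑ D, col D (lead x) (‖wv D x‖⁻¹ • wv D x))) (d₀ : ℂ) = x
    rw [hb]
    exact hxx.1.symm
  · rintro ⟨y, z⟩ ⟨⟨hy, hyU⟩, hz⟩
    have hz : ∀ D, size D ≠ 0 → ‖z D‖ = 1 := hz
    have hs := hsum y hy (fun D => col D y (z D)) (fun D hD => hcol0 D y _ hD)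
      (fun D hD => hPcol y hy D _ hD)
    refine Prod.ext (lead_bordered _ _ _ _) (funext fun D => ?_)
    by_cases hD : size D = 0
    · ext i
      exact absurd i.2 (by omega)
    · have hzD : z D ≠ 0 := fun h => by
        have := hz D hD
        rw [h, norm_zero] at this
        exact zero_ne_one this
      have hNp : 0 < normSqVec (K y *ᵥ ex D (z D)) := (normSqVec_nonneg _).lt_of_ne fun e =>
        hKex y hyU D _ hzD (normSqVec_eq_zero.1 e.symm)
      have hw : wv D (bordered y (∑ D, col D y (z D)) (star (∑ D, col D y (z D))) (d₀ : ℂ)) =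
          (√(R (c D)) / √(normSqVec (K y *ᵥ ex D (z D)))) • z D := by
        simp only [hwv, lead_bordered, lastCol_bordered]
        rw [← hre D (re D _), hex D hD]
        have h3 := hEK y hy hyU (c D) (hcS D hD) (∑ D, col D y (z D))
        rw [hs.1 D hD] at h3
        have h4 := congrArg ((K y)⁻¹ *ᵥ ·) h3
        simp only [hKinv y hyU, hcol, Matrix.mulVec_smul] at h4
        rw [hE] at h4
        rw [h4, map_smul, hre]
      change ‖wv D (bordered y (∑ D, col D y (z D)) (star (∑ D, col D y (z D))) (d₀ : ℂ))‖⁻¹ •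
        wv D (bordered y (∑ D, col D y (z D)) (star (∑ D, col D y (z D))) (d₀ : ℂ)) = z D
      have hsp : 0 < √(R (c D)) / √(normSqVec (K y *ᵥ ex D (z D))) :=
        div_pos (Real.sqrt_pos.2 (hRp D hD)) (Real.sqrt_pos.2 hNp)
      rw [hw, norm_smul, hz D hD, Real.norm_eq_abs, abs_of_pos hsp, mul_one, smul_smul,
        inv_mul_cancel₀ hsp.ne', one_smul]

end Tower

/-! ### Isotropy of the fibres -/

section Isotropy

variable {k : ℕ}

theorem star_vecMulVec (u v : Fin k → ℂ) :
    (Matrix.vecMulVec u v)ᴴ = Matrix.vecMulVec (star v) (star u) := by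
  ext i j; simp [Matrix.vecMulVec_apply, mul_comm]

/-- A skew-Hermitian matrix that annihilates the orthogonal complement of the span of `a` and `β`
and maps `a` to `β`. -/
theorem exists_skew_rank_two {a β : Fin k → ℂ} {R : ℝ} (hR : R ≠ 0)
    (h : star a ⬝ᵥ β + star β ⬝ᵥ a = 0) :
    ∃ Z : Matrix (Fin k) (Fin k) ℂ, Zᴴ = -Z ∧
      (∀ w, star a ⬝ᵥ w = (R : ℂ) → star β ⬝ᵥ w = star β ⬝ᵥ a → Z *ᵥ w = β) ∧
      ∀ (y : Matrix (Fin k) (Fin k) ℂ) (c : ℝ), y.IsHermitian → y *ᵥ a = c • a → y *ᵥ β = c • β →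
        Z * y = y * Z := by
  set θ := star β ⬝ᵥ a with hθ
  have hRc : (R : ℂ) ≠ 0 := by exact_mod_cast hR
  have hθs : star θ = -θ := by
    have : star θ = star a ⬝ᵥ β := by
      rw [hθ, Matrix.star_dotProduct, star_star]
    rw [this]; exact eq_neg_of_add_eq_zero_left h
  -- The rank-two rotation sends `w` to `β - R⁻¹ θ a`, and the term in `a aᴴ` removes the error.
  -- That term is skew-Hermitian because the hypothesis makes `θ` purely imaginary.
  refine ⟨(R : ℂ)⁻¹ • (Matrix.vecMulVec β (star a) - Matrix.vecMulVec a (star β)) +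
    ((R : ℂ)⁻¹ ^ 2 * θ) • Matrix.vecMulVec a (star a), ?_, ?_, ?_⟩
  · simp only [Matrix.conjTranspose_add, Matrix.conjTranspose_smul, Matrix.conjTranspose_sub,
      star_vecMulVec, star_star, star_mul', star_pow, star_inv₀, hθs]
    have : star (R : ℂ) = R := Complex.conj_ofReal R
    rw [this]
    module
  · intro w hw hw'
    simp only [Matrix.add_mulVec, Matrix.smul_mulVec, Matrix.sub_mulVec, Matrix.vecMulVec_mulVec,
      hw, hw']
    ext i
    simp
    field_simp
    ring
  · intro y c hy hya hyβ
    have h1 : ∀ u : Fin k → ℂ, y *ᵥ u = c • u → star u ᵥ* y = c • star u := by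
      intro u hu
      have := congrArg star hu
      rw [Matrix.star_mulVec, hy.eq] at this
      rw [this]; ext i; simp
    have h2 : ∀ u v : Fin k → ℂ, y *ᵥ u = c • u → y *ᵥ v = c • v →
        Matrix.vecMulVec u (star v) * y = y * Matrix.vecMulVec u (star v) := by
      intro u v hu hv
      rw [Matrix.vecMulVec_mul, Matrix.mul_vecMulVec, h1 v hv, hu]
      ext i j; simp [Matrix.vecMulVec_apply]; ring
    simp only [Matrix.add_mul, Matrix.mul_add, Matrix.smul_mul, Matrix.mul_smul, Matrix.sub_mul,
      Matrix.mul_sub, h2 _ _ hya hya, h2 _ _ hya hyβ, h2 _ _ hyβ hya]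

/-- Infinitesimal version of transporting eigenspaces. Differentiating the relations between the
projections shows that `X = ∑ P'_i P_i` is skew and `[X, P_j] = P'_j`, whence `[X, y] = y'`. The
remaining error `β = b' - X b` is corrected inside each eigenspace by a skew matrix commuting with
`y`, which is possible because the lengths of the components of `b` are constant to first order. -/
theorem exists_skew_of_projections (S : Finset ℝ) (P P' : ℝ → Matrix (Fin k) (Fin k) ℂ)
    (R : ℝ → ℝ) {y y' : Matrix (Fin k) (Fin k) ℂ} {b b' : Fin k → ℂ}
    (hne : ∀ i ∈ S, ∀ j ∈ S, i ≠ j → P i * P j = 0) (hself : ∀ i ∈ S, P i * P i = P i)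
    (hsum : ∑ i ∈ S, P i = 1) (hherm : ∀ i ∈ S, (P i)ᴴ = P i) (hy : y = ∑ i ∈ S, i • P i)
    (hne' : ∀ i ∈ S, ∀ j ∈ S, i ≠ j → P' i * P j + P i * P' j = 0)
    (hself' : ∀ i ∈ S, P' i * P i + P i * P' i = P' i)
    (hsum' : ∑ i ∈ S, P' i = 0) (hherm' : ∀ i ∈ S, (P' i)ᴴ = P' i) (hy' : y' = ∑ i ∈ S, i • P' i)
    (hb : ∀ i ∈ S, star b ⬝ᵥ (P i *ᵥ b) = (R i : ℂ))
    (hb' : ∀ i ∈ S, star b' ⬝ᵥ (P i *ᵥ b) + star b ⬝ᵥ (P' i *ᵥ b) + star b ⬝ᵥ (P i *ᵥ b') = 0)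
    (hb0 : ∀ i ∈ S, R i = 0 → P i *ᵥ b = 0 ∧ P' i *ᵥ b + P i *ᵥ b' = 0) :
    ∃ X : Matrix (Fin k) (Fin k) ℂ, Xᴴ = -X ∧ X * y - y * X = y' ∧ X *ᵥ b = b' := by
  set X := ∑ i ∈ S, P' i * P i with hX
  have hXs : Xᴴ = -X := by
    rw [eq_neg_iff_add_eq_zero, hX, Matrix.conjTranspose_sum, ← Finset.sum_add_distrib, ← hsum']
    refine Finset.sum_congr rfl fun i hi => ?_
    rw [Matrix.conjTranspose_mul, hherm i hi, hherm' i hi, add_comm, hself' i hi]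
  have hXP : ∀ j ∈ S, X * P j = P' j * P j := by
    intro j hj
    rw [hX, Finset.sum_mul, Finset.sum_eq_single j]
    · rw [Matrix.mul_assoc, hself j hj]
    · intro i hi hij
      rw [Matrix.mul_assoc, hne i hi j hj hij, Matrix.mul_zero]
    · exact fun h => absurd hj h
  have hPP'P : ∀ j ∈ S, P j * P' j * P j = 0 := by
    intro j hj
    have h1 := congrArg (fun M => P j * M * P j) (hself' j hj)
    simp only [Matrix.mul_add, Matrix.add_mul] at h1
    rw [← Matrix.mul_assoc (P j) (P j), hself j hj, ← Matrix.mul_assoc, Matrix.mul_assoc _ (P j) (P j),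
      hself j hj] at h1
    simpa using h1
  have hPX : ∀ j ∈ S, P j * X = P' j * P j - P' j := by
    intro j hj
    have h1 : ∀ i ∈ S, P j * (P' i * P i) = if i = j then 0 else - (P' j * P i) := by
      intro i hi
      split_ifs with h
      · rw [h, ← Matrix.mul_assoc, hPP'P j hj]
      · rw [← Matrix.mul_assoc, eq_neg_of_add_eq_zero_right (hne' j hj i hi (Ne.symm h)),
          Matrix.neg_mul, Matrix.mul_assoc, hself i hi]
    rw [hX, Finset.mul_sum, Finset.sum_congr rfl h1]
    have h2 : P' j = ∑ i ∈ S, P' j * P i := by rw [← Finset.mul_sum, hsum, Matrix.mul_one]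
    conv_rhs => rw [h2]
    rw [← Finset.add_sum_erase S _ hj, ← Finset.add_sum_erase S (fun i => P' j * P i) hj, if_pos rfl,
      Finset.sum_congr rfl fun i hi => if_neg (Finset.ne_of_mem_erase hi), Finset.sum_neg_distrib,
      Matrix.add_mul, Matrix.mul_assoc, hself j hj, Finset.sum_mul]
    have h3 : ∑ i ∈ S.erase j, P' j * P i * P j = 0 := Finset.sum_eq_zero fun i hi => by
      rw [Matrix.mul_assoc, hne i (Finset.mem_of_mem_erase hi) j hj (Finset.ne_of_mem_erase hi),
        Matrix.mul_zero]
    rw [h3]; abel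
  have hyP : ∀ j ∈ S, y * P j = j • P j := by
    intro j hj
    rw [hy, Finset.sum_mul, Finset.sum_eq_single j]
    · rw [Matrix.smul_mul, hself j hj]
    · intro i hi hij
      rw [Matrix.smul_mul, hne i hi j hj hij, smul_zero]
    · exact fun h => absurd hj h
  have hyh : y.IsHermitian := by
    rw [Matrix.IsHermitian, hy, Matrix.conjTranspose_sum]
    refine Finset.sum_congr rfl fun i hi => ?_
    rw [Matrix.conjTranspose_smul, hherm i hi, star_trivial]
  set β := b' - X *ᵥ b with hβ
  have hPβ : ∀ j ∈ S, P j *ᵥ β = P j *ᵥ b' - (P' j *ᵥ (P j *ᵥ b) - P' j *ᵥ b) := by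
    intro j hj
    rw [hβ, Matrix.mulVec_sub, Matrix.mulVec_mulVec, hPX j hj, Matrix.sub_mulVec,
      Matrix.mulVec_mulVec]
  have hZ : ∀ i ∈ S, ∃ Z : Matrix (Fin k) (Fin k) ℂ, Zᴴ = -Z ∧ Z *ᵥ b = P i *ᵥ β ∧ Z * y = y * Z := by
    intro i hi
    have hPw : ∀ u w : Fin k → ℂ, star (P i *ᵥ u) ⬝ᵥ w = star u ⬝ᵥ (P i *ᵥ w) := by
      intro u w
      rw [Matrix.star_mulVec, hherm i hi, ← Matrix.dotProduct_mulVec]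
    have hPP : ∀ w, P i *ᵥ (P i *ᵥ w) = P i *ᵥ w := fun w => by
      rw [Matrix.mulVec_mulVec, hself i hi]
    -- With zero weight both the component of `b` and its derivative vanish, so the error has no
    -- component here and no correction is needed.
    by_cases h0 : R i = 0
    · refine ⟨0, by simp, ?_, by simp⟩
      rw [hPβ i hi, (hb0 i hi h0).1, Matrix.mulVec_zero, Matrix.zero_mulVec, zero_sub,
        sub_neg_eq_add, add_comm, (hb0 i hi h0).2]
    · have hXb : star (X *ᵥ b) = - (star b ᵥ* X) := by
        rw [Matrix.star_mulVec, hXs, Matrix.vecMul_neg]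
      -- The side condition says that `⟨P_i b, P_i β⟩` has zero real part. It is `hb'`, once the
      -- contribution of `X` to the derivative has been absorbed.
      obtain ⟨Z, hZ1, hZ2, hZ3⟩ := exists_skew_rank_two (a := P i *ᵥ b) (β := P i *ᵥ β) h0
        (by
          rw [hPw, hPw, hPP, hPP, hPβ i hi, hβ, star_sub, hXb, sub_neg_eq_add, add_dotProduct,
            ← Matrix.dotProduct_mulVec, Matrix.mulVec_mulVec b X (P i), hXP i hi, dotProduct_sub,
            dotProduct_sub, ← Matrix.mulVec_mulVec b (P' i) (P i), ← hb' i hi]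
          ring)
      refine ⟨Z, hZ1, hZ2 b ?_ ?_, hZ3 y i hyh ?_ ?_⟩
      · rw [hPw, hb i hi]
      · rw [hPw, hPw, hPP]
      · rw [Matrix.mulVec_mulVec, hyP i hi, Matrix.smul_mulVec]
      · rw [Matrix.mulVec_mulVec, hyP i hi, Matrix.smul_mulVec]
  choose! Z hZ1 hZ2 hZ3 using hZ
  refine ⟨X + ∑ i ∈ S, Z i, ?_, ?_, ?_⟩
  · rw [Matrix.conjTranspose_add, hXs, Matrix.conjTranspose_sum, Finset.sum_congr rfl hZ1,
      Finset.sum_neg_distrib, neg_add]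
  · have h1 : (∑ i ∈ S, Z i) * y = y * ∑ i ∈ S, Z i := by
      rw [Finset.sum_mul, Finset.mul_sum, Finset.sum_congr rfl hZ3]
    rw [Matrix.add_mul, Matrix.mul_add, h1, add_sub_add_right_eq_sub, hy', hy, Finset.mul_sum,
      Finset.sum_mul, ← Finset.sum_sub_distrib]
    refine Finset.sum_congr rfl fun j hj => ?_
    rw [Matrix.mul_smul, Matrix.smul_mul, ← smul_sub, hXP j hj, hPX j hj, sub_sub_cancel]
  · have h1 : (∑ i ∈ S, Z i) *ᵥ b = β := by
      rw [Matrix.sum_mulVec, Finset.sum_congr rfl hZ2, ← Matrix.sum_mulVec, hsum, Matrix.one_mulVec]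
    rw [Matrix.add_mulVec, h1, hβ, add_sub_cancel]

theorem hasDerivAt_matrix {m n : Type*} [Fintype m] [Fintype n] {f : ℝ → Matrix m n ℂ}
    {f' : Matrix m n ℂ} {t : ℝ} :
    HasDerivAt f f' t ↔ ∀ i j, HasDerivAt (fun x => f x i j) (f' i j) t :=
  hasDerivAt_pi.trans (forall_congr' fun _ => hasDerivAt_pi)

theorem HasDerivAt.matrix_mul {f g : ℝ → Matrix (Fin k) (Fin k) ℂ}
    {f' g' : Matrix (Fin k) (Fin k) ℂ} {t : ℝ} (hf : HasDerivAt f f' t) (hg : HasDerivAt g g' t) :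
    HasDerivAt (fun x => f x * g x) (f' * g t + f t * g') t :=
  hasDerivAt_matrix.2 fun i j => by
    simp only [Matrix.mul_apply, Matrix.add_apply, ← Finset.sum_add_distrib]
    exact HasDerivAt.fun_sum fun l _ => (hasDerivAt_matrix.1 hf i l).mul (hasDerivAt_matrix.1 hg l j)

theorem HasDerivAt.matrix_mulVec {f : ℝ → Matrix (Fin k) (Fin k) ℂ} {g : ℝ → Fin k → ℂ}
    {f' : Matrix (Fin k) (Fin k) ℂ} {g' : Fin k → ℂ} {t : ℝ} (hf : HasDerivAt f f' t)
    (hg : HasDerivAt g g' t) : HasDerivAt (fun x => f x *ᵥ g x) (f' *ᵥ g t + f t *ᵥ g') t :=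
  hasDerivAt_pi.2 fun i => by
    simp only [Matrix.mulVec, dotProduct, Pi.add_apply, ← Finset.sum_add_distrib]
    exact HasDerivAt.fun_sum fun l _ => (hasDerivAt_matrix.1 hf i l).mul (hasDerivAt_pi.1 hg l)

theorem HasDerivAt.vec_dotProduct {f g : ℝ → Fin k → ℂ} {f' g' : Fin k → ℂ} {t : ℝ}
    (hf : HasDerivAt f f' t) (hg : HasDerivAt g g' t) :
    HasDerivAt (fun x => f x ⬝ᵥ g x) (f' ⬝ᵥ g t + f t ⬝ᵥ g') t := by
  simp only [dotProduct, ← Finset.sum_add_distrib]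
  exact HasDerivAt.fun_sum fun l _ => (hasDerivAt_pi.1 hf l).mul (hasDerivAt_pi.1 hg l)

theorem HasDerivAt.complex_star {f : ℝ → ℂ} {f' : ℂ} {t : ℝ} (hf : HasDerivAt f f' t) :
    HasDerivAt (fun x => star (f x)) (star f') t :=
  Complex.conjCLE.toContinuousLinearMap.hasFDerivAt.comp_hasDerivAt t hf

theorem HasDerivAt.vec_star {f : ℝ → Fin k → ℂ} {f' : Fin k → ℂ} {t : ℝ}
    (hf : HasDerivAt f f' t) : HasDerivAt (fun x => star (f x)) (star f') t :=
  hasDerivAt_pi.2 fun i => (hasDerivAt_pi.1 hf i).complex_star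

theorem HasDerivAt.matrix_conjTranspose {f : ℝ → Matrix (Fin k) (Fin k) ℂ}
    {f' : Matrix (Fin k) (Fin k) ℂ} {t : ℝ} (hf : HasDerivAt f f' t) :
    HasDerivAt (fun x => (f x)ᴴ) f'ᴴ t :=
  hasDerivAt_matrix.2 fun i j => (hasDerivAt_matrix.1 hf j i).complex_star

theorem HasDerivAt.eq_of_eventuallyEq_const {E : Type*} [NormedAddCommGroup E] [NormedSpace ℝ E]
    {f : ℝ → E} {f' C : E} {t : ℝ} (hf : HasDerivAt f f' t) (h : ∀ᶠ s in 𝓝 t, f s = C) : f' = 0 :=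
  hf.unique ((hasDerivAt_const t C).congr_of_eventuallyEq h)

/-- A tangent vector to the set of Hermitian matrices with given spectrum and given spectrum of the
leading block is induced by the action of the smaller unitary group. -/
theorem exists_skew_of_tangent {ν : Fin k → ℝ} {μ : Fin (k + 1) → ℝ} (hint : Interlacing ν μ)
    {S : Set (Matrix (Fin (k + 1)) (Fin (k + 1)) ℂ)}
    (hS : ∀ x ∈ S, HasSpectrum x μ ∧ HasSpectrum (lead x) ν)
    {x v : Matrix (Fin (k + 1)) (Fin (k + 1)) ℂ} (h : IsTangentVector S x v) :
    ∃ X : Matrix (Fin k) (Fin k) ℂ, Xᴴ = -X ∧ X * lead x - lead x * X = lead v ∧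
      bordered X 0 0 0 * x - x * bordered X 0 0 0 = v := by
  obtain ⟨d₀, R, -, -, hR⟩ := hint.exists_weights
  have hR : IsWeight ν μ d₀ R := hR
  obtain ⟨γ, hsm, h0, hev, hder⟩ := h
  have hder' := hasDerivAt_matrix.1 hder
  have hy : HasDerivAt (fun t => lead (γ t)) (lead v) 0 := hasDerivAt_matrix.2 fun i j => hder' _ _
  have hb : HasDerivAt (fun t => lastCol (γ t)) (lastCol v) 0 := hasDerivAt_pi.2 fun i => hder' _ _
  have hP : ∀ c, ∃ P', HasDerivAt (fun t => specProj ν c (lead (γ t))) P' 0 := by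
    intro c
    -- A finite order of differentiability at the point already holds on a neighbourhood, and order
    -- one suffices for the derivative of a spectral projection.
    obtain ⟨u, hu, hcd⟩ := (hsm.of_le (m := 1) (by norm_cast)).contDiffOn le_rfl (by simp)
    have h1 : ContDiffOn ℝ 1 (fun t => specProj ν c (lead (γ t))) u :=
      (hcd.lead).matrix_aeval _
    exact ⟨_, ((h1.contDiffAt hu).differentiableAt one_ne_zero).hasDerivAt⟩
  choose P' hP' using hP
  have hsp : ∀ᶠ t in 𝓝 (0 : ℝ), HasSpectrum (lead (γ t)) ν := hev.mono fun t ht => (hS _ ht).2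
  have hfib : ∀ᶠ t in 𝓝 (0 : ℝ),
      γ t = bordered (lead (γ t)) (lastCol (γ t)) (star (lastCol (γ t))) (d₀ : ℂ) ∧
      ∀ c ∈ Finset.univ.image ν, normSqVec (specProj ν c (lead (γ t)) *ᵥ lastCol (γ t)) = R c :=
    hev.mono fun t ht => ((hS _ ht).2.iff_of_lead (hS _ ht).1.1 hR).1 (hS _ ht).1
  have hsp0 : HasSpectrum (lead x) ν := h0 ▸ hsp.self_of_nhds
  have hfib0 := hfib.self_of_nhds
  rw [h0] at hfib0
  have hherm' : ∀ c, (P' c)ᴴ = P' c := fun c => by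
    have := (hP' c).matrix_conjTranspose
    exact this.unique ((hP' c).congr_of_eventuallyEq (hsp.mono fun t ht => ht.specProj_conjTranspose c))
  obtain ⟨X, hX1, hX2, hX3⟩ := exists_skew_of_projections (Finset.univ.image ν)
    (fun c => specProj ν c (lead x)) P' R (y := lead x) (y' := lead v) (b := lastCol x)
    (b' := lastCol v)
    (fun i _ j _ hij => hsp0.specProj_mul_of_ne hij) (fun i _ => hsp0.specProj_mul_self i)
    hsp0.sum_specProj (fun i _ => hsp0.specProj_conjTranspose i) hsp0.sum_smul_specProj.symm
    (fun i _ j _ hij => by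
      have h1 := (hP' i).matrix_mul (hP' j)
      rw [h0] at h1
      exact h1.eq_of_eventuallyEq_const (hsp.mono fun t ht => ht.specProj_mul_of_ne hij))
    (fun i _ => by
      have h1 := (hP' i).matrix_mul (hP' i)
      rw [h0] at h1
      exact h1.unique ((hP' i).congr_of_eventuallyEq (hsp.mono fun t ht => ht.specProj_mul_self i)))
    ((HasDerivAt.fun_sum fun i _ => hP' i).eq_of_eventuallyEq_const
      (hsp.mono fun t ht => ht.sum_specProj))
    (fun i _ => hherm' i)
    (hy.unique ((HasDerivAt.fun_sum fun i _ => (hP' i).const_smul i).congr_of_eventuallyEq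
      (hsp.mono fun t ht => ht.sum_smul_specProj.symm)))
    (fun i hi => by rw [hsp0.star_dotProduct_specProj, hfib0.2 i hi])
    (fun i hi => by
      have h1 := hb.vec_star.vec_dotProduct ((hP' i).matrix_mulVec hb)
      rw [h0, dotProduct_add, ← add_assoc] at h1
      refine h1.eq_of_eventuallyEq_const (C := (R i : ℂ)) ?_
      filter_upwards [hsp, hfib] with t ht ht'
      rw [ht.star_dotProduct_specProj, ht'.2 i hi])
    (fun i hi hRi => by
      constructor
      · rw [← normSqVec_eq_zero, hfib0.2 i hi, hRi]
      · have h1 := (hP' i).matrix_mulVec hb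
        rw [h0] at h1
        refine h1.eq_of_eventuallyEq_const (C := 0) ?_
        filter_upwards [hfib] with t ht'
        rw [← normSqVec_eq_zero, ht'.2 i hi, hRi])
  refine ⟨X, hX1, hX2, ?_⟩
  -- Along the curve the corner is the constant `d₀` and the matrix stays Hermitian, so the tangent
  -- vector is determined by its leading block and last column.
  have hv : v = bordered (lead v) (lastCol v) (star (lastCol v)) 0 := by
    have hd : v (Fin.last k) (Fin.last k) = 0 :=
      (hder' _ _).eq_of_eventuallyEq_const (C := (d₀ : ℂ)) (hfib.mono fun t ht => by
        rw [ht.1, bordered_last_last])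
    have hh : v.IsHermitian := by
      have h1 := hder.matrix_conjTranspose
      exact h1.unique (hder.congr_of_eventuallyEq (hev.mono fun t ht => (hS _ ht).1.1.eq))
    rw [← hd]; exact hh.eq_bordered
  rw [hfib0.1, bordered_mul, bordered_mul, bordered_sub, hv]
  have hrow : star (lastCol x) ᵥ* X = - star (lastCol v) := by
    rw [← hX3, Matrix.star_mulVec, hX1, Matrix.vecMul_neg, neg_neg]
  simp only [Matrix.vecMulVec_zero, Matrix.zero_vecMulVec, add_zero, smul_zero, zero_smul,
    Matrix.mulVec_zero, Matrix.zero_vecMul, dotProduct_zero, zero_dotProduct, mul_zero, zero_mul,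
    sub_zero, zero_sub, sub_self, hX2, hX3, hrow, neg_neg]

theorem isTangentVector_lead {S : Set (Matrix (Fin (k + 1)) (Fin (k + 1)) ℂ)}
    {T : Set (Matrix (Fin k) (Fin k) ℂ)} (hST : MapsTo lead S T)
    {x v : Matrix (Fin (k + 1)) (Fin (k + 1)) ℂ} (h : IsTangentVector S x v) :
    IsTangentVector T (lead x) (lead v) := by
  obtain ⟨γ, hsm, h0, hev, hder⟩ := h
  refine ⟨fun t => lead (γ t), ?_, by simp [h0], hev.mono fun t ht => hST ht,
    hasDerivAt_matrix.2 fun i j => hasDerivAt_matrix.1 hder _ _⟩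
  rw [← contDiffWithinAt_univ] at hsm ⊢
  exact contDiffWithinAt_pi.2 fun i => contDiffWithinAt_pi.2 fun j =>
    contDiffWithinAt_pi.1 (contDiffWithinAt_pi.1 hsm i.castSucc) j.castSucc

/-- Tangent vectors are induced by matrices `X`, `Y` with zero last row and column. Then `tr (x [X,
Y])` involves only the leading block of `x`, and the same `X`, `Y` induce the projected tangent
vectors there. The pairing descends through the tower to the empty matrix. -/
theorem kksForm_eq_zero_of_mem_gcTower {a : ℕ → ℕ → ℝ} : ∀ {k : ℕ},
    (∀ m < k, Interlacing (fun i : Fin m => a m i) fun i : Fin (m + 1) => a (m + 1) i) →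
    ∀ {x v w : Matrix (Fin k) (Fin k) ℂ}, IsTangentVector (gcTower a k) x v →
      IsTangentVector (gcTower a k) x w → kksForm x v w = 0
  | 0, _, x, v, w, _, _ => by
    unfold kksForm
    split_ifs <;> simp [Matrix.trace]
  | k + 1, hint, x, v, w, hv, hw => by
    have hS : ∀ x ∈ gcTower a (k + 1), HasSpectrum x (fun i => a (k + 1) i) ∧
        HasSpectrum (lead x) fun i => a k i := fun x hx => ⟨hx.1, hasSpectrum_of_mem_gcTower hx.2⟩
    obtain ⟨X, hX1, hX2, hX3⟩ := exists_skew_of_tangent (hint k (Nat.lt_succ_self k)) hS hv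
    obtain ⟨Y, hY1, hY2, hY3⟩ := exists_skew_of_tangent (hint k (Nat.lt_succ_self k)) hS hw
    have ih := kksForm_eq_zero_of_mem_gcTower (fun m hm => hint m (Nat.lt_succ_of_lt hm))
      (isTangentVector_lead (fun x hx => hx.2) hv) (isTangentVector_lead (fun x hx => hx.2) hw)
    rw [← hX2, ← hY2, kksForm_apply _ _ _ hX1 hY1] at ih
    have hs : ∀ X : Matrix (Fin k) (Fin k) ℂ, Xᴴ = -X → (bordered X 0 0 0)ᴴ = -bordered X 0 0 0 := by
      intro X hX
      rw [bordered_conjTranspose, hX]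
      apply matrix_ext_lastCases <;> intros <;> simp
    rw [← hX3, ← hY3, kksForm_apply _ _ _ (hs X hX1) (hs Y hY1), ← ih]
    congr 2
    rw [bordered_mul, bordered_mul, bordered_sub, eq_bordered x, bordered_mul, trace_bordered]
    simp

end Isotropy

/-! ### Fibres over points with the same pattern are diffeomorphic -/

section Deformation

open Polynomial

variable {k m : ℕ}

theorem aeval_mul_of_intertwine {N M : Type*} [Fintype N] [DecidableEq N] [Fintype M] [DecidableEq M]
    {x : Matrix N N ℂ} {A : Matrix M M ℂ} {J : Matrix N M ℂ} (h : x * J = J * A) (p : ℝ[X]) :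
    aeval x p * J = J * aeval A p := by
  have hpow : ∀ m : ℕ, x ^ m * J = J * A ^ m := by
    intro m
    induction m with
    | zero => simp
    | succ m ih => rw [pow_succ, Matrix.mul_assoc, h, ← Matrix.mul_assoc, ih, Matrix.mul_assoc, ← pow_succ]
  induction p using Polynomial.induction_on' with
  | add p q hp hq => simp only [map_add, hp, hq, Matrix.mul_add, Matrix.add_mul]
  | monomial m a =>
    simp only [aeval_monomial, hpow, Algebra.algebraMap_eq_smul_one, Matrix.smul_mul,
      Matrix.one_mul, Matrix.mul_smul]

theorem exists_aeval_bordered_zero (y : Matrix (Fin k) (Fin k) ℂ) (p : ℝ[X]) :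
    ∃ e : ℂ, aeval (bordered y 0 0 0) p = bordered (aeval y p) 0 0 e := by
  have hpow : ∀ m : ℕ, ∃ e : ℂ, bordered y 0 0 0 ^ m = bordered (y ^ m) 0 0 e := by
    intro m
    induction m with
    | zero => exact ⟨1, by rw [pow_zero, pow_zero, bordered_one]⟩
    | succ m ih =>
      obtain ⟨e, he⟩ := ih
      exact ⟨0, by rw [pow_succ, he, bordered_mul, pow_succ]; simp⟩
  induction p using Polynomial.induction_on' with
  | add p q hp hq =>
    obtain ⟨e, he⟩ := hp
    obtain ⟨e', he'⟩ := hq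
    exact ⟨e + e', by rw [map_add, he, he', bordered_add, map_add]; simp⟩
  | monomial m a =>
    obtain ⟨e, he⟩ := hpow m
    refine ⟨a • e, ?_⟩
    simp only [aeval_monomial, he, Algebra.algebraMap_eq_smul_one, Matrix.smul_mul, Matrix.one_mul]
    apply matrix_ext_lastCases <;> intros <;> simp

/-- The transformation acting by `T` on the span of the orthonormal frame `J`, and trivially on its
orthogonal complement. -/
def frameMap (J : Matrix (Fin k) (Fin m) ℂ) (T : Matrix (Fin m) (Fin m) ℂ) :
    Matrix (Fin k) (Fin k) ℂ :=
  1 + J * (T - 1) * Jᴴ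

theorem frameMap_conjTranspose (J : Matrix (Fin k) (Fin m) ℂ) (T : Matrix (Fin m) (Fin m) ℂ) :
    (frameMap J T)ᴴ = frameMap J Tᴴ := by
  simp [frameMap, Matrix.mul_assoc]

theorem frameMap_mem {J : Matrix (Fin k) (Fin m) ℂ} {T : Matrix (Fin m) (Fin m) ℂ}
    (hJ : Jᴴ * J = 1) (hT : T ∈ Matrix.unitaryGroup (Fin m) ℂ) :
    frameMap J T ∈ Matrix.unitaryGroup (Fin k) ℂ := by
  rw [Matrix.mem_unitaryGroup_iff, Matrix.star_eq_conjTranspose, frameMap_conjTranspose]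
  have h1 : ∀ X : Matrix (Fin m) (Fin k) ℂ, Jᴴ * (J * X) = X := fun X => by
    rw [← Matrix.mul_assoc, hJ, Matrix.one_mul]
  have h2 : ∀ X : Matrix (Fin m) (Fin k) ℂ, T * (Tᴴ * X) = X := fun X => by
    rw [← Matrix.mul_assoc, mul_conjTranspose_of_mem hT, Matrix.one_mul]
  simp only [frameMap, Matrix.mul_add, Matrix.add_mul, Matrix.mul_one, Matrix.one_mul,
    Matrix.mul_sub, Matrix.sub_mul, Matrix.mul_assoc, h1, h2]
  abel

/-- The range of `J` is invariant under `x`, hence so is its orthogonal complement since `x` is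
Hermitian. Conjugation leaves the complementary part alone and acts on the matrix `A` of the
restriction by `T`. -/
theorem frameMap_conj {x : Matrix (Fin k) (Fin k) ℂ} {J : Matrix (Fin k) (Fin m) ℂ}
    {A : Matrix (Fin m) (Fin m) ℂ} (hJ : Jᴴ * J = 1) (hx : x.IsHermitian) (h : x * J = J * A)
    (T : Matrix (Fin m) (Fin m) ℂ) (p : ℝ[X]) :
    frameMap J T * aeval x p * (frameMap J T)ᴴ =
      aeval x p * (1 - J * Jᴴ) + J * (T * aeval A p * Tᴴ) * Jᴴ := by
  rw [frameMap_conjTranspose]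
  have h1 : ∀ X : Matrix (Fin m) (Fin k) ℂ, Jᴴ * (J * X) = X := fun X => by
    rw [← Matrix.mul_assoc, hJ, Matrix.one_mul]
  have h2 := aeval_mul_of_intertwine h p
  have hA : A.IsHermitian := by
    have : A = Jᴴ * x * J := by rw [Matrix.mul_assoc, h, ← Matrix.mul_assoc, hJ, Matrix.one_mul]
    rw [Matrix.IsHermitian, this]
    simp [Matrix.mul_assoc, hx.eq]
  have h3 : Jᴴ * aeval x p = aeval A p * Jᴴ := by
    have := congrArg Matrix.conjTranspose h2
    rwa [Matrix.conjTranspose_mul, Matrix.conjTranspose_mul, (hx.aeval p).eq, (hA.aeval p).eq] at this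
  set q := aeval x p
  set B := aeval A p
  have h4 : ∀ X : Matrix (Fin m) (Fin k) ℂ, q * (J * X) = J * (B * X) := fun X => by
    rw [← Matrix.mul_assoc, h2, Matrix.mul_assoc]
  have h5 : ∀ X : Matrix (Fin k) (Fin k) ℂ, Jᴴ * (q * X) = B * (Jᴴ * X) := fun X => by
    rw [← Matrix.mul_assoc, h3, Matrix.mul_assoc]
  simp only [frameMap, Matrix.mul_add, Matrix.add_mul, Matrix.mul_one, Matrix.one_mul,
    Matrix.mul_sub, Matrix.sub_mul, Matrix.mul_assoc, h1, h3, h4]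
  abel

/-- The orthonormal frame formed by the normalized components of the last column of `x` in the
eigenspaces of the leading block for the eigenvalues `c i`, and the last basis vector. -/
noncomputable def stepFrame (ν : Fin k → ℝ) (c s : Fin m → ℝ)
    (x : Matrix (Fin (k + 1)) (Fin (k + 1)) ℂ) : Matrix (Fin (k + 1)) (Fin (m + 1)) ℂ :=
  bordered (Matrix.of fun j i => ((s i)⁻¹ • (specProj ν (c i) (lead x) *ᵥ lastCol x)) j) 0 0 1

/-- The real symmetric arrow matrix with diagonal `c`, border `s` and corner `d`. -/
def arrowMatrix (c s : Fin m → ℝ) (d : ℝ) : Matrix (Fin (m + 1)) (Fin (m + 1)) ℂ :=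
  bordered (Matrix.diagonal fun i => (c i : ℂ)) (fun i => (s i : ℂ)) (fun i => (s i : ℂ)) d

theorem bordered_unitary {g : Matrix (Fin k) (Fin k) ℂ} (hg : g ∈ Matrix.unitaryGroup (Fin k) ℂ) :
    bordered g 0 0 1 ∈ Matrix.unitaryGroup (Fin (k + 1)) ℂ := by
  rw [Matrix.mem_unitaryGroup_iff, Matrix.star_eq_conjTranspose, bordered_conjTranspose,
    bordered_mul, mul_conjTranspose_of_mem hg, ← bordered_one]
  simp

theorem lead_bordered_conj (g : Matrix (Fin k) (Fin k) ℂ)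
    (x : Matrix (Fin (k + 1)) (Fin (k + 1)) ℂ) :
    lead (bordered g 0 0 1 * x * (bordered g 0 0 1)ᴴ) = g * lead x * gᴴ := by
  conv_lhs => rw [eq_bordered x, bordered_conjTranspose, bordered_mul, bordered_mul]
  simp

theorem lastCol_bordered_conj (g : Matrix (Fin k) (Fin k) ℂ)
    (x : Matrix (Fin (k + 1)) (Fin (k + 1)) ℂ) :
    lastCol (bordered g 0 0 1 * x * (bordered g 0 0 1)ᴴ) = g *ᵥ lastCol x := by
  conv_lhs => rw [eq_bordered x, bordered_conjTranspose, bordered_mul, bordered_mul]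
  simp

/-- The data of a bordered Hermitian matrix: leading block with spectrum `ν`, corner `d`, and last
column with components of norm `s i` in the `c i`-eigenspaces and no others. -/
structure IsStep (ν : Fin k → ℝ) (c s : Fin m → ℝ) (d : ℝ)
    (x : Matrix (Fin (k + 1)) (Fin (k + 1)) ℂ) : Prop where
  spec : HasSpectrum (lead x) ν
  eq : x = bordered (lead x) (lastCol x) (star (lastCol x)) (d : ℂ)
  norm : ∀ i, normSqVec (specProj ν (c i) (lead x) *ᵥ lastCol x) = s i ^ 2
  sum : ∑ i, specProj ν (c i) (lead x) *ᵥ lastCol x = lastCol x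

section

variable {ν : Fin k → ℝ} {c s : Fin m → ℝ} {d : ℝ} {x : Matrix (Fin (k + 1)) (Fin (k + 1)) ℂ}

/-- The upper left block of `stepFrame`. -/
noncomputable def stepBlock (ν : Fin k → ℝ) (c s : Fin m → ℝ)
    (x : Matrix (Fin (k + 1)) (Fin (k + 1)) ℂ) : Matrix (Fin k) (Fin m) ℂ :=
  Matrix.of fun j i => ((s i)⁻¹ • (specProj ν (c i) (lead x) *ᵥ lastCol x)) j

theorem stepFrame_eq : stepFrame ν c s x = bordered (stepBlock ν c s x) 0 0 1 := rfl

theorem mul_stepBlock_apply (M : Matrix (Fin k) (Fin k) ℂ) (j : Fin k) (i : Fin m) :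
    (M * stepBlock ν c s x) j i =
      ((s i)⁻¹ • (M *ᵥ (specProj ν (c i) (lead x) *ᵥ lastCol x))) j := by
  rw [Pi.smul_apply, Matrix.mul_apply, Matrix.mulVec, dotProduct, Finset.smul_sum]
  simp only [stepBlock, Matrix.of_apply, Pi.smul_apply, mul_smul_comm]

theorem stepFrame_conj (ν : Fin k → ℝ) (c s : Fin m → ℝ) {g : Matrix (Fin k) (Fin k) ℂ}
    (hg : g ∈ Matrix.unitaryGroup (Fin k) ℂ) (x : Matrix (Fin (k + 1)) (Fin (k + 1)) ℂ) :
    stepFrame ν c s (bordered g 0 0 1 * x * (bordered g 0 0 1)ᴴ) =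
      bordered g 0 0 1 * stepFrame ν c s x := by
  have h : stepBlock ν c s (bordered g 0 0 1 * x * (bordered g 0 0 1)ᴴ) = g * stepBlock ν c s x := by
    ext j i
    rw [mul_stepBlock_apply, stepBlock, Matrix.of_apply, lead_bordered_conj, lastCol_bordered_conj,
      specProj_conj hg, Matrix.mulVec_mulVec, Matrix.mulVec_mulVec, Matrix.mul_assoc,
      conjTranspose_mul_of_mem hg, Matrix.mul_one]
  rw [stepFrame_eq, stepFrame_eq, bordered_mul, h]
  simp

/-- The construction is equivariant under the smaller unitary group. This lets the correction at one
level commute past the correction of the leading block. -/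
theorem frameMap_stepFrame_conj (ν : Fin k → ℝ) (c s : Fin m → ℝ)
    (T : Matrix (Fin (m + 1)) (Fin (m + 1)) ℂ) {g : Matrix (Fin k) (Fin k) ℂ}
    (hg : g ∈ Matrix.unitaryGroup (Fin k) ℂ) (x : Matrix (Fin (k + 1)) (Fin (k + 1)) ℂ) :
    frameMap (stepFrame ν c s (bordered g 0 0 1 * x * (bordered g 0 0 1)ᴴ)) T =
      bordered g 0 0 1 * frameMap (stepFrame ν c s x) T * (bordered g 0 0 1)ᴴ := by
  rw [stepFrame_conj ν c s hg, frameMap, frameMap, Matrix.mul_add, Matrix.mul_one, Matrix.add_mul,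
    mul_conjTranspose_of_mem (bordered_unitary hg), Matrix.conjTranspose_mul]
  simp only [Matrix.mul_assoc]

theorem stepBlock_mulVec (hs : ∀ i, 0 < s i) (t : Fin m → ℝ) :
    stepBlock ν c s x *ᵥ (fun i => (t i : ℂ)) =
      ∑ i, (t i / s i) • (specProj ν (c i) (lead x) *ᵥ lastCol x) := by
  ext j
  simp only [stepBlock, Matrix.mulVec, dotProduct, Matrix.of_apply, Pi.smul_apply, Finset.sum_apply,
    Complex.real_smul]
  refine Finset.sum_congr rfl fun i _ => ?_
  push_cast
  have := (hs i).ne'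
  ring

theorem IsStep.specProj_mul_stepBlock (h : IsStep ν c s d x) (hc : Function.Injective c) (i : Fin m) :
    specProj ν (c i) (lead x) * stepBlock ν c s x =
      Matrix.of fun j i' => if i' = i then stepBlock ν c s x j i' else 0 := by
  ext j i'
  rw [mul_stepBlock_apply, Matrix.mulVec_mulVec, Matrix.of_apply]
  split_ifs with hi
  · subst hi
    rw [h.spec.specProj_mul_self]; rfl
  · rw [h.spec.specProj_mul_of_ne fun e => hi (hc e).symm, Matrix.zero_mulVec, smul_zero]; rfl

theorem IsStep.stepBlock_orthonormal (h : IsStep ν c s d x) (hc : Function.Injective c)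
    (hs : ∀ i, 0 < s i) : (stepBlock ν c s x)ᴴ * stepBlock ν c s x = 1 := by
  ext i i'
  have h1 : ((stepBlock ν c s x)ᴴ * stepBlock ν c s x) i i' = ((s i)⁻¹ * (s i')⁻¹ : ℝ) *
      (star (specProj ν (c i) (lead x) *ᵥ lastCol x) ⬝ᵥ
        (specProj ν (c i') (lead x) *ᵥ lastCol x)) := by
    simp only [stepBlock, Matrix.mul_apply, Matrix.conjTranspose_apply, Matrix.of_apply,
      Pi.smul_apply, dotProduct, Pi.star_apply, Finset.mul_sum, Complex.real_smul, star_mul']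
    refine Finset.sum_congr rfl fun j _ => ?_
    have : star (((s i)⁻¹ : ℝ) : ℂ) = ((s i)⁻¹ : ℝ) := Complex.conj_ofReal _
    rw [this]; push_cast; ring
  rw [h1]
  by_cases hi : i = i'
  · subst hi
    rw [star_dotProduct_self, h.norm i, Matrix.one_apply_eq]
    have := (hs i).ne'
    norm_cast
    field_simp
  · rw [Matrix.star_mulVec, h.spec.specProj_conjTranspose, ← Matrix.dotProduct_mulVec,
      Matrix.mulVec_mulVec, h.spec.specProj_mul_of_ne fun e => hi (hc e), Matrix.zero_mulVec,
      dotProduct_zero, mul_zero, Matrix.one_apply_ne hi]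

theorem IsStep.stepFrame_orthonormal (h : IsStep ν c s d x) (hc : Function.Injective c)
    (hs : ∀ i, 0 < s i) : (stepFrame ν c s x)ᴴ * stepFrame ν c s x = 1 := by
  rw [stepFrame_eq, bordered_conjTranspose, bordered_mul, h.stepBlock_orthonormal hc hs, ← bordered_one]
  simp

theorem IsStep.aeval_mul_stepBlock (h : IsStep ν c s d x) (p : ℝ[X]) :
    aeval (lead x) p * stepBlock ν c s x =
      stepBlock ν c s x * Matrix.diagonal fun i => ((p.eval (c i) : ℝ) : ℂ) := by
  ext j i
  rw [mul_stepBlock_apply, Matrix.mulVec_mulVec, h.spec.aeval_mul_specProj, Matrix.mul_diagonal]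
  simp [stepBlock, Matrix.smul_mulVec]
  ring

theorem IsStep.stepBlock_mulVec_norm (h : IsStep ν c s d x) (hs : ∀ i, 0 < s i) :
    stepBlock ν c s x *ᵥ (fun i => (s i : ℂ)) = lastCol x := by
  rw [stepBlock_mulVec hs, ← h.sum]
  refine Finset.sum_congr rfl fun i _ => ?_
  rw [h.sum, div_self (hs i).ne', one_smul]

theorem IsStep.star_lastCol_vecMul (h : IsStep ν c s d x) (hc : Function.Injective c)
    (hs : ∀ i, 0 < s i) : star (lastCol x) ᵥ* stepBlock ν c s x = fun i => (s i : ℂ) := by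
  rw [← h.stepBlock_mulVec_norm hs, Matrix.star_mulVec, Matrix.vecMul_vecMul,
    h.stepBlock_orthonormal hc hs, Matrix.vecMul_one]
  ext i; simp

/-- On the frame, the leading block acts with eigenvalues `c i` and the border couples the `i`-th
vector to the last basis vector with strength `s i`. The resulting matrix does not depend on `x`, so
a single `T` can be used for the whole fibre. -/
theorem IsStep.mul_stepFrame (h : IsStep ν c s d x) (hc : Function.Injective c)
    (hs : ∀ i, 0 < s i) : x * stepFrame ν c s x = stepFrame ν c s x * arrowMatrix c s d := by
  have h1 := h.aeval_mul_stepBlock X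
  simp only [aeval_X, eval_X] at h1
  rw [stepFrame_eq, arrowMatrix, bordered_mul]
  rw [show x * bordered (stepBlock ν c s x) 0 0 1 = bordered (lead x) (lastCol x)
    (star (lastCol x)) (d : ℂ) * bordered (stepBlock ν c s x) 0 0 1 by rw [← h.eq]]
  rw [bordered_mul, h1, h.stepBlock_mulVec_norm hs, h.star_lastCol_vecMul hc hs]
  simp only [smul_zero, zero_add, one_smul, add_zero, Matrix.mulVec_zero, Matrix.zero_vecMulVec,
    Matrix.zero_vecMul, dotProduct_zero, zero_dotProduct, mul_one, one_mul]
  congr 1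
  ext i j
  simp [Matrix.vecMulVec_apply]

/-- The orthogonal complement of the frame lies in the first `k` coordinates and is orthogonal to
the last column. There `x` acts as its leading block, and so do polynomials in `x`. -/
theorem IsStep.aeval_mul_complement (h : IsStep ν c s d x) (hc : Function.Injective c)
    (hs : ∀ i, 0 < s i) (p : ℝ[X]) :
    aeval x p * (1 - stepFrame ν c s x * (stepFrame ν c s x)ᴴ) =
      bordered (aeval (lead x) p * (1 - stepBlock ν c s x * (stepBlock ν c s x)ᴴ)) 0 0 0 := by
  set β := stepBlock ν c s x with hβ
  have h0 : 1 - stepFrame ν c s x * (stepFrame ν c s x)ᴴ = bordered (1 - β * βᴴ) 0 0 0 := by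
    rw [stepFrame_eq, bordered_conjTranspose, bordered_mul, ← bordered_one, bordered_sub]
    simp [hβ]
  have hcomm : ∀ p : ℝ[X], aeval (lead x) p * (1 - β * βᴴ) = (1 - β * βᴴ) * aeval (lead x) p := by
    intro p
    have h1 := h.aeval_mul_stepBlock p
    have h2 : aeval (lead x) p * (β * βᴴ) = β * βᴴ * aeval (lead x) p := by
      have h3 := congrArg Matrix.conjTranspose h1
      rw [Matrix.conjTranspose_mul, Matrix.conjTranspose_mul, (h.spec.1.aeval p).eq,
        Matrix.diagonal_conjTranspose] at h3
      rw [← Matrix.mul_assoc, h1, Matrix.mul_assoc β βᴴ, h3, Matrix.mul_assoc]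
      congr 3
      ext i; simp
    rw [Matrix.mul_sub, Matrix.sub_mul, h2, Matrix.mul_one, Matrix.one_mul]
  have hrow : star (lastCol x) ᵥ* (1 - β * βᴴ) = 0 := by
    rw [Matrix.vecMul_sub, Matrix.vecMul_one, ← Matrix.vecMul_vecMul, h.star_lastCol_vecMul hc hs,
      sub_eq_zero]
    have := congrArg star (h.stepBlock_mulVec_norm hs)
    rw [Matrix.star_mulVec] at this
    rw [← this]
    congr 1
    ext i; simp
  have hint : x * bordered (1 - β * βᴴ) 0 0 0 =
      bordered (1 - β * βᴴ) 0 0 0 * bordered (lead x) 0 0 0 := by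
    have := hcomm X
    simp only [aeval_X] at this
    conv_lhs => rw [h.eq]
    rw [bordered_mul, bordered_mul, hrow, this]
    simp
  -- The unspecified corner `e` is harmless: it meets the zero corner of the projection onto the
  -- complement.
  obtain ⟨e, he⟩ := exists_aeval_bordered_zero (lead x) p
  rw [h0, aeval_mul_of_intertwine hint p, he, bordered_mul, hcomm p]
  simp

/-- On the complement of the frame `p(x)` already agrees with `p` of the leading block; on the frame
`T` replaces it by the new arrow matrix, whose diagonal block is again `p` of the old one.
Altogether the leading block becomes `p` of the leading block, bordered with the new lengths `s'`.
-/
theorem IsStep.frameMap_conj_eq (h : IsStep ν c s d x) (hc : Function.Injective c)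
    (hs : ∀ i, 0 < s i) {p : ℝ[X]} {c' s' : Fin m → ℝ} {d' : ℝ} (hp : ∀ i, p.eval (c i) = c' i)
    {T : Matrix (Fin (m + 1)) (Fin (m + 1)) ℂ}
    (hT : T * aeval (arrowMatrix c s d) p * Tᴴ = arrowMatrix c' s' d') :
    frameMap (stepFrame ν c s x) T * aeval x p * (frameMap (stepFrame ν c s x) T)ᴴ =
      bordered (aeval (lead x) p) (stepBlock ν c s x *ᵥ fun i => (s' i : ℂ))
        (star (stepBlock ν c s x *ᵥ fun i => (s' i : ℂ))) (d' : ℂ) := by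
  have hx : x.IsHermitian := by
    rw [h.eq]; exact isHermitian_bordered h.spec.1 _ _
  rw [frameMap_conj (h.stepFrame_orthonormal hc hs) hx (h.mul_stepFrame hc hs), hT,
    h.aeval_mul_complement hc hs, arrowMatrix, stepFrame_eq, bordered_conjTranspose, bordered_mul,
    bordered_mul, bordered_add]
  have h1 := h.aeval_mul_stepBlock p
  simp only [hp] at h1
  congr 1
  · simp only [Matrix.vecMulVec_zero, Matrix.zero_vecMulVec, star_zero, add_zero, ← h1]
    rw [Matrix.mul_assoc, ← Matrix.mul_add, sub_add_cancel, Matrix.mul_one]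
  · simp
  · rw [Matrix.star_mulVec]
    have : star (fun i => (s' i : ℂ)) = fun i => (s' i : ℂ) := by ext i; simp
    rw [this]; simp
  · simp

end

end Deformation

/-! ### Assembling the unitary corrections along the tower -/

section DeformationTower

open Polynomial

variable {k m : ℕ}

section

variable {ν ν' : Fin k → ℝ} {c s c' s' : Fin m → ℝ} {d d' : ℝ}
  {x : Matrix (Fin (k + 1)) (Fin (k + 1)) ℂ}

theorem HasSpectrum.specProj_aeval {y : Matrix (Fin k) (Fin k) ℂ} (h : HasSpectrum y ν) {p : ℝ[X]}
    (hp : ∀ j, p.eval (ν j) = ν' j) {c c' : ℝ} (hc : ∀ j, ν' j = c' ↔ ν j = c) :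
    specProj ν' c' (Polynomial.aeval y p) = specProj ν c y := by
  rw [specProj, ← aeval_comp, specProj]
  refine h.aeval_congr fun j => ?_
  rw [eval_comp, hp, eval_projPoly, eval_projPoly]
  simp only [hc]

/-- The deformation keeps the eigenspaces of the leading block and only rescales the components of
the last column by positive factors. The normalised frame is thus unchanged, which is why the
inverse deformation is built from the same frame and `Tᴴ`. -/
theorem IsStep.transform (h : IsStep ν c s d x) (hc : Function.Injective c) (hs : ∀ i, 0 < s i)
    (hs' : ∀ i, 0 < s' i) {p : ℝ[X]} (hpν : ∀ j, p.eval (ν j) = ν' j) (hp : ∀ i, p.eval (c i) = c' i)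
    (hinj : ∀ i j, ν' j = c' i ↔ ν j = c i) {T : Matrix (Fin (m + 1)) (Fin (m + 1)) ℂ}
    (hT : T * aeval (arrowMatrix c s d) p * Tᴴ = arrowMatrix c' s' d') :
    lead (frameMap (stepFrame ν c s x) T * aeval x p * (frameMap (stepFrame ν c s x) T)ᴴ) =
        aeval (lead x) p ∧
      stepFrame ν' c' s'
        (frameMap (stepFrame ν c s x) T * aeval x p * (frameMap (stepFrame ν c s x) T)ᴴ) =
        stepFrame ν c s x := by
  rw [h.frameMap_conj_eq hc hs hp hT]
  refine ⟨lead_bordered _ _ _ _, ?_⟩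
  rw [stepFrame_eq, stepFrame_eq]
  congr 1
  ext j i
  rw [stepBlock, Matrix.of_apply, lead_bordered, lastCol_bordered, h.spec.specProj_aeval hpν (hinj i),
    Matrix.mulVec_mulVec, h.specProj_mul_stepBlock hc i]
  have : ((Matrix.of fun j i' => if i' = i then stepBlock ν c s x j i' else 0) *ᵥ
      fun i => (s' i : ℂ)) j = stepBlock ν c s x j i * s' i := by
    simp [Matrix.mulVec, dotProduct]
  rw [Pi.smul_apply, this, Complex.real_smul]
  have h1 : (s' i : ℂ) ≠ 0 := by exact_mod_cast (hs' i).ne'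
  push_cast
  field_simp

end

/-- The eigenvalues `c` at which the leading block has one eigenvalue too many. -/
theorem Interlacing.exists_enumeration {ν : Fin k → ℝ} {μ : Fin (k + 1) → ℝ} :
    ∃ (m : ℕ) (c : Fin m → ℝ), Function.Injective c ∧ (∀ i, mult μ (c i) < mult ν (c i)) ∧
      ∀ c₀, mult μ c₀ < mult ν c₀ → ∃ i, c i = c₀ := by
  have hfin : {c₀ | mult μ c₀ < mult ν c₀}.Finite := by
    refine (Finset.univ.image ν).finite_toSet.subset fun c₀ hc₀ => ?_
    have h : 0 < mult ν c₀ := Nat.zero_lt_of_lt hc₀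
    simpa using Multiset.count_pos.1 h
  let e := hfin.toFinset.equivFin.symm
  refine ⟨_, fun i => (e i : ℝ), fun i j h => e.injective (Subtype.ext h), fun i => ?_, fun c₀ h => ?_⟩
  · exact (hfin.mem_toFinset.1 (e i).2 :)
  · exact ⟨e.symm ⟨c₀, hfin.mem_toFinset.2 h⟩, by simp⟩

theorem mem_image_of_mult_pos {ν : Fin k → ℝ} {c : ℝ} (h : 0 < mult ν c) :
    c ∈ Finset.univ.image ν := by
  simpa using Multiset.count_pos.1 h

theorem isStep_of_hasSpectrum {ν : Fin k → ℝ} {μ : Fin (k + 1) → ℝ} {d : ℝ} {R : ℝ → ℝ}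
    (hR : IsWeight ν μ d R) (hpos : ∀ c, mult μ c < mult ν c → 0 < R c)
    (h0 : ∀ c, ¬ mult μ c < mult ν c → R c = 0) {c : Fin m → ℝ} (hc : Function.Injective c)
    (hlt : ∀ i, mult μ (c i) < mult ν (c i)) (hex : ∀ c₀, mult μ c₀ < mult ν c₀ → ∃ i, c i = c₀)
    {x : Matrix (Fin (k + 1)) (Fin (k + 1)) ℂ} (hx : HasSpectrum x μ) (hy : HasSpectrum (lead x) ν) :
    IsStep ν c (fun i => √(R (c i))) d x := by
  obtain ⟨h1, h2⟩ := (hy.iff_of_lead hx.1 hR).1 hx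
  have hmem : ∀ i, c i ∈ Finset.univ.image ν := fun i =>
    mem_image_of_mult_pos (Nat.zero_lt_of_lt (hlt i))
  refine ⟨hy, h1, fun i => ?_, ?_⟩
  · rw [h2 _ (hmem i), Real.sq_sqrt (hpos _ (hlt i)).le]
  · conv_rhs => rw [← Matrix.one_mulVec (lastCol x), ← hy.sum_specProj, Matrix.sum_mulVec]
    rw [← Finset.sum_image (s := Finset.univ) (g := c)
      (f := fun c₀ => specProj ν c₀ (lead x) *ᵥ lastCol x) hc.injOn]
    refine Finset.sum_subset (fun c₀ hc₀ => ?_) fun c₀ hc₀ hn => ?_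
    · obtain ⟨i, -, rfl⟩ := Finset.mem_image.1 hc₀
      exact hmem i
    · rw [← normSqVec_eq_zero, h2 c₀ hc₀]
      refine h0 c₀ fun h => hn ?_
      obtain ⟨i, rfl⟩ := hex c₀ h
      exact Finset.mem_image_of_mem c (Finset.mem_univ i)

theorem arrowMatrix_eq (c s : Fin m → ℝ) (d : ℝ) :
    arrowMatrix c s d = bordered (Matrix.diagonal fun i => (c i : ℂ)) (fun i => (s i : ℂ))
      (star fun i => (s i : ℂ)) d := by
  rw [arrowMatrix]; congr 1; ext i; simp

theorem isHermitian_arrowMatrix (c s : Fin m → ℝ) (d : ℝ) : (arrowMatrix c s d).IsHermitian := by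
  rw [arrowMatrix_eq]
  exact isHermitian_bordered (hasSpectrum_diagonal c).1 _ _

theorem Matrix.IsHermitian.hasSpectrum {A : Matrix (Fin m) (Fin m) ℂ} (hA : A.IsHermitian) :
    HasSpectrum A hA.eigenvalues :=
  ⟨hA, hA.charpoly_eq⟩

/-- The eigenvalues of the arrow matrix are those of the bordered matrix that are not accounted for
by the leading block. -/
theorem arrowMatrix_spectrum {ν : Fin k → ℝ} {μ : Fin (k + 1) → ℝ} {d : ℝ} {R : ℝ → ℝ}
    (hR : IsWeight ν μ d R) (hpos : ∀ c, mult μ c < mult ν c → 0 < R c)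
    (h0 : ∀ c, ¬ mult μ c < mult ν c → R c = 0) {c : Fin m → ℝ} (hc : Function.Injective c)
    (hlt : ∀ i, mult μ (c i) < mult ν (c i)) (hex : ∀ c₀, mult μ c₀ < mult ν c₀ → ∃ i, c i = c₀)
    {α : Fin (m + 1) → ℝ} (hα : HasSpectrum (arrowMatrix c (fun i => √(R (c i))) d) α) :
    Finset.univ.val.map μ + Finset.univ.val.map c = Finset.univ.val.map ν + Finset.univ.val.map α := by
  have hmem : ∀ i, c i ∈ Finset.univ.image ν := fun i =>
    mem_image_of_mult_pos (Nat.zero_lt_of_lt (hlt i))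
  have hev : ∀ t ∉ Finset.univ.image ν, (∏ i, (t - μ i)) * ∏ i, (t - c i) =
      (∏ i, (t - ν i)) * ∏ i, (t - α i) := by
    intro t ht
    have htc : t ∉ Finset.univ.image c := fun h => by
      obtain ⟨i, -, rfl⟩ := Finset.mem_image.1 h
      exact ht (hmem i)
    have h1 := (hasSpectrum_diagonal c).eval_charpoly_bordered (fun i => ((√(R (c i)) : ℝ) : ℂ)) d t htc
    rw [← arrowMatrix_eq, hα.2, eval_prod] at h1
    simp only [eval_sub, eval_X, eval_C] at h1
    -- The arrow matrix has the same rational factor `t - d - ∑ R c / (t - c)` as the bordered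
    -- matrix, since `R` vanishes away from the values of `c`.
    have h2 : ∏ i, (t - α i) = (∏ i, (t - c i)) * (t - d - ∑ c₀ ∈ Finset.univ.image ν, R c₀ / (t - c₀)) := by
      have h3 : ∑ c₀ ∈ Finset.univ.image c, normSqVec (specProj c c₀
          (Matrix.diagonal fun i => (c i : ℂ)) *ᵥ fun i => ((√(R (c i)) : ℝ) : ℂ)) / (t - c₀) =
          ∑ c₀ ∈ Finset.univ.image ν, R c₀ / (t - c₀) := by
        have h4 : Finset.univ.image c ⊆ Finset.univ.image ν := fun c₀ hc₀ => by
          obtain ⟨i, -, rfl⟩ := Finset.mem_image.1 hc₀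
          exact hmem i
        rw [← Finset.sum_subset h4]
        · refine Finset.sum_congr rfl fun c₀ hc₀ => ?_
          obtain ⟨i, -, rfl⟩ := Finset.mem_image.1 hc₀
          congr 1
          rw [specProj_diagonal, normSqVec, Finset.sum_eq_single i]
          · rw [Matrix.mulVec_diagonal, if_pos rfl, one_mul, Complex.normSq_ofReal,
              Real.mul_self_sqrt (hpos _ (hlt i)).le]
          · intro j _ hj
            rw [Matrix.mulVec_diagonal, if_neg fun e => hj (hc e), zero_mul, map_zero]
          · exact fun h => absurd (Finset.mem_univ i) h
        · intro c₀ _ hn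
          rw [h0 c₀ fun h => hn ?_, zero_div]
          obtain ⟨i, rfl⟩ := hex c₀ h
          exact Finset.mem_image_of_mem c (Finset.mem_univ i)
      rw [h3] at h1
      exact_mod_cast h1
    rw [hR t ht, h2]
    ring
  have hpol : (Multiset.map (fun a => X - C a)
        (Finset.univ.val.map μ + Finset.univ.val.map c)).prod =
      (Multiset.map (fun a => (X - C a : ℝ[X])) (Finset.univ.val.map ν + Finset.univ.val.map α)).prod := by
    refine eq_of_infinite_eval_eq _ _ (((Finset.univ.image ν).finite_toSet.infinite_compl).mono ?_)
    intro t ht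
    have := hev t ht
    simp only [Multiset.map_add, Multiset.prod_add, Multiset.map_map, mem_ofPred_eq, eval_mul]
    simp only [Finset.prod_map_val, Function.comp, eval_prod, eval_sub, eval_X, eval_C]
    exact this
  have := congrArg Polynomial.roots hpol
  rwa [roots_multiset_prod_X_sub_C, roots_multiset_prod_X_sub_C] at this

theorem mult_eq_of_eval {k : ℕ} {ν ν' : Fin k → ℝ} {p p' : ℝ[X]} (hp : ∀ i, p.eval (ν i) = ν' i)
    (hp' : ∀ i, p'.eval (ν' i) = ν i) {c : ℝ} (hc : p'.eval (p.eval c) = c) :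
    mult ν' (p.eval c) = mult ν c := by
  rw [mult_eq_card, mult_eq_card]
  congr 1
  ext i
  simp only [Finset.mem_filter, Finset.mem_univ, true_and]
  rw [← hp i]
  exact ⟨fun h => by rw [← hp' i, ← hp i, h, hc], fun h => by rw [h]⟩

/-- The spectrum of an arrow matrix is determined as a multiset by `ν`, `μ` and the enumeration `c`.
Since `p` carries all of these to their primed versions, `p` of the first arrow matrix and the
second arrow matrix are isospectral Hermitian matrices, hence unitarily conjugate. -/
theorem exists_arrow_transform {ν ν' : Fin k → ℝ} {μ μ' : Fin (k + 1) → ℝ} (hint : Interlacing ν μ)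
    (hint' : Interlacing ν' μ') {p p' : ℝ[X]} (hpν : ∀ i, p.eval (ν i) = ν' i)
    (hpμ : ∀ i, p.eval (μ i) = μ' i) (hpν' : ∀ i, p'.eval (ν' i) = ν i)
    (hpμ' : ∀ i, p'.eval (μ' i) = μ i) :
    ∃ (m : ℕ) (c s c' s' : Fin m → ℝ) (d d' : ℝ) (T : Matrix (Fin (m + 1)) (Fin (m + 1)) ℂ),
      Function.Injective c ∧ Function.Injective c' ∧ (∀ i, 0 < s i) ∧ (∀ i, 0 < s' i) ∧
      (∀ i, p.eval (c i) = c' i) ∧ (∀ i, p'.eval (c' i) = c i) ∧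
      T ∈ Matrix.unitaryGroup (Fin (m + 1)) ℂ ∧
      T * aeval (arrowMatrix c s d) p * Tᴴ = arrowMatrix c' s' d' ∧
      Tᴴ * aeval (arrowMatrix c' s' d') p' * T = arrowMatrix c s d ∧
      (∀ x, HasSpectrum x μ → HasSpectrum (lead x) ν → IsStep ν c s d x) ∧
      (∀ x, HasSpectrum x μ' → HasSpectrum (lead x) ν' → IsStep ν' c' s' d' x) := by
  obtain ⟨d, R, hpos, h0, hR⟩ := hint.exists_weights
  have hR : IsWeight ν μ d R := hR
  obtain ⟨d', R', hpos', h0', hR'⟩ := hint'.exists_weights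
  have hR' : IsWeight ν' μ' d' R' := hR'
  obtain ⟨m, c, hc, hlt, hex⟩ := Interlacing.exists_enumeration (ν := ν) (μ := μ)
  have hcν : ∀ i, ∃ j, ν j = c i := fun i => by
    simpa using mem_image_of_mult_pos (Nat.zero_lt_of_lt (hlt i))
  have hpc : ∀ i, p'.eval (p.eval (c i)) = c i := fun i => by
    obtain ⟨j, hj⟩ := hcν i
    rw [← hj, hpν, hpν']
  have hc' : Function.Injective fun i => p.eval (c i) := fun i j h => hc (by
    have h : p.eval (c i) = p.eval (c j) := h
    rw [← hpc i, h, hpc j])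
  have hlt' : ∀ i, mult μ' (p.eval (c i)) < mult ν' (p.eval (c i)) := fun i => by
    rw [mult_eq_of_eval hpμ hpμ' (hpc i), mult_eq_of_eval hpν hpν' (hpc i)]
    exact hlt i
  have hex' : ∀ c₀, mult μ' c₀ < mult ν' c₀ → ∃ i, p.eval (c i) = c₀ := by
    intro c₀ hc₀
    obtain ⟨j, hj⟩ : ∃ j, ν' j = c₀ := by
      simpa using mem_image_of_mult_pos (Nat.zero_lt_of_lt hc₀)
    have h1 : p'.eval (p.eval (ν j)) = ν j := by rw [hpν, hpν']
    rw [← hj, ← hpν, mult_eq_of_eval hpμ hpμ' h1, mult_eq_of_eval hpν hpν' h1] at hc₀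
    obtain ⟨i, hi⟩ := hex _ hc₀
    exact ⟨i, by rw [hi, hpν, hj]⟩
  set A := arrowMatrix c (fun i => √(R (c i))) d with hA
  set A' := arrowMatrix (fun i => p.eval (c i)) (fun i => √(R' (p.eval (c i)))) d' with hA'
  have hα := (isHermitian_arrowMatrix c (fun i => √(R (c i))) d).hasSpectrum
  set α := (isHermitian_arrowMatrix c (fun i => √(R (c i))) d).eigenvalues
  have hα' := (isHermitian_arrowMatrix (fun i => p.eval (c i))
    (fun i => √(R' (p.eval (c i)))) d').hasSpectrum
  set α' := (isHermitian_arrowMatrix (fun i => p.eval (c i))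
    (fun i => √(R' (p.eval (c i)))) d').eigenvalues
  have hms := arrowMatrix_spectrum hR hpos h0 hc hlt hex hα
  have hms' := arrowMatrix_spectrum hR' hpos' h0' hc' hlt' hex' hα'
  have hmul : Finset.univ.val.map (fun i => p.eval (α i)) = Finset.univ.val.map α' := by
    have h1 := congrArg (Multiset.map fun t => p.eval t) hms
    simp only [Multiset.map_add, Multiset.map_map, Function.comp_def, hpν, hpμ] at h1
    rw [hms'] at h1
    exact (add_left_cancel h1).symm
  -- Every eigenvalue of the arrow matrix already occurs in `μ` or in `c`, where `p'` is known to
  -- invert `p`.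
  have hpα : ∀ i, p'.eval (p.eval (α i)) = α i := by
    intro i
    have h1 : α i ∈ Finset.univ.val.map μ + Finset.univ.val.map c := by
      rw [hms]
      exact Multiset.mem_add.2 (Or.inr (Multiset.mem_map_of_mem α (Finset.mem_univ i)))
    rcases Multiset.mem_add.1 h1 with h2 | h2
    · obtain ⟨j, -, hj⟩ := Multiset.mem_map.1 h2
      rw [← hj, hpμ, hpμ']
    · obtain ⟨j, -, hj⟩ := Multiset.mem_map.1 h2
      rw [← hj, hpc]
  have hcp : A'.charpoly = (aeval A p).charpoly := by
    rw [hα'.2, (hα.aeval p).2]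
    have h1 := congrArg (fun M : Multiset ℝ => (M.map fun a : ℝ => (X - C (a : ℂ) : ℂ[X])).prod) hmul
    simp only [Multiset.map_map, Finset.prod_map_val, Function.comp_def] at h1
    exact h1.symm
  obtain ⟨T, hT, hTA⟩ := hα'.1.exists_conj_of_charpoly_eq (hα.aeval p).1 hcp
  refine ⟨m, c, fun i => √(R (c i)), fun i => p.eval (c i), fun i => √(R' (p.eval (c i))), d, d', T,
    hc, hc', fun i => Real.sqrt_pos.2 (hpos _ (hlt i)), fun i => Real.sqrt_pos.2 (hpos' _ (hlt' i)),
    fun _ => rfl, hpc, hT, hTA.symm, ?_,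
    fun x hx hy => isStep_of_hasSpectrum hR hpos h0 hc hlt hex hx hy,
    fun x hx hy => isStep_of_hasSpectrum hR' hpos' h0' hc' hlt' hex' hx hy⟩
  have h1 : aeval (aeval A p) p' = A := by
    rw [← aeval_comp]
    conv_rhs => rw [← aeval_X (R := ℝ) A]
    refine hα.aeval_congr fun i => ?_
    rw [eval_comp, hpα, eval_X]
  change Tᴴ * aeval A' p' * T = A
  have hTA' : A' = T * aeval A p * Tᴴ := hTA
  rw [hTA', aeval_conj_unitary hT, h1, ← Matrix.mul_assoc, ← Matrix.mul_assoc,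
    conjTranspose_mul_of_mem hT, Matrix.one_mul, Matrix.mul_assoc, conjTranspose_mul_of_mem hT,
    Matrix.mul_one]

theorem contDiffOn_frameMap_stepFrame (ν : Fin k → ℝ) (c s : Fin m → ℝ)
    (T : Matrix (Fin (m + 1)) (Fin (m + 1)) ℂ) (S : Set (Matrix (Fin (k + 1)) (Fin (k + 1)) ℂ)) :
    ContDiffOn ℝ ∞ (fun x => frameMap (stepFrame ν c s x) T) S := by
  have h : ContDiffOn ℝ ∞ (fun x => stepFrame ν c s x) S := by
    refine ContDiffOn.bordered (contDiffOn_matrix.2 fun j i => ?_) contDiffOn_const contDiffOn_const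
      contDiffOn_const
    have h1 : ContDiffOn ℝ ∞ (fun x => specProj ν (c i) (lead x) *ᵥ lastCol x) S :=
      (contDiffOn_id.lead.matrix_aeval _).matrix_mulVec contDiffOn_id.lastCol
    exact (contDiffOn_pi.1 h1 j).const_smul (s i)⁻¹
  exact contDiffOn_const.add ((h.matrix_mul contDiffOn_const).matrix_mul h.matrix_conjTranspose)

/-- `g` is a smooth family of unitary matrices such that `x ↦ g(x) q(x) g(x)ᴴ` maps the tower of `a`
to that of `a'`, where `q` is a polynomial that maps the eigenvalues of `x` to those required; its
inverse is given by `g'` in the same way. -/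
def Intertwines (a a' : ℕ → ℕ → ℝ) (k : ℕ)
    (g g' : Matrix (Fin k) (Fin k) ℂ → Matrix (Fin k) (Fin k) ℂ) : Prop :=
  ContDiffOn ℝ ∞ g (gcTower a k) ∧ ∀ x ∈ gcTower a k, g x ∈ Matrix.unitaryGroup (Fin k) ℂ ∧
    ∀ q : ℝ[X], (∀ i : Fin k, q.eval (a k i) = a' k i) →
      g x * aeval x q * (g x)ᴴ ∈ gcTower a' k ∧ g' (g x * aeval x q * (g x)ᴴ) = (g x)ᴴ

/-- First `T` acts on the frame, making the leading block `p` of the old one; then the unitary for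
the leading block moves this block into the new tower. The definition allows every admissible
polynomial `q` because the one used for a block at the next level need not be the one used for it
before. -/
theorem Intertwines.step {a a' : ℕ → ℕ → ℝ} {g g' : Matrix (Fin k) (Fin k) ℂ → Matrix (Fin k) (Fin k) ℂ}
    (hg : Intertwines a a' k g g') {c s c' s' : Fin m → ℝ} {d d' : ℝ}
    {T : Matrix (Fin (m + 1)) (Fin (m + 1)) ℂ} {p : ℝ[X]}
    (hpν : ∀ i : Fin k, p.eval (a k i) = a' k i)
    (hpμ : ∀ i : Fin (k + 1), p.eval (a (k + 1) i) = a' (k + 1) i)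
    (hinj : ∀ (i : Fin m) (j : Fin k), a' k j = c' i ↔ a k j = c i)
    (hc : Function.Injective c) (hs : ∀ i, 0 < s i) (hs' : ∀ i, 0 < s' i)
    (hp : ∀ i, p.eval (c i) = c' i) (hTu : T ∈ Matrix.unitaryGroup (Fin (m + 1)) ℂ)
    (hT : T * aeval (arrowMatrix c s d) p * Tᴴ = arrowMatrix c' s' d')
    (hstep : ∀ x, HasSpectrum x (fun i : Fin (k + 1) => a (k + 1) i) →
      HasSpectrum (lead x) (fun i : Fin k => a k i) → IsStep (fun i : Fin k => a k i) c s d x) :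
    Intertwines a a' (k + 1)
      (fun x => bordered (g (lead x)) 0 0 1 * frameMap (stepFrame (fun i : Fin k => a k i) c s x) T)
      (fun x => bordered (g' (lead x)) 0 0 1 *
        frameMap (stepFrame (fun i : Fin k => a' k i) c' s' x) Tᴴ) := by
  constructor
  · refine ContDiffOn.matrix_mul ?_ (contDiffOn_frameMap_stepFrame _ c s T _)
    exact (hg.1.comp contDiffOn_id.lead fun x hx => hx.2).bordered contDiffOn_const contDiffOn_const
      contDiffOn_const
  · rintro x ⟨hx, hxl⟩
    obtain ⟨hgu, hgq⟩ := hg.2 _ hxl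
    obtain ⟨hgt, hgi⟩ := hgq p hpν
    have hst := hstep x hx (hasSpectrum_of_mem_gcTower hxl)
    set h := frameMap (stepFrame (fun i : Fin k => a k i) c s x) T with hh
    have hhu : h ∈ Matrix.unitaryGroup (Fin (k + 1)) ℂ :=
      frameMap_mem (hst.stepFrame_orthonormal hc hs) hTu
    have hGu := bordered_unitary hgu
    refine ⟨mul_mem hGu hhu, fun q hq => ?_⟩
    -- `q` is only known on the top row; by equality of values there it may be exchanged for `p`,
    -- which also controls the row below.
    have hqp : aeval x q = aeval x p := hx.aeval_congr fun i => by rw [hq, hpμ]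
    obtain ⟨htr1, htr2⟩ := hst.transform (ν' := fun i : Fin k => a' k i) hc hs hs' hpν hp hinj hT
    rw [← hh] at htr1 htr2
    have hF : bordered (g (lead x)) 0 0 1 * h * aeval x q * (bordered (g (lead x)) 0 0 1 * h)ᴴ =
        bordered (g (lead x)) 0 0 1 * (h * aeval x p * hᴴ) * (bordered (g (lead x)) 0 0 1)ᴴ := by
      rw [hqp, Matrix.conjTranspose_mul]
      simp only [Matrix.mul_assoc]
    have hlead : lead (bordered (g (lead x)) 0 0 1 * (h * aeval x p * hᴴ) *
        (bordered (g (lead x)) 0 0 1)ᴴ) = g (lead x) * aeval (lead x) p * (g (lead x))ᴴ := by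
      rw [lead_bordered_conj, htr1]
    dsimp only
    rw [hF]
    refine ⟨⟨?_, ?_⟩, ?_⟩
    · have := ((hx.aeval p).conj hhu).conj hGu
      simpa only [hpμ] using this
    · rw [hlead]; exact hgt
    -- At the image point the frame is the old frame rotated by `g`. The inverse correction is
    -- therefore `hᴴ` conjugated by `g`, and the product collapses to the adjoint of the total
    -- unitary.
    · rw [hlead, hgi, frameMap_stepFrame_conj _ _ _ _ hgu, htr2, ← frameMap_conjTranspose, ← hh,
        Matrix.conjTranspose_mul, ← Matrix.mul_assoc, ← Matrix.mul_assoc]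
      have : bordered (g (lead x))ᴴ 0 0 1 * bordered (g (lead x)) 0 0 1 = 1 := by
        rw [bordered_mul, conjTranspose_mul_of_mem hgu, ← bordered_one]
        simp
      rw [this, Matrix.one_mul]

theorem exists_intertwines {a a' : ℕ → ℕ → ℝ} {n : ℕ}
    (hint : ∀ m < n, Interlacing (fun i : Fin m => a m i) fun i : Fin (m + 1) => a (m + 1) i)
    (hint' : ∀ m < n, Interlacing (fun i : Fin m => a' m i) fun i : Fin (m + 1) => a' (m + 1) i)
    (hp : ∀ m < n, ∃ p p' : ℝ[X], (∀ i : Fin m, p.eval (a m i) = a' m i) ∧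
      (∀ i : Fin (m + 1), p.eval (a (m + 1) i) = a' (m + 1) i) ∧
      (∀ i : Fin m, p'.eval (a' m i) = a m i) ∧
      (∀ i : Fin (m + 1), p'.eval (a' (m + 1) i) = a (m + 1) i)) :
    ∀ k ≤ n, ∃ g g', Intertwines a a' k g g' ∧ Intertwines a' a k g' g := by
  intro k
  induction k with
  | zero =>
    intro _
    refine ⟨fun _ => 1, fun _ => 1, ⟨contDiffOn_const, fun x _ => ⟨one_mem _, fun q _ => ⟨trivial, ?_⟩⟩⟩,
      ⟨contDiffOn_const, fun x _ => ⟨one_mem _, fun q _ => ⟨trivial, ?_⟩⟩⟩⟩ <;> simp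
  | succ k ih =>
    intro hk
    obtain ⟨g, g', hg, hg'⟩ := ih (Nat.le_of_succ_le hk)
    obtain ⟨p, p', hpν, hpμ, hpν', hpμ'⟩ := hp k hk
    obtain ⟨m, c, s, c', s', d, d', T, hc, hc', hs, hs', hpc, hpc', hTu, hT, hT', hst, hst'⟩ :=
      exists_arrow_transform (hint k hk) (hint' k hk) hpν hpμ hpν' hpμ'
    have hinj : ∀ (i : Fin m) (j : Fin k), a' k j = c' i ↔ a k j = c i := fun i j =>
      ⟨fun e => by rw [← hpν', e, hpc'], fun e => by rw [← hpν, e, hpc]⟩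
    refine ⟨_, _, hg.step hpν hpμ hinj hc hs hs' hpc hTu hT hst, ?_⟩
    have h1 := hg'.step (T := Tᴴ) (d := d') (d' := d) hpν' hpμ' (fun i j => (hinj i j).symm) hc' hs' hs hpc'
      (conjTranspose_mem hTu) (by rw [Matrix.conjTranspose_conjTranspose]; exact hT') hst'
    rwa [Matrix.conjTranspose_conjTranspose] at h1

/-- The map is `x ↦ g(x) q(x) g(x)ᴴ`. Applying `q'` inverts `q` on the spectrum, and `g'` at the
image point is the adjoint of `g` at `x`, so the reverse map has the same form. -/
theorem diffeomorphic_gcTower {a a' : ℕ → ℕ → ℝ} {n : ℕ}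
    (hint : ∀ m < n, Interlacing (fun i : Fin m => a m i) fun i : Fin (m + 1) => a (m + 1) i)
    (hint' : ∀ m < n, Interlacing (fun i : Fin m => a' m i) fun i : Fin (m + 1) => a' (m + 1) i)
    (hp : ∀ m < n, ∃ p p' : ℝ[X], (∀ i : Fin m, p.eval (a m i) = a' m i) ∧
      (∀ i : Fin (m + 1), p.eval (a (m + 1) i) = a' (m + 1) i) ∧
      (∀ i : Fin m, p'.eval (a' m i) = a m i) ∧
      (∀ i : Fin (m + 1), p'.eval (a' (m + 1) i) = a (m + 1) i))
    (hq : ∃ q q' : ℝ[X], (∀ i : Fin n, q.eval (a n i) = a' n i) ∧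
      ∀ i : Fin n, q'.eval (a' n i) = a n i) :
    Diffeomorphic (gcTower a n) (gcTower a' n) := by
  obtain ⟨g, g', hg, hg'⟩ := exists_intertwines hint hint' hp n le_rfl
  obtain ⟨q, q', hq, hq'⟩ := hq
  have inv : ∀ {a a' : ℕ → ℕ → ℝ} {g g' : Matrix (Fin n) (Fin n) ℂ → Matrix (Fin n) (Fin n) ℂ}
      {q q' : ℝ[X]}, Intertwines a a' n g g' → (∀ i : Fin n, q.eval (a n i) = a' n i) →
      (∀ i : Fin n, q'.eval (a' n i) = a n i) → ∀ x ∈ gcTower a n,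
      g' (g x * aeval x q * (g x)ᴴ) * aeval (g x * aeval x q * (g x)ᴴ) q' *
        (g' (g x * aeval x q * (g x)ᴴ))ᴴ = x := by
    intro a a' g g' q q' hg hq hq' x hx
    obtain ⟨hu, h1⟩ := hg.2 x hx
    have h2 : aeval (aeval x q) q' = x := by
      rw [← aeval_comp]
      conv_rhs => rw [← aeval_X (R := ℝ) x]
      refine (hasSpectrum_of_mem_gcTower hx).aeval_congr fun i => ?_
      rw [eval_comp, hq, hq', eval_X]
    rw [(h1 q hq).2, aeval_conj_unitary hu, h2, Matrix.conjTranspose_conjTranspose,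
      ← Matrix.mul_assoc, ← Matrix.mul_assoc, conjTranspose_mul_of_mem hu, Matrix.one_mul,
      Matrix.mul_assoc, conjTranspose_mul_of_mem hu, Matrix.mul_one]
  refine ⟨fun x => g x * aeval x q * (g x)ᴴ, fun x => g' x * aeval x q' * (g' x)ᴴ, ?_, ?_, ?_, ?_, ?_, ?_⟩
  · exact (hg.1.matrix_mul (contDiffOn_id.matrix_aeval q)).matrix_mul hg.1.matrix_conjTranspose
  · exact (hg'.1.matrix_mul (contDiffOn_id.matrix_aeval q')).matrix_mul hg'.1.matrix_conjTranspose
  · exact fun x hx => ((hg.2 x hx).2 q hq).1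
  · exact fun x hx => ((hg'.2 x hx).2 q' hq').1
  · exact fun x hx => inv hg hq hq' x hx
  · exact fun x hx => inv hg' hq' hq x hx

end DeformationTower

/-! ### Relative interiors -/

section RelativeInterior

variable {V : Type*} [AddCommGroup V] [Module ℝ V] [TopologicalSpace V] {C : Set V} {u w : V}

/-- A point of the relative interior can be pushed away from any other point of the set. -/
theorem exists_add_smul_sub_mem [IsTopologicalAddGroup V] [ContinuousSMul ℝ V]
    (hu : u ∈ intrinsicInterior ℝ C) (hw : w ∈ C) :
    ∃ ε : ℝ, 0 < ε ∧ u + ε • (u - w) ∈ C := by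
  obtain ⟨y, hy, rfl⟩ := mem_intrinsicInterior.1 hu
  -- The parameter `-t` runs along the line away from `w`, within the affine span, so a small
  -- positive time stays in `C`.
  let g : ℝ → affineSpan ℝ C := fun t =>
    ⟨AffineMap.lineMap (y : V) w (-t), AffineMap.lineMap_mem _ y.2 (subset_affineSpan ℝ C hw)⟩
  have hg : Continuous g := by
    refine Continuous.subtype_mk ?_ _
    exact AffineMap.lineMap_continuous.comp continuous_neg
  have hg0 : g 0 = y := Subtype.ext (by simp [g])
  have h1 : ∀ᶠ t in 𝓝 (0 : ℝ), g t ∈ interior ((↑) ⁻¹' C : Set (affineSpan ℝ C)) :=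
    hg.continuousAt.eventually_mem (isOpen_interior.mem_nhds (by rw [hg0]; exact hy))
  obtain ⟨ε, hε, hpos⟩ := ((h1.filter_mono nhdsWithin_le_nhds).and
    (self_mem_nhdsWithin : Ioi (0 : ℝ) ∈ 𝓝[>] 0)).exists
  refine ⟨ε, hpos, ?_⟩
  have h2 : g ε ∈ ((↑) ⁻¹' C : Set (affineSpan ℝ C)) := interior_subset hε
  have h2 : (g ε : V) ∈ C := h2
  convert h2 using 1
  simp only [g, AffineMap.lineMap_apply_module']
  module

/-- If `ℓ` were positive at some `w`, it would be negative at a point of `C` slightly beyond `u` on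
the line from `w`. -/
theorem eq_zero_of_mem_intrinsicInterior [IsTopologicalAddGroup V] [ContinuousSMul ℝ V]
    (ℓ : V →ₗ[ℝ] ℝ) (hℓ : ∀ v ∈ C, 0 ≤ ℓ v)
    (hu : u ∈ intrinsicInterior ℝ C) (h0 : ℓ u = 0) (hw : w ∈ C) : ℓ w = 0 := by
  obtain ⟨ε, hε, h⟩ := exists_add_smul_sub_mem hu hw
  have h1 := hℓ _ h
  simp only [map_add, map_smul, map_sub, h0, smul_eq_mul] at h1
  have h2 := hℓ w hw
  nlinarith

theorem mem_intrinsicInterior_of_nhds {U : Set V} (hu : u ∈ C) (hU : U ∈ 𝓝 u)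
    (h : ∀ v ∈ affineSpan ℝ C, v ∈ U → v ∈ C) : u ∈ intrinsicInterior ℝ C := by
  refine mem_intrinsicInterior.2 ⟨⟨u, subset_affineSpan ℝ C hu⟩, ?_, rfl⟩
  rw [mem_interior_iff_mem_nhds]
  exact mem_of_superset (continuous_subtype_val.continuousAt.preimage_mem_nhds hU)
    fun v hv => h v v.2 hv

end RelativeInterior

theorem eq_of_mem_affineSpan {V : Type*} [AddCommGroup V] [Module ℝ V] {C : Set V} (ℓ : V →ₗ[ℝ] ℝ) (b : ℝ) (hℓ : ∀ v ∈ C, ℓ v = b)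
    {v : V} (hv : v ∈ affineSpan ℝ C) : ℓ v = b := by
  refine affineSpan_induction (p := fun v => ℓ v = b) hv hℓ fun c x y z hx hy hz => ?_
  simp [hx, hy, hz]

/-! ### Lattice paths in the ladder diagram -/

section LatticePath

/-- `x m` is the abscissa after `m` unit steps to the right or upwards, starting at the origin. -/
def IsLatticePath (n : ℕ) (x : ℕ → ℕ) : Prop :=
  x 0 = 0 ∧ ∀ m < n, x m ≤ x (m + 1) ∧ x (m + 1) ≤ x m + 1

def pathPoint (x : ℕ → ℕ) (m : ℕ) : ℤ × ℤ := ((x m : ℤ), (m : ℤ) - x m)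

variable {n r : ℕ} {x : ℕ → ℕ} {N : Fin (r + 2) → ℕ}

theorem IsLatticePath.le (h : IsLatticePath n x) {m : ℕ} (hm : m ≤ n) : x m ≤ m := by
  induction m with
  | zero => exact h.1.le
  | succ m ih => have := ih (by omega); have := h.2 m (by omega); omega

theorem IsLatticePath.mono (h : IsLatticePath n x) {m : ℕ} (hm : m ≤ n) :
    x m ≤ x n ∧ x n + m ≤ x m + n := by
  induction n with
  | zero => obtain rfl : m = 0 := by omega
            omega
  | succ n ih =>
    rcases Nat.lt_or_ge n m with h1 | h1
    · obtain rfl : m = n + 1 := by omega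
      omega
    · have := ih ⟨h.1, fun m hm => h.2 m (by omega)⟩ h1
      have := h.2 n (by omega)
      omega

theorem IsLatticePath.adj (h : IsLatticePath n x) {m : ℕ} (hm : m < n) :
    gridGraph.Adj (pathPoint x m) (pathPoint x (m + 1)) := by
  have h1 := h.2 m hm
  change |((x m : ℤ)) - x (m + 1)| + |((m : ℤ) - x m) - (((m + 1 : ℕ) : ℤ) - x (m + 1))| = 1
  rcases (by omega : x (m + 1) = x m ∨ x (m + 1) = x m + 1) with h2 | h2 <;> rw [h2] <;> push_cast
  · have e : ((m : ℤ) - x m) - ((m : ℤ) + 1 - x m) = -1 := by ring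
    rw [e]; simp
  · have e : ((m : ℤ) - x m) - ((m : ℤ) + 1 - (x m + 1)) = 0 := by ring
    have e' : (x m : ℤ) - (x m + 1) = -1 := by ring
    rw [e, e']; simp

theorem exists_walk_getVert {V : Type*} {G : SimpleGraph V} (n : ℕ) (f : ℕ → V)
    (h : ∀ m < n, G.Adj (f m) (f (m + 1))) :
    ∃ P : G.Walk (f 0) (f n), P.length = n ∧ ∀ m ≤ n, P.getVert m = f m := by
  induction n generalizing f with
  | zero => exact ⟨.nil, rfl, fun m hm => by obtain rfl : m = 0 := by omega
                                             rfl⟩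
  | succ n ih =>
    obtain ⟨P, hP, hv⟩ := ih (fun m => f (m + 1)) fun m hm => h (m + 1) (by omega)
    refine ⟨.cons (h 0 (by omega)) P, by simp [hP], fun m hm => ?_⟩
    cases m with
    | zero => simp
    | succ m => rw [SimpleGraph.Walk.getVert_cons_succ]; exact hv m (by omega)

/-- Each step of a walk in the grid raises the sum of the coordinates by at most one. -/
theorem grid_step_le {v w : ℤ × ℤ} (h : gridGraph.Adj v w) : w.1 + w.2 ≤ v.1 + v.2 + 1 := by
  have h : |v.1 - w.1| + |v.2 - w.2| = 1 := h
  have := neg_abs_le (v.1 - w.1)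
  have := neg_abs_le (v.2 - w.2)
  omega

theorem grid_step_eq {v w : ℤ × ℤ} (h : gridGraph.Adj v w) (hs : w.1 + w.2 = v.1 + v.2 + 1) :
    v.1 ≤ w.1 ∧ w.1 ≤ v.1 + 1 := by
  have h : |v.1 - w.1| + |v.2 - w.2| = 1 := h
  rcases abs_cases (v.1 - w.1) with h1 | h1 <;> rcases abs_cases (v.2 - w.2) with h2 | h2 <;> omega

theorem walk_getVert_le {t : ℤ × ℤ} (P : gridGraph.Walk (0, 0) t) {m m' : ℕ} (hm : m ≤ m')
    (hm' : m' ≤ P.length) :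
    (P.getVert m').1 + (P.getVert m').2 ≤ (P.getVert m).1 + (P.getVert m).2 + (m' - m : ℤ) := by
  induction m', hm using Nat.le_induction with
  | base => simp
  | succ m' hm ih =>
    have := ih (by omega)
    have := grid_step_le (P.adj_getVert_succ (i := m') (by omega))
    push_cast
    omega

theorem le_length {t : ℤ × ℤ} (P : gridGraph.Walk (0, 0) t) : t.1 + t.2 ≤ P.length := by
  have := walk_getVert_le P (Nat.zero_le _) le_rfl
  simpa using this

/-- The whole rectangle from the origin to the `j`-th top vertex lies in the ladder: points further
left fall under an earlier strip, whose height bound is weaker. -/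
theorem mem_ladderVertices (hN0 : N 0 = 0) (j : Fin (r + 1)) {v : ℤ × ℤ} (hN : Monotone N)
    (h1 : 0 ≤ v.1) (h2 : v.1 ≤ N j.succ) (h3 : 0 ≤ v.2) (h4 : v.2 ≤ (n : ℤ) - N j.succ) :
    v ∈ ladderVertices n N := by
  induction j using Fin.induction with
  | zero => exact ⟨0, by rw [Fin.castSucc_zero, hN0]; exact_mod_cast h1, h2, h3, h4⟩
  | succ i ih =>
    by_cases h : v.1 ≤ N i.castSucc.succ
    · refine ih h ?_
      have : N i.castSucc.succ ≤ N i.succ.succ := hN (by simp [Fin.le_def])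
      omega
    · refine ⟨i.succ, ?_, h2, h3, h4⟩
      have : i.succ.castSucc = i.castSucc.succ := rfl
      rw [this]
      omega

theorem isTopVertex_iff {v : ℤ × ℤ} (hN0 : N 0 = 0) (hN : Monotone N) (hn : N (Fin.last _) = n) :
    IsTopVertex n N v ↔ ∃ j : Fin (r + 1), v = ((N j.succ : ℤ), (n : ℤ) - N j.succ) := by
  constructor
  · rintro ⟨⟨j, h1, h2, h3, h4⟩, h5⟩
    exact ⟨j, Prod.ext (by simp only; omega) (by simp only; omega)⟩
  · rintro ⟨j, rfl⟩
    have : N j.succ ≤ n := hn ▸ hN (Fin.le_last _)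
    exact ⟨mem_ladderVertices hN0 j hN (by simp) (by simp) (by simp only; omega) (by simp),
      by simp only; omega⟩

/-- A monotone path stays in the rectangle below its endpoint, hence in the ladder. It is shortest
because no grid step raises the coordinate sum by more than one. -/
theorem IsLatticePath.exists_isPositivePath (h : IsLatticePath n x) (hN0 : N 0 = 0)
    (hN : Monotone N) {j : Fin (r + 1)} (hj : x n = N j.succ) :
    ∃ P : gridGraph.Walk (0, 0) (pathPoint x n), IsPositivePath n N P ∧ P.length = n ∧
      ∀ m ≤ n, P.getVert m = pathPoint x m := by
  have h0 : pathPoint x 0 = (0, 0) := by simp [pathPoint, h.1]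
  obtain ⟨P, hP, hv⟩ := exists_walk_getVert n (pathPoint x) fun m hm => h.adj hm
  have hsum : (pathPoint x n).1 + (pathPoint x n).2 = n := by simp [pathPoint]
  have hmem : ∀ m ≤ n, pathPoint x m ∈ ladderVertices n N := fun m hm => by
    have h1 := h.mono hm
    have h2 := h.le hm
    refine mem_ladderVertices hN0 j hN ?_ ?_ ?_ ?_ <;> simp only [pathPoint] <;> omega
  refine ⟨P.copy h0 rfl, ⟨⟨hmem n le_rfl, hsum⟩, ?_, fun Q _ => ?_⟩, by simpa using hP,
    fun m hm => by simpa using hv m hm⟩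
  · have hvert : ∀ v ∈ (P.copy h0 rfl).toSubgraph.verts, v ∈ ladderVertices n N := fun v hv' => by
      obtain ⟨m, rfl, hm⟩ := (SimpleGraph.Walk.mem_support_iff_exists_getVert).1
        ((SimpleGraph.Walk.mem_verts_toSubgraph _).1 hv')
      rw [SimpleGraph.Walk.getVert_copy]
      rw [SimpleGraph.Walk.length_copy, hP] at hm
      rw [hv m hm]
      exact hmem m hm
    exact ⟨hvert, fun v w hvw => ⟨hvert v ((P.copy h0 rfl).toSubgraph.edge_vert hvw),
      hvert w ((P.copy h0 rfl).toSubgraph.edge_vert hvw.symm), (P.copy h0 rfl).toSubgraph.adj_sub hvw⟩⟩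
  · have := le_length Q
    rw [SimpleGraph.Walk.length_copy, hP]
    omega

/-- Every top vertex is reached by a lattice path. -/
theorem exists_isLatticePath {j : ℕ} (hj : j ≤ n) : ∃ x, IsLatticePath n x ∧ x n = j :=
  ⟨fun m => m - (n - j), ⟨by simp, fun m _ => by dsimp only; omega⟩, by dsimp only; omega⟩

/-- Comparison with an explicit monotone path gives length `n`. The coordinate sum must then rise by
one at every step, so each step goes right or up. -/
theorem IsPositivePath.exists_isLatticePath {t : ℤ × ℤ} {P : gridGraph.Walk (0, 0) t}
    (hP : IsPositivePath n N P) (hN0 : N 0 = 0) (hN : Monotone N) (hn : N (Fin.last _) = n) :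
    ∃ x, IsLatticePath n x ∧ (∃ j : Fin (r + 1), x n = N j.succ) ∧ t = pathPoint x n ∧
      P.length = n ∧ ∀ m ≤ n, P.getVert m = pathPoint x m := by
  obtain ⟨hT, -, hmin⟩ := hP
  obtain ⟨j, hj⟩ := (isTopVertex_iff hN0 hN hn).1 hT
  have hjn : N j.succ ≤ n := hn ▸ hN (Fin.le_last _)
  have hlen : P.length = n := by
    obtain ⟨x, hx, hxn⟩ := _root_.exists_isLatticePath hjn
    obtain ⟨Q, ⟨-, hQ, -⟩, hQn, -⟩ := hx.exists_isPositivePath hN0 hN hxn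
    have ht : pathPoint x n = t := by rw [hj, pathPoint, hxn]
    subst ht
    have h1 := hmin Q hQ
    have h2 := le_length P
    have h3 := hT.2
    omega
  have hsum : ∀ m ≤ n, (P.getVert m).1 + (P.getVert m).2 = m := fun m hm => by
    have h1 := walk_getVert_le P (Nat.zero_le m) (by omega)
    have h2 := walk_getVert_le P (m := m) (m' := P.length) (by omega) le_rfl
    have h3 := hT.2
    rw [SimpleGraph.Walk.getVert_length, hlen] at h2
    simp only [SimpleGraph.Walk.getVert_zero] at h1
    push_cast at h1
    omega
  have hstep : ∀ m < n, (P.getVert m).1 ≤ (P.getVert (m + 1)).1 ∧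
      (P.getVert (m + 1)).1 ≤ (P.getVert m).1 + 1 := fun m hm => by
    refine grid_step_eq (P.adj_getVert_succ (by omega)) ?_
    rw [hsum m hm.le, hsum (m + 1) hm]
    push_cast; ring
  have hnn : ∀ m ≤ n, 0 ≤ (P.getVert m).1 := by
    intro m
    induction m with
    | zero => simp
    | succ m ih => intro hm; have := ih (by omega); have := hstep m hm; omega
  have hx : ∀ m ≤ n, P.getVert m = pathPoint (fun m => (P.getVert m).1.toNat) m := fun m hm => by
    have h1 := hnn m hm
    have h2 := hsum m hm
    refine Prod.ext ?_ ?_ <;> simp only [pathPoint] <;> omega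
  have htn : t = pathPoint (fun m => (P.getVert m).1.toNat) n := by
    rw [← hx n le_rfl, ← hlen, SimpleGraph.Walk.getVert_length]
  refine ⟨fun m => (P.getVert m).1.toNat, ⟨by simp, fun m hm => ?_⟩, ⟨j, ?_⟩, htn, hlen, hx⟩
  · have h1 := hstep m hm
    have h2 := hnn m hm.le
    dsimp only
    omega
  · have := congrArg Prod.fst (htn.symm.trans hj)
    simp only [pathPoint] at this
    exact_mod_cast this

/-- The union of the paths in `X`. -/
def HasPaths (n : ℕ) (X : Set (ℕ → ℕ)) (γ : gridGraph.Subgraph) : Prop :=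
  ∀ v w, γ.Adj v w ↔ ∃ x ∈ X, ∃ m < n, s(pathPoint x m, pathPoint x (m + 1)) = s(v, w)

theorem IsLadderFace.exists_hasPaths {γ : gridGraph.Subgraph} (h : IsLadderFace n N γ)
    (hN0 : N 0 = 0) (hN : Monotone N) (hn : N (Fin.last _) = n) :
    ∃ X : Set (ℕ → ℕ), (∀ x ∈ X, IsLatticePath n x ∧ ∃ j : Fin (r + 1), x n = N j.succ) ∧
      (∀ j : Fin (r + 1), ∃ x ∈ X, x n = N j.succ) ∧ HasPaths n X γ := by
  obtain ⟨htop, paths, hpos, rfl⟩ := h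
  refine ⟨{x | IsLatticePath n x ∧ (∃ j : Fin (r + 1), x n = N j.succ) ∧ ∃ P ∈ paths,
    P.2.length = n ∧ ∀ m ≤ n, P.2.getVert m = pathPoint x m}, fun x hx => ⟨hx.1, hx.2.1⟩,
    fun j => ?_, fun v w => ?_⟩
  · have hv := htop _ ((isTopVertex_iff hN0 hN hn).2 ⟨j, rfl⟩)
    simp only [SimpleGraph.Subgraph.verts_iSup, mem_iUnion, SimpleGraph.Walk.mem_verts_toSubgraph,
      SimpleGraph.Walk.mem_support_iff_exists_getVert] at hv
    obtain ⟨P, hP, m, hm, hml⟩ := hv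
    obtain ⟨x, hx, hxn, -, hl, hxv⟩ := (hpos P hP).exists_isLatticePath hN0 hN hn
    refine ⟨x, ⟨hx, hxn, P, hP, hl, hxv⟩, ?_⟩
    rw [hxv m (hl ▸ hml)] at hm
    have h1 := congrArg Prod.fst hm
    have h2 := congrArg Prod.snd hm
    simp only [pathPoint] at h1 h2
    have : m = n := by omega
    subst this
    omega
  · simp only [SimpleGraph.Subgraph.iSup_adj, SimpleGraph.Walk.toSubgraph_adj_iff]
    constructor
    · rintro ⟨P, hP, m, hm, hml⟩
      obtain ⟨x, hx, hxn, -, hl, hxv⟩ := (hpos P hP).exists_isLatticePath hN0 hN hn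
      refine ⟨x, ⟨hx, hxn, P, hP, hl, hxv⟩, m, hl ▸ hml, ?_⟩
      rw [← hm, hxv m (by omega), hxv (m + 1) (by omega)]
    · rintro ⟨x, ⟨hx, hxn, P, hP, hl, hxv⟩, m, hm, h⟩
      refine ⟨P, hP, m, ?_, hl ▸ hm⟩
      rw [← h, hxv m hm.le, hxv (m + 1) hm]

theorem exists_isLadderFace (hN0 : N 0 = 0) (hN : Monotone N) (hn : N (Fin.last _) = n)
    {X : Set (ℕ → ℕ)} (hX : ∀ x ∈ X, IsLatticePath n x ∧ ∃ j : Fin (r + 1), x n = N j.succ)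
    (htop : ∀ j : Fin (r + 1), ∃ x ∈ X, x n = N j.succ) :
    ∃ γ, IsLadderFace n N γ ∧ HasPaths n X γ := by
  refine ⟨_, ⟨fun t ht => ?_, {P | IsPositivePath n N P.2 ∧ ∃ x ∈ X, P.2.length = n ∧
    ∀ m ≤ n, P.2.getVert m = pathPoint x m}, fun P hP => hP.1, rfl⟩, fun v w => ?_⟩
  · obtain ⟨j, rfl⟩ := (isTopVertex_iff hN0 hN hn).1 ht
    obtain ⟨x, hx, hxn⟩ := htop j
    obtain ⟨P, hP, hl, hv⟩ := (hX x hx).1.exists_isPositivePath hN0 hN hxn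
    simp only [SimpleGraph.Subgraph.verts_iSup, mem_iUnion, SimpleGraph.Walk.mem_verts_toSubgraph]
    refine ⟨⟨_, P⟩, ⟨hP, x, hx, hl, hv⟩, ?_⟩
    convert P.end_mem_support using 1
    rw [pathPoint, hxn]
  · simp only [SimpleGraph.Subgraph.iSup_adj, SimpleGraph.Walk.toSubgraph_adj_iff]
    constructor
    · rintro ⟨P, ⟨-, x, hx, hl, hxv⟩, m, hm, hml⟩
      refine ⟨x, hx, m, hl ▸ hml, ?_⟩
      rw [← hm, hxv m (by omega), hxv (m + 1) (by omega)]
    · rintro ⟨x, hx, m, hm, h⟩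
      obtain ⟨hx', j, hxn⟩ := hX x hx
      obtain ⟨P, hP, hl, hv⟩ := hx'.exists_isPositivePath hN0 hN hxn
      refine ⟨⟨_, P⟩, ⟨hP, x, hx, hl, hv⟩, m, ?_, hm.trans_eq hl.symm⟩
      rw [← h, hv m hm.le, hv (m + 1) hm]

/-- The `m`-th point of a path has coordinate sum `m`, so an edge between the antidiagonals `k` and
`k + 1` can only be the `k`-th step of a path. -/
theorem HasPaths.adj_horizontal {X : Set (ℕ → ℕ)} {γ : gridGraph.Subgraph} (h : HasPaths n X γ)
    {k i : ℕ} (hk : k < n) :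
    γ.Adj ((i : ℤ), (k : ℤ) - i) ((i : ℤ) + 1, (k : ℤ) - i) ↔ ∃ x ∈ X, x k = i ∧ x (k + 1) = i + 1 := by
  rw [h]
  refine exists_congr fun x => and_congr_right fun _ => ⟨?_, fun ⟨h1, h2⟩ => ⟨k, hk, ?_⟩⟩
  · rintro ⟨m, -, hm⟩
    simp only [Sym2.eq_iff, pathPoint, Prod.mk.injEq] at hm
    have : m = k := by omega
    subst this
    omega
  · rw [pathPoint, pathPoint, h1, h2]
    push_cast
    have e1 : (k : ℤ) + 1 - (i + 1) = k - i := by ring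
    rw [e1]

theorem HasPaths.adj_vertical {X : Set (ℕ → ℕ)} {γ : gridGraph.Subgraph} (h : HasPaths n X γ)
    {k i : ℕ} (hk : k < n) :
    γ.Adj ((i : ℤ) + 1, (k : ℤ) - i - 1) ((i : ℤ) + 1, (k : ℤ) - i) ↔
      ∃ x ∈ X, x k = i + 1 ∧ x (k + 1) = i + 1 := by
  rw [h]
  refine exists_congr fun x => and_congr_right fun _ => ⟨?_, fun ⟨h1, h2⟩ => ⟨k, hk, ?_⟩⟩
  · rintro ⟨m, -, hm⟩
    simp only [Sym2.eq_iff, pathPoint, Prod.mk.injEq] at hm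
    have : m = k := by omega
    subst this
    omega
  · rw [pathPoint, pathPoint, h1, h2]
    push_cast
    have e1 : (k : ℤ) - (i + 1) = k - i - 1 := by ring
    have e2 : (k : ℤ) + 1 - (i + 1) = k - i := by ring
    rw [e1, e2]

end LatticePath

/-! ### The Gelfand-Cetlin pattern as a triangular array -/

section Array

variable {n : ℕ} {lam : Fin n → ℝ} {u w : GCIndex n → ℝ}

/-- The entry with index `(i + 1, k - i)`, the `i`-th eigenvalue (from `0`) of the `k × k` block. -/
noncomputable def gcArray (u : GCIndex n → ℝ) (k i : ℕ) : ℝ :=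
  if h : i < k ∧ k ≤ n then u ⟨(i + 1, k - i), by dsimp only; omega⟩ else 0

theorem gcArray_eq {k i : ℕ} (p : GCIndex n) (h1 : p.1.1 = i + 1) (h2 : p.1.2 + i = k) :
    gcArray u k i = u p := by
  obtain ⟨⟨a, b⟩, hp⟩ := p
  dsimp only at h1 h2 hp
  subst h1 h2
  rw [gcArray, dif_pos (by omega)]
  congr 3
  omega

theorem gcArray_index {k i : ℕ} (hi : i < k) (hk : k ≤ n) :
    ∃ p : GCIndex n, p.1 = (i + 1, k - i) ∧ ∀ u : GCIndex n → ℝ, gcArray u k i = u p :=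
  ⟨⟨(i + 1, k - i), by dsimp only; omega⟩, rfl, fun _ => dif_pos ⟨hi, hk⟩⟩

/-- Membership in the polytope in terms of arrays. -/
theorem mem_gcPolytope_iff : u ∈ gcPolytope lam ↔ (∀ i : Fin n, gcArray u n i = lam i) ∧
    ∀ k < n, ∀ i < k, gcArray u k i ≤ gcArray u (k + 1) i ∧
      gcArray u (k + 1) (i + 1) ≤ gcArray u k i := by
  constructor
  · rintro ⟨h1, h2, h3⟩
    refine ⟨fun i => ?_, fun k hk i hi => ?_⟩
    · obtain ⟨p, hp, hu⟩ := gcArray_index i.2 le_rfl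
      rw [hu, h1 i p hp]
    · obtain ⟨p, hp, hu⟩ := gcArray_index hi hk.le
      obtain ⟨q, hq, hu'⟩ := gcArray_index (i := i) (k := k + 1) (by omega) hk
      obtain ⟨q', hq', hu''⟩ := gcArray_index (i := i + 1) (k := k + 1) (by omega) hk
      rw [hu, hu', hu'']
      exact ⟨h2 p q (by rw [hq, hp, Prod.mk.injEq]; exact ⟨rfl, by omega⟩),
        h3 p q' (by rw [hq', hp, Prod.mk.injEq]; exact ⟨rfl, by omega⟩)⟩
  · rintro ⟨h1, h2⟩
    refine ⟨fun j p hp => ?_, fun p q hq => ?_, fun p q hq => ?_⟩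
    · rw [← h1, gcArray_eq p (by rw [hp]) (by rw [hp]; dsimp only; omega)]
    · have hp := p.2
      have hq' := q.2
      have e1 := congrArg Prod.fst hq
      have e2 := congrArg Prod.snd hq
      dsimp only at e1 e2
      have := (h2 (p.1.1 + p.1.2 - 1) (by omega) (p.1.1 - 1) (by omega)).1
      rwa [gcArray_eq p (by omega) (by omega), gcArray_eq q (by omega) (by omega)] at this
    · have hp := p.2
      have hq' := q.2
      have e1 := congrArg Prod.fst hq
      have e2 := congrArg Prod.snd hq
      dsimp only at e1 e2
      have := (h2 (p.1.1 + p.1.2 - 1) (by omega) (p.1.1 - 1) (by omega)).2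
      rwa [gcArray_eq q (by omega) (by omega), gcArray_eq p (by omega) (by omega)] at this

/-- `u` and `w` agree on the equality of neighbouring entries. -/
def SamePattern (u w : GCIndex n → ℝ) : Prop :=
  ∀ k < n, ∀ i < k, (gcArray u k i = gcArray u (k + 1) i ↔ gcArray w k i = gcArray w (k + 1) i) ∧
    (gcArray u (k + 1) (i + 1) = gcArray u k i ↔ gcArray w (k + 1) (i + 1) = gcArray w k i)

theorem exists_linearMap_gcArray (k i : ℕ) :
    ∃ ℓ : (GCIndex n → ℝ) →ₗ[ℝ] ℝ, Continuous ℓ ∧ ∀ v, ℓ v = gcArray v k i := by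
  by_cases h : i < k ∧ k ≤ n
  · obtain ⟨p, -, hp⟩ := gcArray_index h.1 h.2
    exact ⟨LinearMap.proj p, continuous_apply p, fun v => (hp v).symm⟩
  · exact ⟨0, continuous_zero, fun v => by rw [gcArray, dif_neg h]; rfl⟩

/-- The differences of neighbouring entries are linear functionals that are nonnegative on the
polytope; one vanishing at a relatively interior point vanishes on all of `f`. -/
theorem gcArray_eq_of_intrinsicInterior {f : Set (GCIndex n → ℝ)} (hf : f ⊆ gcPolytope lam)
    (hu : u ∈ intrinsicInterior ℝ f) (hw : w ∈ f) {k i : ℕ} (hk : k < n) (hi : i < k) :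
    (gcArray u k i = gcArray u (k + 1) i → gcArray w k i = gcArray w (k + 1) i) ∧
      (gcArray u (k + 1) (i + 1) = gcArray u k i → gcArray w (k + 1) (i + 1) = gcArray w k i) := by
  obtain ⟨ℓ, -, hℓ⟩ := exists_linearMap_gcArray (n := n) k i
  obtain ⟨ℓ₁, -, hℓ₁⟩ := exists_linearMap_gcArray (n := n) (k + 1) i
  obtain ⟨ℓ₂, -, hℓ₂⟩ := exists_linearMap_gcArray (n := n) (k + 1) (i + 1)
  constructor <;> intro h
  · have := eq_zero_of_mem_intrinsicInterior (ℓ₁ - ℓ) (fun v hv => by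
      have := ((mem_gcPolytope_iff.1 (hf hv)).2 k hk i hi).1
      simpa [hℓ, hℓ₁] using this) hu (by simp [hℓ, hℓ₁, h]) hw
    simp only [LinearMap.sub_apply, hℓ, hℓ₁] at this
    linarith
  · have := eq_zero_of_mem_intrinsicInterior (ℓ - ℓ₂) (fun v hv => by
      have := ((mem_gcPolytope_iff.1 (hf hv)).2 k hk i hi).2
      simpa [hℓ, hℓ₂] using this) hu (by simp [hℓ, hℓ₂, h]) hw
    simp only [LinearMap.sub_apply, hℓ, hℓ₂] at this
    linarith

theorem samePattern_of_intrinsicInterior {f : Set (GCIndex n → ℝ)} (hf : f ⊆ gcPolytope lam)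
    (hu : u ∈ intrinsicInterior ℝ f) (hw : w ∈ intrinsicInterior ℝ f) : SamePattern u w := by
  intro k hk i hi
  have h1 := gcArray_eq_of_intrinsicInterior hf hu (intrinsicInterior_subset hw) hk hi
  have h2 := gcArray_eq_of_intrinsicInterior hf hw (intrinsicInterior_subset hu) hk hi
  exact ⟨⟨h1.1, h2.1⟩, ⟨h1.2, h2.2⟩⟩

/-- The walls of `γ` above and to the right of the box with index `(i + 1, k - i)`. -/
def UpWall (γ : gridGraph.Subgraph) (k i : ℕ) : Prop :=
  γ.Adj ((i : ℤ), (k : ℤ) - i) ((i : ℤ) + 1, (k : ℤ) - i)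

def RightWall (γ : gridGraph.Subgraph) (k i : ℕ) : Prop :=
  γ.Adj ((i : ℤ) + 1, (k : ℤ) - i - 1) ((i : ℤ) + 1, (k : ℤ) - i)

theorem undivided_iff (γ : gridGraph.Subgraph) {i k : ℕ} {p q : ℤ × ℤ}
    (hp : p = ((i : ℤ) + 1, (k : ℤ) - i)) :
    Undivided γ p q ↔ (q = ((i : ℤ) + 2, (k : ℤ) - i) ∧ ¬ RightWall γ k i) ∨
      (q = ((i : ℤ) + 1, (k : ℤ) - i + 1) ∧ ¬ UpWall γ k i) := by
  subst hp
  have e1 : (i : ℤ) + 1 + 1 = i + 2 := by ring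
  have e2 : (i : ℤ) + 1 - 1 = i := by ring
  simp only [Undivided, UpWall, RightWall, e1, e2]

theorem mem_gcFace_iff {γ : gridGraph.Subgraph} : u ∈ gcFace lam γ ↔ u ∈ gcPolytope lam ∧
    ∀ k < n, ∀ i < k, (¬ UpWall γ k i → gcArray u k i = gcArray u (k + 1) i) ∧
      (¬ RightWall γ k i → gcArray u (k + 1) (i + 1) = gcArray u k i) := by
  refine and_congr_right fun _ => ⟨fun h k hk i hi => ?_, fun h p q hpq => ?_⟩
  · obtain ⟨p, hp, hu⟩ := gcArray_index hi hk.le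
    obtain ⟨q, hq, hu'⟩ := gcArray_index (i := i) (k := k + 1) (by omega) hk
    obtain ⟨q', hq', hu''⟩ := gcArray_index (i := i + 1) (k := k + 1) (by omega) hk
    have hpb : p.box = ((i : ℤ) + 1, (k : ℤ) - i) := by
      simp only [GCIndex.box, hp, Prod.mk.injEq]; omega
    rw [hu, hu', hu'']
    constructor <;> intro hw
    · refine h p q ((undivided_iff γ hpb).2 (Or.inr ⟨?_, hw⟩))
      simp only [GCIndex.box, hq, Prod.mk.injEq]; omega
    · refine (h p q' ((undivided_iff γ hpb).2 (Or.inl ⟨?_, hw⟩))).symm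
      simp only [GCIndex.box, hq', Prod.mk.injEq]; omega
  · have hp := p.2
    have hq := q.2
    have hpb : p.box = (((p.1.1 - 1 : ℕ) : ℤ) + 1, ((p.1.1 + p.1.2 - 1 : ℕ) : ℤ) - (p.1.1 - 1 : ℕ)) := by
      simp only [GCIndex.box, Prod.mk.injEq]; omega
    rcases (undivided_iff γ hpb).1 hpq with ⟨e, hw⟩ | ⟨e, hw⟩
    · simp only [GCIndex.box, Prod.mk.injEq] at e
      have := (h _ (by omega) _ (by omega)).2 hw
      rw [gcArray_eq q (by omega) (by omega), gcArray_eq p (by omega) (by omega)] at this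
      exact this.symm
    · simp only [GCIndex.box, Prod.mk.injEq] at e
      have := (h _ (by omega) _ (by omega)).1 hw
      rwa [gcArray_eq p (by omega) (by omega), gcArray_eq q (by omega) (by omega)] at this

/-- A point of `f_γ` at which all walls of `γ` are strict lies in the relative interior. -/
theorem mem_intrinsicInterior_gcFace {γ : gridGraph.Subgraph} (hu : u ∈ gcFace lam γ)
    (h : ∀ k < n, ∀ i < k, (UpWall γ k i → gcArray u k i < gcArray u (k + 1) i) ∧
      (RightWall γ k i → gcArray u (k + 1) (i + 1) < gcArray u k i)) :
    u ∈ intrinsicInterior ℝ (gcFace lam γ) := by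
  have hcont : ∀ k i, Continuous fun v : GCIndex n → ℝ => gcArray v k i := fun k i => by
    obtain ⟨ℓ, hc, hℓ⟩ := exists_linearMap_gcArray (n := n) k i
    simpa only [← hℓ] using hc
  -- Linear equalities on the face persist on its affine span. Only the strict inequalities at walls
  -- remain, and they are open conditions.
  have hspan : ∀ (k i k' i' : ℕ), (∀ v ∈ gcFace lam γ, gcArray v k i = gcArray v k' i') →
      ∀ v ∈ affineSpan ℝ (gcFace lam γ), gcArray v k i = gcArray v k' i' := by
    intro k i k' i' hv v hvs
    obtain ⟨ℓ, -, hℓ⟩ := exists_linearMap_gcArray (n := n) k i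
    obtain ⟨ℓ', -, hℓ'⟩ := exists_linearMap_gcArray (n := n) k' i'
    have := eq_of_mem_affineSpan (ℓ - ℓ') 0 (fun v hv' => by simp [hℓ, hℓ', hv v hv']) hvs
    simp only [LinearMap.sub_apply, hℓ, hℓ'] at this
    linarith
  have hev : ∀ᶠ v in 𝓝 u, ∀ k < n, ∀ i < k,
      (UpWall γ k i → gcArray v k i < gcArray v (k + 1) i) ∧
      (RightWall γ k i → gcArray v (k + 1) (i + 1) < gcArray v k i) := by
    refine (eventually_all_finite (finite_Iio n)).2 fun k hk =>
      (eventually_all_finite (finite_Iio k)).2 fun i hi => ?_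
    obtain ⟨h1, h2⟩ := h k hk i hi
    refine Eventually.and ?_ ?_
    · by_cases hw : UpWall γ k i
      · exact ((hcont _ _).continuousAt.eventually_lt (hcont _ _).continuousAt (h1 hw)).mono
          fun v hv _ => hv
      · exact Eventually.of_forall fun v hv => absurd hv hw
    · by_cases hw : RightWall γ k i
      · exact ((hcont _ _).continuousAt.eventually_lt (hcont _ _).continuousAt (h2 hw)).mono
          fun v hv _ => hv
      · exact Eventually.of_forall fun v hv => absurd hv hw
  refine mem_intrinsicInterior_of_nhds hu hev fun v hvs hv => ?_
  have heq : ∀ k < n, ∀ i < k, (¬ UpWall γ k i → gcArray v k i = gcArray v (k + 1) i) ∧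
      (¬ RightWall γ k i → gcArray v (k + 1) (i + 1) = gcArray v k i) := fun k hk i hi =>
    ⟨fun hw => hspan _ _ _ _ (fun v hv => ((mem_gcFace_iff.1 hv).2 k hk i hi).1 hw) v hvs,
      fun hw => hspan _ _ _ _ (fun v hv => ((mem_gcFace_iff.1 hv).2 k hk i hi).2 hw) v hvs⟩
  refine mem_gcFace_iff.2 ⟨mem_gcPolytope_iff.2 ⟨fun i => ?_, fun k hk i hi => ⟨?_, ?_⟩⟩, heq⟩
  · obtain ⟨ℓ, -, hℓ⟩ := exists_linearMap_gcArray (n := n) n i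
    rw [← hℓ]
    exact eq_of_mem_affineSpan ℓ _ (fun v hv => by
      rw [hℓ]; exact (mem_gcPolytope_iff.1 hv.1).1 i) hvs
  · by_cases hw : UpWall γ k i
    · exact ((hv k hk i hi).1 hw).le
    · exact ((heq k hk i hi).1 hw).le
  · by_cases hw : RightWall γ k i
    · exact ((hv k hk i hi).2 hw).le
    · exact ((heq k hk i hi).2 hw).le

theorem gcArray_antitone (hu : u ∈ gcPolytope lam) {k : ℕ} (hk : k < n) :
    Interlacing (fun i : Fin k => gcArray u k i) fun i : Fin (k + 1) => gcArray u (k + 1) i := by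
  intro i
  have := (mem_gcPolytope_iff.1 hu).2 k hk i i.2
  simpa using this

end Array

/-! ### Level curves -/

section LevelCurve

variable {n r : ℕ} {N : Fin (r + 2) → ℕ} {lam : Fin n → ℝ} {u : GCIndex n → ℝ}

theorem gcArray_succ_le (hu : u ∈ gcPolytope lam) {k i : ℕ} (hk : k ≤ n) (hi : i + 1 < k) :
    gcArray u k (i + 1) ≤ gcArray u k i := by
  obtain ⟨k, rfl⟩ : ∃ l, k = l + 1 := ⟨k - 1, by omega⟩
  have := (mem_gcPolytope_iff.1 hu).2 k (by omega) i (by omega)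
  exact this.2.trans this.1

theorem gcArray_le (hu : u ∈ gcPolytope lam) {k i j : ℕ} (hk : k ≤ n) (hij : i ≤ j) (hj : j < k) :
    gcArray u k j ≤ gcArray u k i := by
  induction j, hij using Nat.le_induction with
  | base => exact le_rfl
  | succ j hij ih => exact (gcArray_succ_le hu hk hj).trans (ih (by omega))

/-- The path that separates the entries `≥ c` from those `< c`. -/
noncomputable def levelPath (u : GCIndex n → ℝ) (c : ℝ) (k : ℕ) : ℕ :=
  sInf {i | k ≤ i ∨ gcArray u k i < c}

theorem lt_levelPath (hu : u ∈ gcPolytope lam) {c : ℝ} {k i : ℕ} (hk : k ≤ n) :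
    i < levelPath u c k ↔ i < k ∧ c ≤ gcArray u k i := by
  constructor
  · intro h
    have := Nat.notMem_of_lt_sInf h
    simpa using this
  · rintro ⟨h1, h2⟩
    have h3 : levelPath u c k ∈ {i | k ≤ i ∨ gcArray u k i < c} :=
      Nat.sInf_mem ⟨k, Or.inl le_rfl⟩
    by_contra h
    rcases h3 with h3 | h3
    · omega
    · have := gcArray_le hu hk (not_lt.1 h) h1
      linarith

/-- The abscissa at level `k` counts the entries `≥ c` in row `k`; interlacing says that this number
grows by zero or one from row to row. -/
theorem isLatticePath_levelPath (hu : u ∈ gcPolytope lam) (c : ℝ) :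
    IsLatticePath n (levelPath u c) := by
  refine ⟨?_, fun m hm => ⟨?_, ?_⟩⟩
  · have := (lt_levelPath hu (c := c) (i := 0) (Nat.zero_le n)).1
    by_contra h
    have := (this (by omega)).1
    omega
  · by_contra! h
    obtain ⟨h1, h2⟩ := (lt_levelPath hu hm.le).1 h
    have h3 := ((mem_gcPolytope_iff.1 hu).2 m hm _ h1).1
    have := (lt_levelPath hu (c := c) (k := m + 1) hm).2 ⟨by omega, h2.trans h3⟩
    omega
  · by_contra! h
    obtain ⟨h1, h2⟩ := (lt_levelPath hu hm).1 h
    have h3 := ((mem_gcPolytope_iff.1 hu).2 m hm (levelPath u c m) (by omega)).2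
    exact lt_irrefl _ ((lt_levelPath hu hm.le).2 ⟨(by omega : levelPath u c m < m), h2.trans h3⟩)

theorem gcArray_le_lam (hu : u ∈ gcPolytope lam) {k i : ℕ} (hi : i < k) (hk : k ≤ n) :
    gcArray u k i ≤ lam ⟨i, hi.trans_le hk⟩ := by
  rw [← (mem_gcPolytope_iff.1 hu).1]
  dsimp only
  have h : ∀ m, k ≤ m → m ≤ n → gcArray u k i ≤ gcArray u m i := by
    intro m hkm
    induction m, hkm using Nat.le_induction with
    | base => exact fun _ => le_rfl
    | succ m hkm ih =>
      intro hm
      exact (ih (by omega)).trans ((mem_gcPolytope_iff.1 hu).2 m hm i (by omega)).1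
  exact h n hk le_rfl

/-- The bound on `c` keeps the endpoint away from abscissa `0`. Otherwise the level curve ends at
the right edge or where `lam` drops, which happens only at the `N j`. -/
theorem levelPath_top (hN0 : N 0 = 0) (hNlast : N (Fin.last (r + 1)) = n)
    (hlam : ∀ i i' : Fin n, lam i' < lam i ↔ ∃ j, (i : ℕ) < N j ∧ N j ≤ (i' : ℕ))
    (hu : u ∈ gcPolytope lam) {c : ℝ} {i : Fin n} (hc : c ≤ lam i) :
    ∃ j : Fin (r + 1), levelPath u c n = N j.succ := by
  have htop := (mem_gcPolytope_iff.1 hu).1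
  have hx := (isLatticePath_levelPath hu c).le le_rfl
  have hi : (i : ℕ) < levelPath u c n := (lt_levelPath hu le_rfl).2 ⟨i.2, by rwa [htop]⟩
  rcases hx.eq_or_lt with hx | hx
  · exact ⟨Fin.last r, by rw [Fin.succ_last, hNlast, hx]⟩
  · have h1 := ((lt_levelPath hu le_rfl).1 (by omega : levelPath u c n - 1 < levelPath u c n)).2
    have h2 : gcArray u n (levelPath u c n) < c := by
      by_contra h
      exact lt_irrefl _ ((lt_levelPath hu le_rfl).2 ⟨hx, not_lt.1 h⟩)
    have h3 := htop ⟨levelPath u c n, hx⟩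
    have h4 := htop ⟨levelPath u c n - 1, by omega⟩
    dsimp only at h3 h4
    obtain ⟨j, hj1, hj2⟩ := (hlam ⟨levelPath u c n - 1, by omega⟩ ⟨levelPath u c n, hx⟩).1
      (by rw [← h3, ← h4]; linarith)
    dsimp only at hj1 hj2
    obtain ⟨j', rfl⟩ := Fin.exists_succ_eq_of_ne_zero (x := j) (by rintro rfl; omega)
    exact ⟨j', by omega⟩

/-- Every point of the polytope lies in the relative interior of the face cut out by its level
curves. -/
theorem exists_mem_intrinsicInterior_gcFace (hN : StrictMono N) (hN0 : N 0 = 0)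
    (hNlast : N (Fin.last (r + 1)) = n)
    (hlam : ∀ i i' : Fin n, lam i' < lam i ↔ ∃ j, (i : ℕ) < N j ∧ N j ≤ (i' : ℕ))
    (hu : u ∈ gcPolytope lam) :
    ∃ γ, IsLadderFace n N γ ∧ u ∈ intrinsicInterior ℝ (gcFace lam γ) := by
  have htop := (mem_gcPolytope_iff.1 hu).1
  -- Thresholds exceeding every `lam i` are excluded, since their level curves run straight up to
  -- `(0, n)`, which is not a top vertex.
  obtain ⟨γ, hγ, hX⟩ := exists_isLadderFace (X := {x | ∃ c, (∃ i, c ≤ lam i) ∧ x = levelPath u c})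
    hN0 hN.monotone hNlast
    (fun x hx => by
      obtain ⟨c, ⟨i, hi⟩, rfl⟩ := hx
      exact ⟨isLatticePath_levelPath hu c, levelPath_top hN0 hNlast hlam hu hi⟩)
    (fun j => by
      have hjn : N j.succ ≤ n := hNlast ▸ hN.monotone (Fin.le_last _)
      have hj0 : 0 < N j.succ := hN0 ▸ hN (Fin.succ_pos j)
      refine ⟨_, ⟨lam ⟨N j.succ - 1, by omega⟩, ⟨_, le_rfl⟩, rfl⟩, ?_⟩
      have h1 := (lt_levelPath hu (c := lam ⟨N j.succ - 1, by omega⟩) le_rfl).2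
        ⟨(by omega : N j.succ - 1 < n), by rw [← htop]⟩
      have h2 : ¬ N j.succ < levelPath u (lam ⟨N j.succ - 1, by omega⟩) n := fun h => by
        obtain ⟨h3, h4⟩ := (lt_levelPath hu le_rfl).1 h
        have h5 := htop ⟨N j.succ, h3⟩
        dsimp only at h5
        rw [h5, ← not_lt] at h4
        exact h4 ((hlam _ _).2 ⟨j.succ, by dsimp only; omega, le_rfl⟩)
      omega)
  -- The level curve of `c` passes between two neighbouring boxes exactly when `c` separates their
  -- entries; the larger entry itself serves as the threshold.
  have hup : ∀ k < n, ∀ i < k, UpWall γ k i ↔ gcArray u k i < gcArray u (k + 1) i := by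
    intro k hk i hi
    rw [UpWall, hX.adj_horizontal hk]
    constructor
    · rintro ⟨_, ⟨c, -, rfl⟩, h1, h2⟩
      have h3 := ((lt_levelPath hu (k := k + 1) hk).1 (by omega : i < levelPath u c (k + 1))).2
      have h4 : ¬ c ≤ gcArray u k i := fun h => by
        have := (lt_levelPath hu hk.le).2 ⟨hi, h⟩
        omega
      linarith
    · intro h
      refine ⟨_, ⟨gcArray u (k + 1) i, ⟨_, gcArray_le_lam hu (by omega) hk⟩, rfl⟩, ?_⟩
      have h1 := (lt_levelPath hu (k := k + 1) hk).2 ⟨(by omega : i < k + 1), le_rfl⟩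
      have h2 : ¬ i < levelPath u (gcArray u (k + 1) i) k := fun h' => by
        have := ((lt_levelPath hu hk.le).1 h').2
        linarith
      have h3 := (isLatticePath_levelPath hu (gcArray u (k + 1) i)).2 k hk
      omega
  have hright : ∀ k < n, ∀ i < k, RightWall γ k i ↔ gcArray u (k + 1) (i + 1) < gcArray u k i := by
    intro k hk i hi
    rw [RightWall, hX.adj_vertical hk]
    constructor
    · rintro ⟨_, ⟨c, -, rfl⟩, h1, h2⟩
      have h3 := ((lt_levelPath hu hk.le).1 (by omega : i < levelPath u c k)).2
      have h4 : ¬ c ≤ gcArray u (k + 1) (i + 1) := fun h => by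
        have := (lt_levelPath hu (k := k + 1) hk).2 ⟨by omega, h⟩
        omega
      linarith
    · intro h
      refine ⟨_, ⟨gcArray u k i, ⟨_, gcArray_le_lam hu hi hk.le⟩, rfl⟩, ?_⟩
      have h1 := (lt_levelPath hu hk.le).2 ⟨hi, le_rfl⟩
      have h2 : ¬ i + 1 < levelPath u (gcArray u k i) (k + 1) := fun h' => by
        have := ((lt_levelPath hu (k := k + 1) hk).1 h').2
        linarith
      have h3 := (isLatticePath_levelPath hu (gcArray u k i)).2 k hk
      omega
  refine ⟨γ, hγ, mem_intrinsicInterior_gcFace (mem_gcFace_iff.2 ⟨hu, fun k hk i hi => ⟨fun h => ?_,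
    fun h => ?_⟩⟩) fun k hk i hi => ⟨(hup k hk i hi).1, (hright k hk i hi).1⟩⟩
  · rw [hup k hk i hi, not_lt] at h
    exact le_antisymm ((mem_gcPolytope_iff.1 hu).2 k hk i hi).1 h
  · rw [hright k hk i hi, not_lt] at h
    exact le_antisymm ((mem_gcPolytope_iff.1 hu).2 k hk i hi).2 h

end LevelCurve

/-! ### The points of a face given by families of paths -/

section PathPoint

variable {n r : ℕ} {N : Fin (r + 2) → ℕ} {lam : Fin n → ℝ}

/-- Writes the top row as a sum of step functions, one for each drop. Moving these steps along
lattice paths produces points of the polytope. -/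
theorem sum_telescope (f : ℕ → ℝ) {i n : ℕ} (hi : i < n) :
    f (n - 1) + ∑ j ∈ Finset.Ico 1 n, (f (j - 1) - f j) * (if i < j then 1 else 0) = f i := by
  induction n, hi using Nat.le_induction with
  | base =>
    rw [Finset.sum_eq_zero, add_zero]
    · rfl
    · intro j hj
      rw [Finset.mem_Ico] at hj
      rw [if_neg (by omega), mul_zero]
  | succ n hn ih =>
    have hn : i < n := hn
    rw [Finset.sum_Ico_succ_top (by omega), if_pos hn, Nat.add_sub_cancel]
    linarith

/-- For each drop of `lam`, choose a path of `γ` ending there and add the size of the drop on the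
boxes to its left. The resulting point changes value only across the chosen paths, so it lies in
`f_γ`. Taking `x` as the path at its own endpoint makes the entries on the two sides of the given
step differ strictly. -/
theorem exists_strict_of_mem_path (hN0 : N 0 = 0)
    (hlam : ∀ i i' : Fin n, lam i' < lam i ↔ ∃ j, (i : ℕ) < N j ∧ N j ≤ (i' : ℕ))
    {γ : gridGraph.Subgraph} {X : Set (ℕ → ℕ)}
    (hX : ∀ x ∈ X, IsLatticePath n x ∧ ∃ j : Fin (r + 1), x n = N j.succ)
    (htop : ∀ j : Fin (r + 1), ∃ x ∈ X, x n = N j.succ) (hγ : HasPaths n X γ)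
    {x : ℕ → ℕ} (hx : x ∈ X) {k i : ℕ} (hk : k < n) (hi : i < k) (hxi : x (k + 1) = i + 1) :
    ∃ w ∈ gcFace lam γ, (x k = i → gcArray w k i < gcArray w (k + 1) i) ∧
      (x k = i + 1 → gcArray w (k + 1) (i + 1) < gcArray w k i) := by
  let f : ℕ → ℝ := fun m => if h : m < n then lam ⟨m, h⟩ else 0
  have hf : ∀ m (h : m < n), f m = lam ⟨m, h⟩ := fun m h => dif_pos h
  have hdrop : ∀ j ∈ Finset.Ico 1 n, 0 ≤ f (j - 1) - f j := by
    intro j hj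
    rw [Finset.mem_Ico] at hj
    rw [hf j hj.2, hf (j - 1) (by omega), sub_nonneg, ← not_lt, hlam]
    rintro ⟨l, h1, h2⟩
    dsimp only at h1 h2
    omega
  have hy : ∀ j, ∃ y, IsLatticePath n y ∧
      (j ∈ Finset.Ico 1 n → f (j - 1) - f j ≠ 0 → y ∈ X ∧ y n = j) := by
    intro j
    by_cases h : j ∈ Finset.Ico 1 n ∧ f (j - 1) - f j ≠ 0
    · have h1 := lt_of_le_of_ne (hdrop j h.1) h.2.symm
      have hj := Finset.mem_Ico.1 h.1
      rw [hf j hj.2, hf (j - 1) (by omega), sub_pos, hlam] at h1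
      obtain ⟨l, h2, h3⟩ := h1
      dsimp only at h2 h3
      obtain ⟨l', rfl⟩ := Fin.exists_succ_eq_of_ne_zero (x := l) (by rintro rfl; omega)
      obtain ⟨y, hy, hyn⟩ := htop l'
      exact ⟨y, (hX y hy).1, fun _ _ => ⟨hy, by omega⟩⟩
    -- Where there is no drop the coefficient is zero, so any lattice path will do, even one outside
    -- `X`.
    · exact ⟨fun _ => 0, ⟨rfl, by simp⟩, fun h1 h2 => absurd ⟨h1, h2⟩ h⟩
  choose y₀ hy₀ hy₀' using hy
  obtain ⟨y, hy, hy', hyx⟩ : ∃ y : ℕ → ℕ → ℕ, (∀ j, IsLatticePath n (y j)) ∧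
      (∀ j ∈ Finset.Ico 1 n, f (j - 1) - f j ≠ 0 → y j ∈ X ∧ y j n = j) ∧ y (x n) = x := by
    refine ⟨Function.update y₀ (x n) x, fun j => ?_, fun j hj => ?_, Function.update_self ..⟩
    · rcases eq_or_ne j (x n) with rfl | h
      · rw [Function.update_self]; exact (hX x hx).1
      · rw [Function.update_of_ne h]; exact hy₀ j
    · rcases eq_or_ne j (x n) with rfl | h
      · rw [Function.update_self]; exact fun _ => ⟨hx, rfl⟩
      · rw [Function.update_of_ne h]; exact hy₀' j hj
  let W : ℕ → ℕ → ℝ := fun k i => f (n - 1) +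
    ∑ j ∈ Finset.Ico 1 n, (f (j - 1) - f j) * (if i < y j k then 1 else 0)
  let w : GCIndex n → ℝ := fun p => W (p.1.1 + p.1.2 - 1) (p.1.1 - 1)
  have hw : ∀ k i, i < k → k ≤ n → gcArray w k i = W k i := by
    intro k i hi hk
    obtain ⟨p, hp, h⟩ := gcArray_index hi hk
    rw [h]
    simp only [w, hp]
    congr 1; omega
  have hind : ∀ {P Q : Prop} [Decidable P] [Decidable Q], (P → Q) →
      (if P then (1 : ℝ) else 0) ≤ if Q then 1 else 0 := by
    intro P Q _ _ h
    split_ifs with h1 h2 <;> simp_all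
  have hup : ∀ k < n, ∀ i, ∀ j, i < y j k → i < y j (k + 1) := fun k hk i j h =>
    h.trans_le ((hy j).2 k hk).1
  have hright : ∀ k < n, ∀ i, ∀ j, i + 1 < y j (k + 1) → i < y j k := fun k hk i j h => by
    have := ((hy j).2 k hk).2
    omega
  have hxn := (hX x hx).1.mono (m := k + 1) hk
  have hmem : x n ∈ Finset.Ico 1 n := Finset.mem_Ico.2 (by omega)
  have hpos : 0 < f (x n - 1) - f (x n) := by
    obtain ⟨-, j, hj⟩ := hX x hx
    have := Finset.mem_Ico.1 hmem
    rw [hf _ this.2, hf _ (by omega), sub_pos, hlam]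
    exact ⟨j.succ, by dsimp only; omega, by dsimp only; omega⟩
  refine ⟨w, mem_gcFace_iff.2 ⟨mem_gcPolytope_iff.2 ⟨fun i => ?_, fun k hk i hi => ⟨?_, ?_⟩⟩,
    fun k hk i hi => ⟨fun h => ?_, fun h => ?_⟩⟩, fun h => ?_, fun h => ?_⟩
  · rw [hw n i i.2 le_rfl, ← hf i i.2, ← sum_telescope f i.2]
    refine congrArg (f (n - 1) + ·) (Finset.sum_congr rfl fun j hj => ?_)
    by_cases h : f (j - 1) - f j = 0
    · rw [h, zero_mul, zero_mul]
    · rw [(hy' j hj h).2]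
  · rw [hw k i hi hk.le, hw (k + 1) i (by omega) hk]
    exact add_le_add le_rfl (Finset.sum_le_sum fun j hj =>
      mul_le_mul_of_nonneg_left (hind (hup k hk i j)) (hdrop j hj))
  · rw [hw k i hi hk.le, hw (k + 1) (i + 1) (by omega) hk]
    exact add_le_add le_rfl (Finset.sum_le_sum fun j hj =>
      mul_le_mul_of_nonneg_left (hind (hright k hk i j)) (hdrop j hj))
  · rw [hw k i hi hk.le, hw (k + 1) i (by omega) hk]
    refine congrArg (f (n - 1) + ·) (Finset.sum_congr rfl fun j hj => ?_)
    by_cases h0 : f (j - 1) - f j = 0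
    · rw [h0, zero_mul, zero_mul]
    · rw [UpWall, hγ.adj_horizontal hk] at h
      have h1 : ¬ (y j k = i ∧ y j (k + 1) = i + 1) := fun h2 => h ⟨_, (hy' j hj h0).1, h2⟩
      have h2 := (hy j).2 k hk
      simp only [(by omega : i < y j k ↔ i < y j (k + 1))]
  · rw [hw k i hi hk.le, hw (k + 1) (i + 1) (by omega) hk]
    refine congrArg (f (n - 1) + ·) (Finset.sum_congr rfl fun j hj => ?_)
    by_cases h0 : f (j - 1) - f j = 0
    · rw [h0, zero_mul, zero_mul]
    · rw [RightWall, hγ.adj_vertical hk] at h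
      have h1 : ¬ (y j k = i + 1 ∧ y j (k + 1) = i + 1) := fun h2 => h ⟨_, (hy' j hj h0).1, h2⟩
      have h2 := (hy j).2 k hk
      simp only [(by omega : i + 1 < y j (k + 1) ↔ i < y j k)]
  · rw [hw k i hi hk.le, hw (k + 1) i (by omega) hk]
    refine add_lt_add_of_le_of_lt le_rfl (Finset.sum_lt_sum (fun j hj =>
      mul_le_mul_of_nonneg_left (hind (hup k hk i j)) (hdrop j hj)) ⟨x n, hmem, ?_⟩)
    rw [hyx, if_neg (by omega), if_pos (by omega), mul_zero, mul_one]
    exact hpos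
  · rw [hw k i hi hk.le, hw (k + 1) (i + 1) (by omega) hk]
    refine add_lt_add_of_le_of_lt le_rfl (Finset.sum_lt_sum (fun j hj =>
      mul_le_mul_of_nonneg_left (hind (hright k hk i j)) (hdrop j hj)) ⟨x n, hmem, ?_⟩)
    rw [hyx, if_neg (by omega), if_pos (by omega), mul_zero, mul_one]
    exact hpos

/-- At a relatively interior point of `f_γ`, neighbouring entries agree exactly when `γ` does not
divide their boxes. -/
theorem wall_iff_of_mem_intrinsicInterior (hN : StrictMono N) (hN0 : N 0 = 0)
    (hNlast : N (Fin.last (r + 1)) = n)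
    (hlam : ∀ i i' : Fin n, lam i' < lam i ↔ ∃ j, (i : ℕ) < N j ∧ N j ≤ (i' : ℕ))
    {γ : gridGraph.Subgraph} (hγ : IsLadderFace n N γ) {u : GCIndex n → ℝ}
    (hu : u ∈ intrinsicInterior ℝ (gcFace lam γ)) {k i : ℕ} (hk : k < n) (hi : i < k) :
    (¬ UpWall γ k i ↔ gcArray u k i = gcArray u (k + 1) i) ∧
      (¬ RightWall γ k i ↔ gcArray u (k + 1) (i + 1) = gcArray u k i) := by
  obtain ⟨X, hX, htop, hpaths⟩ := hγ.exists_hasPaths hN0 hN.monotone hNlast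
  have hf : gcFace lam γ ⊆ gcPolytope lam := fun v hv => hv.1
  have hu' := (mem_gcFace_iff.1 (intrinsicInterior_subset hu)).2 k hk i hi
  -- An equality across a wall at `u` would hold on the whole face, against the point built from a
  -- path through that wall.
  refine ⟨⟨hu'.1, fun h hw => ?_⟩, ⟨hu'.2, fun h hw => ?_⟩⟩
  · rw [UpWall, hpaths.adj_horizontal hk] at hw
    obtain ⟨x, hx, h1, h2⟩ := hw
    obtain ⟨w, hw, h3, -⟩ := exists_strict_of_mem_path hN0 hlam hX htop hpaths hx hk hi h2
    exact (h3 h1).ne ((gcArray_eq_of_intrinsicInterior hf hu hw hk hi).1 h)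
  · rw [RightWall, hpaths.adj_vertical hk] at hw
    obtain ⟨x, hx, h1, h2⟩ := hw
    obtain ⟨w, hw, -, h3⟩ := exists_strict_of_mem_path hN0 hlam hX htop hpaths hx hk hi h2
    exact (h3 h1).ne ((gcArray_eq_of_intrinsicInterior hf hu hw hk hi).2 h)

end PathPoint

/-! ### Regions of the block `W_k` -/

section Regions

variable {γ : gridGraph.Subgraph} {K : ℕ} {ν μ : ℕ → ℝ}

/-- The walls of `γ` in `W_K` separate the distinct entries of the interlacing sequences `ν`, `μ`. -/
structure SeparatesPattern (γ : gridGraph.Subgraph) (K : ℕ) (ν μ : ℕ → ℝ) : Prop where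
  upper : ∀ i < K, ν i ≤ μ i
  lower : ∀ i < K, μ (i + 1) ≤ ν i
  upWall : ∀ i < K, ¬ UpWall γ K i ↔ ν i = μ i
  rightWall : ∀ i < K, ¬ RightWall γ K i ↔ μ (i + 1) = ν i

/-- The entry in the box `p` of `W_K`. -/
noncomputable def boxValue (K : ℕ) (ν μ : ℕ → ℝ) (p : ℤ × ℤ) : ℝ :=
  if p.1 + p.2 = K + 1 then ν (p.1 - 1).toNat else μ (p.1 - 1).toNat

theorem boxValue_inner {p : ℤ × ℤ} {i : ℕ} (h1 : p.1 = i + 1) (h2 : p.2 = K - i) :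
    boxValue K ν μ p = ν i := by
  rw [boxValue, if_pos (by omega)]
  congr 1
  omega

theorem boxValue_outer {p : ℤ × ℤ} {i : ℕ} (h1 : p.1 = i + 1) (h2 : p.2 = K + 1 - i) :
    boxValue K ν μ p = μ i := by
  rw [boxValue, if_neg (by omega)]
  congr 1
  omega

namespace SeparatesPattern

variable (h : SeparatesPattern γ K ν μ)
include h

theorem boxValue_eq_of_undivided {p q : ℤ × ℤ} (hp : p ∈ wBlock K) (hq : q ∈ wBlock K)
    (hpq : Undivided γ p q) : boxValue K ν μ p = boxValue K ν μ q := by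
  obtain ⟨h1, h2, h3, h4⟩ := hp
  obtain ⟨h5, h6, h7, h8⟩ := hq
  have hsum : p.1 + p.2 = K + 1 := by
    rcases hpq with ⟨rfl, -⟩ | ⟨rfl, -⟩ <;> dsimp only at h8 <;> omega
  obtain ⟨i, hi⟩ : ∃ i : ℕ, p.1 = i + 1 := ⟨(p.1 - 1).toNat, by omega⟩
  have hp : p = ((i : ℤ) + 1, (K : ℤ) - i) := Prod.ext hi (by dsimp only; omega)
  have hiK : i < K := by omega
  rw [boxValue_inner (i := i) hi (by omega)]
  rcases (undivided_iff γ hp).1 hpq with ⟨rfl, hw⟩ | ⟨rfl, hw⟩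
  · rw [boxValue_outer (i := i + 1) (by push_cast; ring) (by push_cast; ring)]
    exact ((h.rightWall i hiK).1 hw).symm
  · rw [boxValue_outer (i := i) rfl (by dsimp only; ring)]
    exact (h.upWall i hiK).1 hw

theorem boxValue_eq_of_reachable {p q : wBlock K} (hpq : (wallGraph γ K).Reachable p q) :
    boxValue K ν μ p = boxValue K ν μ q := by
  obtain ⟨w⟩ := hpq
  induction w with
  | nil => rfl
  | cons hadj _ ih =>
    refine Eq.trans ?_ ih
    rcases hadj with hadj | hadj
    · exact h.boxValue_eq_of_undivided (Subtype.prop _) (Subtype.prop _) hadj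
    · exact (h.boxValue_eq_of_undivided (Subtype.prop _) (Subtype.prop _) hadj).symm

end SeparatesPattern

/-- The boxes of `W_K` from the upper left to the lower right. -/
def zigzag (K s : ℕ) : ℤ × ℤ := (((s / 2 : ℕ) : ℤ) + 1, (K : ℤ) + 1 - ((s + 1) / 2 : ℕ))

theorem zigzag_mem {s : ℕ} (hs : s ≤ 2 * K) : zigzag K s ∈ wBlock K := by
  refine ⟨?_, ?_, ?_, ?_⟩ <;> simp only [zigzag] <;> omega

theorem exists_zigzag {p : ℤ × ℤ} (hp : p ∈ wBlock K) : ∃ s ≤ 2 * K, p = zigzag K s := by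
  obtain ⟨h1, h2, h3, h4⟩ := hp
  refine ⟨(p.1 - 1 + (K + 1 - p.2)).toNat, by omega, Prod.ext ?_ ?_⟩ <;> simp only [zigzag] <;> omega

namespace SeparatesPattern

variable (h : SeparatesPattern γ K ν μ)
include h

/-- The zigzag lists the boxes as `μ 0, ν 0, μ 1, ν 1, …`, so interlacing makes the entries decrease
along it, and consecutive boxes are joined whenever their entries agree. -/
theorem zigzag_step {s : ℕ} (hs : s < 2 * K) :
    boxValue K ν μ (zigzag K (s + 1)) ≤ boxValue K ν μ (zigzag K s) ∧
      (boxValue K ν μ (zigzag K s) = boxValue K ν μ (zigzag K (s + 1)) →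
        Undivided γ (zigzag K s) (zigzag K (s + 1)) ∨ Undivided γ (zigzag K (s + 1)) (zigzag K s)) := by
  rcases Nat.even_or_odd' s with ⟨i, rfl | rfl⟩
  · have e1 : zigzag K (2 * i) = ((i : ℤ) + 1, (K : ℤ) - i + 1) := by
      refine Prod.ext ?_ ?_ <;> simp only [zigzag] <;> omega
    have e2 : zigzag K (2 * i + 1) = ((i : ℤ) + 1, (K : ℤ) - i) := by
      refine Prod.ext ?_ ?_ <;> simp only [zigzag] <;> omega
    rw [e1, e2, boxValue_inner (i := i) rfl rfl, boxValue_outer (i := i) rfl (by dsimp only; ring)]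
    refine ⟨h.upper i (by omega), fun e => Or.inr ?_⟩
    exact (undivided_iff γ rfl).2 (Or.inr ⟨rfl, (h.upWall i (by omega)).2 e.symm⟩)
  · have e1 : zigzag K (2 * i + 1) = ((i : ℤ) + 1, (K : ℤ) - i) := by
      refine Prod.ext ?_ ?_ <;> simp only [zigzag] <;> omega
    have e2 : zigzag K (2 * i + 1 + 1) = ((i : ℤ) + 2, (K : ℤ) - i) := by
      refine Prod.ext ?_ ?_ <;> simp only [zigzag] <;> omega
    rw [e1, e2, boxValue_inner (p := (_, _)) (i := i) rfl rfl,
      boxValue_outer (i := i + 1) (by push_cast; ring) (by push_cast; ring)]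
    refine ⟨h.lower i (by omega), fun e => Or.inl ?_⟩
    exact (undivided_iff γ rfl).2 (Or.inl ⟨rfl, (h.rightWall i (by omega)).2 e.symm⟩)

theorem zigzag_le {s t : ℕ} (hst : s ≤ t) (ht : t ≤ 2 * K) :
    boxValue K ν μ (zigzag K t) ≤ boxValue K ν μ (zigzag K s) := by
  induction t, hst using Nat.le_induction with
  | base => exact le_rfl
  | succ t hst ih => exact (h.zigzag_step ht).1.trans (ih (by omega))

theorem reachable_zigzag {s t : ℕ} (hst : s ≤ t) (ht : t ≤ 2 * K)
    (e : boxValue K ν μ (zigzag K s) = boxValue K ν μ (zigzag K t)) :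
    (wallGraph γ K).Reachable ⟨zigzag K s, zigzag_mem (hst.trans ht)⟩
      ⟨zigzag K t, zigzag_mem ht⟩ := by
  induction t, hst using Nat.le_induction with
  | base => exact SimpleGraph.Reachable.refl _
  | succ t hst ih =>
    have h1 := h.zigzag_step (s := t) (by omega)
    have h2 := h.zigzag_le hst (by omega)
    refine (ih (by omega) (le_antisymm (e.le.trans h1.1) h2)).trans (SimpleGraph.Adj.reachable ?_)
    exact h1.2 (le_antisymm (h2.trans e.le) h1.1)

/-- Along the decreasing zigzag, two equal entries force all entries between them to be equal, so
the regions are exactly the level sets of `boxValue`. -/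
theorem reachable_iff {p q : wBlock K} :
    (wallGraph γ K).Reachable p q ↔ boxValue K ν μ p = boxValue K ν μ q := by
  refine ⟨h.boxValue_eq_of_reachable, fun e => ?_⟩
  obtain ⟨p, hp⟩ := p
  obtain ⟨q, hq⟩ := q
  obtain ⟨s, hs, rfl⟩ := exists_zigzag hp
  obtain ⟨t, ht, rfl⟩ := exists_zigzag hq
  rcases le_total s t with hst | hst
  · exact h.reachable_zigzag hst ht e
  · exact (h.reachable_zigzag hst hs e.symm).symm

end SeparatesPattern

/-- The common value of the entries in the boxes of a region. -/
noncomputable def regionValue (ν μ : ℕ → ℝ) (D : Region γ K) : ℝ :=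
  boxValue K ν μ (Quot.out D : wBlock K)

namespace SeparatesPattern

variable (h : SeparatesPattern γ K ν μ)
include h

theorem mem_boxes_iff {D : Region γ K} {p : ℤ × ℤ} :
    p ∈ D.boxes ↔ p ∈ wBlock K ∧ boxValue K ν μ p = regionValue ν μ D := by
  have hD : (wallGraph γ K).connectedComponentMk (Quot.out D) = D := Quot.out_eq D
  rw [regionValue]
  constructor
  · rintro ⟨p, hp, rfl⟩
    refine ⟨p.2, (h.reachable_iff).1 (SimpleGraph.ConnectedComponent.eq.1 ?_)⟩
    rw [hD]; exact hp
  · rintro ⟨hp, e⟩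
    refine ⟨⟨p, hp⟩, ?_, rfl⟩
    rw [SimpleGraph.ConnectedComponent.mem_supp_iff, ← hD]
    exact SimpleGraph.ConnectedComponent.eq.2 ((h.reachable_iff).2 e)

theorem regionValue_mk (p : wBlock K) :
    regionValue ν μ ((wallGraph γ K).connectedComponentMk p : Region γ K) = boxValue K ν μ p :=
  (((h.mem_boxes_iff).1 ⟨p, rfl, rfl⟩).2).symm

theorem regionValue_injective :
    Function.Injective (regionValue ν μ : Region γ K → ℝ) := by
  intro D D' e
  rw [← Quot.out_eq D, ← Quot.out_eq D']
  exact SimpleGraph.ConnectedComponent.eq.2 ((h.reachable_iff).2 e)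

theorem antitone {i j : ℕ} (hij : i ≤ j) (hj : j < K) : ν j ≤ ν i := by
  induction j, hij using Nat.le_induction with
  | base => exact le_rfl
  | succ j hij ih =>
    exact ((h.upper _ hj).trans (h.lower j (by omega))).trans (ih (by omega))

end SeparatesPattern

theorem mult_eq_of_interval {k a b : ℕ} {ν : ℕ → ℝ} {c : ℝ} (hb : b ≤ k)
    (h : ∀ i < k, ν i = c ↔ a ≤ i ∧ i < b) : mult (fun i : Fin k => ν i) c = b - a := by
  rw [mult_eq_card, ← Nat.card_Ico]
  refine Finset.card_bij (fun i _ => (i : ℕ)) (fun i hi => ?_) (fun i _ j _ e => Fin.ext e)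
    fun i hi => ?_
  · exact Finset.mem_Ico.2 ((h i i.2).1 (Finset.mem_filter.1 hi).2)
  · have hi := Finset.mem_Ico.1 hi
    exact ⟨⟨i, by omega⟩, Finset.mem_filter.2 ⟨Finset.mem_univ _, (h i (by omega)).2 hi⟩, rfl⟩

theorem mem_image_add_mBlock {t p : ℤ × ℤ} {l : ℕ} :
    p ∈ (fun p => p + t) '' mBlock l ↔ t.1 + 1 ≤ p.1 ∧ t.2 + 1 ≤ p.2 ∧
      (p.1 + p.2 = t.1 + t.2 + l + 1 ∨
        p.1 + p.2 = t.1 + t.2 + l + 2 ∧ p.1 ≠ t.1 + l + 1 ∧ p.1 ≠ t.1 + 1) := by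
  constructor
  · rintro ⟨⟨a, b⟩, ⟨h1, h2, h3, h4, h5, h6⟩, rfl⟩
    simp only [ne_eq, Prod.mk.injEq, not_and, Prod.fst_add, Prod.snd_add] at *
    omega
  · rintro ⟨h1, h2, h3⟩
    refine ⟨(p.1 - t.1, p.2 - t.2), ⟨?_, ?_, ?_, ?_, ?_, ?_⟩, Prod.ext ?_ ?_⟩ <;>
      simp only [ne_eq, Prod.mk.injEq, not_and, Prod.fst_add, Prod.snd_add] <;> omega

theorem le_of_mem_latticePoints {K : ℕ} {v : ℤ × ℤ} (hv : v ∈ latticePoints (wBlock K)) :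
    (K : ℤ) - 1 ≤ |v.1| + |v.2| := by
  obtain ⟨p, ⟨h1, h2, h3, h4⟩, h5, h6⟩ := hv
  have := le_abs_self v.1
  have := le_abs_self v.2
  omega

theorem mem_bottomVertices_of_sum_eq {K : ℕ} {p : ℤ × ℤ} (hp : p ∈ wBlock K)
    (hs : p.1 + p.2 = K + 1) : (p.1 - 1, p.2 - 1) ∈ bottomVertices K := by
  refine ⟨⟨p, hp, Or.inl rfl, Or.inl rfl⟩, fun w hw => le_trans ?_ (le_of_mem_latticePoints hw)⟩
  obtain ⟨h1, h2, -⟩ := hp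
  dsimp only
  rw [abs_of_nonneg (by omega), abs_of_nonneg (by omega)]
  omega

theorem exists_sum_eq_of_bottomVertices {K : ℕ} (hK : 1 ≤ K) {S : Set (ℤ × ℤ)} (hS : S ⊆ wBlock K)
    (h : (latticePoints S ∩ bottomVertices K).Nonempty) : ∃ p ∈ S, p.1 + p.2 = K + 1 := by
  obtain ⟨v, ⟨p, hp, h1, h2⟩, -, hv⟩ := h
  refine ⟨p, hp, ?_⟩
  obtain ⟨h3, h4, h5, h6⟩ := hS hp
  have h7 := hv ((0 : ℤ), (K : ℤ) - 1) ⟨(1, K), ⟨le_rfl, by dsimp only; omega, by dsimp only; omega,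
    by dsimp only; omega⟩, Or.inl rfl, Or.inl rfl⟩
  dsimp only at h7
  rw [abs_zero, zero_add, abs_of_nonneg (by omega : (0 : ℤ) ≤ (K : ℤ) - 1)] at h7
  have := le_abs_self v.1
  have := le_abs_self v.2
  omega

namespace SeparatesPattern

variable (h : SeparatesPattern γ K ν μ)
include h

/-- A block `M_l` has `l` boxes on its lower antidiagonal and `l - 1` on the upper one. The bottom
vertex fixes the height of the block in `W_K`, so these antidiagonals are the rows of `ν` and `μ`.
Without that condition a single outer box, which is also an `M_1`, would be counted. -/
theorem mult_of_isSphereBlock (hK : 1 ≤ K) {D : Region γ K} {l : ℕ} (hD : D.IsSphereBlock l) :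
    mult (fun i : Fin K => ν i) (regionValue ν μ D) = l ∧
      mult (fun i : Fin (K + 1) => μ i) (regionValue ν μ D) + 1 = l := by
  obtain ⟨hl, ⟨t, ht⟩, hb⟩ := hD
  have hsub : D.boxes ⊆ wBlock K := fun p hp => ((h.mem_boxes_iff).1 hp).1
  have hmem : ∀ p, p ∈ D.boxes ↔ t.1 + 1 ≤ p.1 ∧ t.2 + 1 ≤ p.2 ∧
      (p.1 + p.2 = t.1 + t.2 + l + 1 ∨
        p.1 + p.2 = t.1 + t.2 + l + 2 ∧ p.1 ≠ t.1 + l + 1 ∧ p.1 ≠ t.1 + 1) := fun p => by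
    rw [ht]; exact mem_image_add_mBlock
  obtain ⟨p, hp, hpK⟩ := exists_sum_eq_of_bottomVertices hK hsub hb
  have hp' := (hmem p).1 hp
  obtain ⟨a1, a2, a3, a4⟩ := hsub ((hmem (t.1 + 1, t.2 + l)).2
    ⟨le_rfl, by dsimp only; omega, Or.inl (by dsimp only; ring)⟩)
  obtain ⟨b1, b2, b3, b4⟩ := hsub ((hmem (t.1 + l, t.2 + 1)).2
    ⟨by dsimp only; omega, le_rfl, Or.inl (by dsimp only; ring)⟩)
  dsimp only at a1 a2 a3 a4 b1 b2 b3 b4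
  have htl : t.1 + t.2 + l = K := by omega
  obtain ⟨a, ha⟩ : ∃ a : ℕ, t.1 = a := ⟨t.1.toNat, by omega⟩
  constructor
  · have := mult_eq_of_interval (k := K) (a := a) (b := a + l) (ν := ν) (c := regionValue ν μ D)
      (by omega) fun i hi => by
        have h1 := (h.mem_boxes_iff (D := D) (p := ((i : ℤ) + 1, (K : ℤ) - i)))
        rw [boxValue_inner (i := i) rfl rfl, hmem] at h1
        have h2 : ((i : ℤ) + 1, (K : ℤ) - i) ∈ wBlock K := by
          refine ⟨?_, ?_, ?_, ?_⟩ <;> dsimp only <;> omega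
        rw [and_iff_right h2] at h1
        rw [← h1]
        dsimp only
        omega
    omega
  · have := mult_eq_of_interval (k := K + 1) (a := a + 1) (b := a + l) (ν := μ)
      (c := regionValue ν μ D) (by omega) fun i hi => by
        have h1 := (h.mem_boxes_iff (D := D) (p := ((i : ℤ) + 1, (K : ℤ) + 1 - i)))
        rw [boxValue_outer (i := i) rfl rfl, hmem] at h1
        have h2 : ((i : ℤ) + 1, (K : ℤ) + 1 - i) ∈ wBlock K := by
          refine ⟨?_, ?_, ?_, ?_⟩ <;> dsimp only <;> omega
        rw [and_iff_right h2] at h1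
        rw [← h1]
        dsimp only
        omega
    omega

/-- The entries of `ν` equal to `c` occupy an interval `i₀, …, i₁`, and interlacing forces `μ i = c`
for `i₀ < i ≤ i₁`. Any further such entry of `μ` would raise its multiplicity to that of `ν`. The
level set is then shaped like an `M`-block. -/
theorem isSphereBlock_of_mult_lt {D : Region γ K}
    (hlt : mult (fun i : Fin (K + 1) => μ i) (regionValue ν μ D) <
      mult (fun i : Fin K => ν i) (regionValue ν μ D)) :
    ∃ l, D.IsSphereBlock l := by
  set c := regionValue ν μ D with hc
  have hne : (Finset.univ.filter fun i : Fin K => ν i = c).Nonempty := by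
    rw [← Finset.card_pos, ← mult_eq_card]
    omega
  obtain ⟨i₀, hi₀, hmin⟩ := Finset.exists_min_image _ (fun i => i) hne
  obtain ⟨i₁, hi₁, hmax⟩ := Finset.exists_max_image _ (fun i => i) hne
  simp only [Finset.mem_filter, Finset.mem_univ, true_and] at hi₀ hmin hi₁ hmax
  have h01 : (i₀ : ℕ) ≤ i₁ := hmin i₁ hi₁
  have hν : ∀ i < K, ν i = c ↔ (i₀ : ℕ) ≤ i ∧ i ≤ i₁ := fun i hi =>
    ⟨fun e => ⟨hmin ⟨i, hi⟩ e, hmax ⟨i, hi⟩ e⟩, fun ⟨e1, e2⟩ => le_antisymm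
      ((h.antitone e1 hi).trans hi₀.le) (hi₁.ge.trans (h.antitone e2 i₁.2))⟩
  have hμ' : ∀ i, (i₀ : ℕ) + 1 ≤ i → i ≤ i₁ → μ i = c := fun i e1 e2 => by
    obtain ⟨i, rfl⟩ : ∃ j, i = j + 1 := ⟨i - 1, by omega⟩
    have := i₁.2
    refine le_antisymm ((h.lower i (by omega)).trans ((hν i (by omega)).2 (by omega)).le) ?_
    exact ((hν (i + 1) (by omega)).2 (by omega)).ge.trans (h.upper (i + 1) (by omega))
  have hμ : ∀ i < K + 1, μ i = c ↔ (i₀ : ℕ) + 1 ≤ i ∧ i ≤ i₁ := by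
    refine fun i hi => ⟨fun e => ?_, fun e => hμ' i e.1 e.2⟩
    by_contra hn
    refine absurd hlt (not_lt.2 ?_)
    rw [mult_eq_card, mult_eq_card]
    -- The index `i₀`, which has no forced counterpart in `μ`, is sent to the supposed extra entry
    -- `i`.
    refine Finset.card_le_card_of_injOn (fun j => if j = i₀ then ⟨i, hi⟩ else j.castSucc)
      (fun j hj => ?_) fun j hj j' hj' e' => ?_
    · have hj : ν j = c := by simpa using hj
      have hj := (hν j j.2).1 hj
      simp only [Finset.coe_filter, Finset.mem_univ, true_and, mem_ofPred_eq]
      split_ifs with hji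
      · exact e
      · rw [Fin.ext_iff] at hji
        exact hμ' j (by omega) hj.2
    · have hj : ν j = c := by simpa using hj
      have hj' : ν j' = c := by simpa using hj'
      have hj := (hν j j.2).1 hj
      have hj' := (hν j' j'.2).1 hj'
      dsimp only at e'
      split_ifs at e' with h1 h2 h2 <;> simp only [Fin.ext_iff, Fin.val_castSucc] at * <;> omega
  have hi₁K := i₁.2
  -- The coordinates of the translation and the block size add up to `K`, which places the lower
  -- antidiagonal of the block on the inner boxes.
  refine ⟨i₁ - i₀ + 1, by omega, ⟨((i₀ : ℕ), (K : ℤ) - i₁ - 1), ?_⟩, ?_⟩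
  · ext p
    rw [mem_image_add_mBlock, h.mem_boxes_iff, ← hc]
    have key : p ∈ wBlock K → (boxValue K ν μ p = c ↔
        (p.1 + p.2 = K + 1 ∧ (i₀ : ℤ) ≤ p.1 - 1 ∧ p.1 - 1 ≤ i₁) ∨
        (p.1 + p.2 = K + 2 ∧ (i₀ : ℤ) + 1 ≤ p.1 - 1 ∧ p.1 - 1 ≤ i₁)) := by
      rintro ⟨h1, h2, h3, h4⟩
      obtain ⟨i, hi⟩ : ∃ i : ℕ, p.1 = i + 1 := ⟨(p.1 - 1).toNat, by omega⟩
      rcases (by omega : p.1 + p.2 = K + 1 ∨ p.1 + p.2 = K + 2) with h5 | h5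
      · rw [boxValue_inner (i := i) hi (by omega), hν i (by omega)]
        omega
      · rw [boxValue_outer (i := i) hi (by omega), hμ i (by omega)]
        omega
    constructor
    · rintro ⟨h1, h2⟩
      have h3 := (key h1).1 h2
      dsimp only
      omega
    · rintro ⟨h1, h2, h3⟩
      dsimp only at h1 h2 h3
      have hw : p ∈ wBlock K := by refine ⟨?_, ?_, ?_, ?_⟩ <;> omega
      refine ⟨hw, (key hw).2 ?_⟩
      omega
  · have hw : ((i₀ : ℤ) + 1, (K : ℤ) - i₀) ∈ wBlock K := by
      refine ⟨?_, ?_, ?_, ?_⟩ <;> dsimp only <;> omega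
    refine ⟨_, ⟨_, (h.mem_boxes_iff).2 ⟨hw, ?_⟩, Or.inl rfl, Or.inl rfl⟩,
      mem_bottomVertices_of_sum_eq hw (by dsimp only; ring)⟩
    rw [boxValue_inner (i := i₀) rfl rfl, hi₀]

theorem mult_of_size_ne_zero (hK : 1 ≤ K) {D : Region γ K} (hD : D.size ≠ 0) :
    mult (fun i : Fin K => ν i) (regionValue ν μ D) = D.size ∧
      mult (fun i : Fin (K + 1) => μ i) (regionValue ν μ D) <
        mult (fun i : Fin K => ν i) (regionValue ν μ D) := by
  have hmem : D.IsSphereBlock D.size :=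
    Nat.sInf_mem (Nat.nonempty_of_pos_sInf (Nat.pos_of_ne_zero hD) : {l | D.IsSphereBlock l}.Nonempty)
  have := h.mult_of_isSphereBlock hK hmem
  omega

theorem exists_region {c : ℝ}
    (hlt : mult (fun i : Fin (K + 1) => μ i) c < mult (fun i : Fin K => ν i) c) :
    ∃ D : Region γ K, D.size ≠ 0 ∧ regionValue ν μ D = c := by
  obtain ⟨i, hi⟩ : ∃ i : Fin K, ν i = c := by
    simpa using mem_image_of_mult_pos (Nat.zero_lt_of_lt hlt)
  have hw : (((i : ℕ) : ℤ) + 1, (K : ℤ) - i) ∈ wBlock K := by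
    have := i.2
    refine ⟨?_, ?_, ?_, ?_⟩ <;> dsimp only <;> omega
  have hv : regionValue ν μ ((wallGraph γ K).connectedComponentMk ⟨_, hw⟩ : Region γ K) = c := by
    rw [h.regionValue_mk, boxValue_inner (i := i) rfl rfl, hi]
  refine ⟨(wallGraph γ K).connectedComponentMk ⟨_, hw⟩, ?_, hv⟩
  obtain ⟨l, hl⟩ := h.isSphereBlock_of_mult_lt (hv.symm ▸ hlt)
  exact Nat.one_le_iff_ne_zero.1 (Nat.sInf_mem (⟨l, hl⟩ : {l | Region.IsSphereBlock _ l}.Nonempty)).1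

end SeparatesPattern

end Regions

/-! ### Interpolation between arrays of the same pattern -/

section Interpolation

open Polynomial

/-- Interpolation on the distinct values of `z`. The targets are well defined because equal values
of a monotone sequence are consecutive, so only neighbouring equalities need to be respected. -/
theorem exists_polynomial_of_antitone {M : ℕ} {z z' : ℕ → ℝ} (hz : ∀ s < M, z (s + 1) ≤ z s)
    (h : ∀ s < M, z s = z (s + 1) → z' s = z' (s + 1)) :
    ∃ p : ℝ[X], ∀ s ≤ M, p.eval (z s) = z' s := by
  have hle : ∀ s t, s ≤ t → t ≤ M → z t ≤ z s := by
    intro s t hst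
    induction t, hst using Nat.le_induction with
    | base => exact fun _ => le_rfl
    | succ t hst ih => exact fun ht => (hz t ht).trans (ih (by omega))
  have heq : ∀ s t, s ≤ t → t ≤ M → z s = z t → z' s = z' t := by
    intro s t hst
    induction t, hst using Nat.le_induction with
    | base => exact fun _ _ => rfl
    | succ t hst ih =>
      intro ht e
      have h1 := hle s t hst (by omega)
      have h2 := hz t ht
      exact (ih (by omega) (le_antisymm (e.le.trans h2) h1)).trans
        (h t ht (le_antisymm (h1.trans e.le) h2))
  have heq' : ∀ s t, s ≤ M → t ≤ M → z s = z t → z' s = z' t := fun s t hs ht e => by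
    rcases le_total s t with hst | hst
    · exact heq s t hst ht e
    · exact (heq t s hst hs e.symm).symm
  classical
  let r : ℝ → ℝ := fun c => if hc : ∃ s, s ≤ M ∧ z s = c then z' hc.choose else 0
  refine ⟨Lagrange.interpolate ((Finset.range (M + 1)).image z) id r, fun s hs => ?_⟩
  have h1 := Lagrange.eval_interpolate_at_node (s := (Finset.range (M + 1)).image z) (v := id) r
    (fun a _ b _ e => e) (Finset.mem_image_of_mem z (Finset.mem_range.2 (Nat.lt_succ_of_le hs)))
  have hc : ∃ t, t ≤ M ∧ z t = z s := ⟨s, hs, rfl⟩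
  have h2 : r (z s) = z' s := by
    simp only [r]
    rw [dif_pos hc]
    exact heq' _ _ hc.choose_spec.1 hs hc.choose_spec.2
  exact h1.trans h2

/-- The two rows are merged into one decreasing sequence, `μ` at even places and `ν` at odd ones;
its neighbours are exactly the pairs compared by the pattern. -/
theorem exists_polynomial_of_interlacing {k : ℕ} {ν ν' μ μ' : ℕ → ℝ}
    (hint : ∀ i < k, ν i ≤ μ i ∧ μ (i + 1) ≤ ν i)
    (h : ∀ i < k, (ν i = μ i → ν' i = μ' i) ∧ (μ (i + 1) = ν i → μ' (i + 1) = ν' i)) :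
    ∃ p : ℝ[X], (∀ i < k, p.eval (ν i) = ν' i) ∧ ∀ i < k + 1, p.eval (μ i) = μ' i := by
  have h0 : ∀ i, (2 * i + 1) / 2 = i := fun i => by omega
  have h1 : ∀ i, (2 * i) / 2 = i := fun i => by omega
  have h2 : ∀ i, (2 * i + 1 + 1) / 2 = i + 1 := fun i => by omega
  have h3 : ∀ i, (2 * i + 1 + 1) % 2 = 0 := fun i => by omega
  have h4 : ∀ i, ¬ (2 * i + 1) % 2 = 0 := fun i => by omega
  have h5 : ∀ i, (2 * i) % 2 = 0 := fun i => by omega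
  obtain ⟨p, hp⟩ := exists_polynomial_of_antitone (M := 2 * k)
    (z := fun s => if s % 2 = 0 then μ (s / 2) else ν (s / 2))
    (z' := fun s => if s % 2 = 0 then μ' (s / 2) else ν' (s / 2))
    (fun s hs => by
      rcases Nat.even_or_odd' s with ⟨i, rfl | rfl⟩
      · simp only [h0, h1, h4, h5, if_true, if_false]
        exact (hint i (by omega)).1
      · simp only [h0, h2, h3, h4, if_true, if_false]
        exact (hint i (by omega)).2)
    (fun s hs => by
      rcases Nat.even_or_odd' s with ⟨i, rfl | rfl⟩
      · simp only [h0, h1, h4, h5, if_true, if_false]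
        exact fun e => ((h i (by omega)).1 e.symm).symm
      · simp only [h0, h2, h3, h4, if_true, if_false]
        exact fun e => ((h i (by omega)).2 e.symm).symm)
  refine ⟨p, fun i hi => ?_, fun i hi => ?_⟩
  · simpa only [h0, h4, if_false] using hp (2 * i + 1) (by omega)
  · simpa only [h1, h5, if_true] using hp (2 * i) (by omega)

end Interpolation

/-! ### Fibres of the Gelfand-Cetlin system as towers -/

section Fiber

open Polynomial

theorem eq_of_antitone_of_map_eq {k : ℕ} {ν ν' : Fin k → ℝ} (hν : Antitone ν) (hν' : Antitone ν')
    (h : Finset.univ.val.map ν = Finset.univ.val.map ν') : ν = ν' := by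
  rw [Fin.univ_val_map, Fin.univ_val_map, Multiset.coe_eq_coe] at h
  exact List.ofFn_injective
    (h.eq_of_pairwise' hν.sortedGE_ofFn.pairwise hν'.sortedGE_ofFn.pairwise)

theorem HasSpectrum.eq_of_antitone {k : ℕ} {y : Matrix (Fin k) (Fin k) ℂ} {ν ν' : Fin k → ℝ}
    (h : HasSpectrum y ν) (h' : HasSpectrum y ν') (hν : Antitone ν) (hν' : Antitone ν') : ν = ν' := by
  refine eq_of_antitone_of_map_eq hν hν' ?_
  have h1 := congrArg roots (h.2.symm.trans h'.2)
  have h2 : ∀ ν : Fin k → ℝ, (∏ i, (X - C (ν i : ℂ))).roots =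
      (Finset.univ.val.map ν).map ((↑) : ℝ → ℂ) := fun ν => by
    have : (∏ i, (X - C (ν i : ℂ))) = (((Finset.univ.val.map ν).map ((↑) : ℝ → ℂ)).map
        fun a => X - C a).prod := by
      rw [Multiset.map_map, Multiset.map_map]; rfl
    rw [this, roots_multiset_prod_X_sub_C]
  rw [h2, h2] at h1
  exact Multiset.map_injective Complex.ofReal_injective h1

theorem Matrix.IsHermitian.hasSpectrum_sortedEigenvalue {k : ℕ} {y : Matrix (Fin k) (Fin k) ℂ}
    (h : y.IsHermitian) : HasSpectrum y (sortedEigenvalue y) := by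
  refine ⟨h, h.charpoly_eq.trans ?_⟩
  simp only [sortedEigenvalue, dif_pos h, Matrix.IsHermitian.eigenvalues]
  rw [← Equiv.prod_comp (Fintype.equivOfCardEq (Fintype.card_fin _)),
    ← Equiv.prod_comp (finCongr (Fintype.card_fin k))]
  simp

theorem antitone_sortedEigenvalue {k : ℕ} (y : Matrix (Fin k) (Fin k) ℂ) :
    Antitone (sortedEigenvalue y) := by
  intro i j hij
  unfold sortedEigenvalue
  split_ifs with h
  · exact h.eigenvalues₀_antitone hij
  · exact le_rfl

theorem HasSpectrum.sortedEigenvalue_eq {k : ℕ} {y : Matrix (Fin k) (Fin k) ℂ} {ν : Fin k → ℝ}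
    (h : HasSpectrum y ν) (hν : Antitone ν) : sortedEigenvalue y = ν :=
  h.1.hasSpectrum_sortedEigenvalue.eq_of_antitone h (antitone_sortedEigenvalue y) hν

theorem mem_gcTower_iff {a : ℕ → ℕ → ℝ} {n : ℕ} {x : Matrix (Fin n) (Fin n) ℂ} :
    x ∈ gcTower a n ↔ ∀ k (hk : k ≤ n), HasSpectrum (leadingSubmatrix x k hk) fun i => a k i := by
  induction n with
  | zero =>
    refine ⟨fun _ k hk => ?_, fun _ => trivial⟩
    obtain rfl : k = 0 := by omega
    exact hasSpectrum_of_mem_gcTower (a := a) (k := 0) trivial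
  | succ n ih =>
    constructor
    · rintro ⟨h1, h2⟩ k hk
      rcases hk.eq_or_lt with rfl | hk'
      · exact h1
      · exact ih.1 h2 k (by omega)
    · intro h
      exact ⟨h (n + 1) le_rfl, ih.2 fun k hk => h k (by omega)⟩

variable {n : ℕ} {lam : Fin n → ℝ} {u : GCIndex n → ℝ}

theorem gcArray_gcSystem (x : Matrix (Fin n) (Fin n) ℂ) {k i : ℕ} (hi : i < k) (hk : k ≤ n) :
    gcArray (gcSystem x) k i = sortedEigenvalue (leadingSubmatrix x k hk) ⟨i, hi⟩ := by
  let F : ℕ → ℕ → ℝ := fun k i =>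
    if h : i < k ∧ k ≤ n then sortedEigenvalue (leadingSubmatrix x k h.2) ⟨i, h.1⟩ else 0
  have hF : ∀ p : GCIndex n, gcSystem x p = F (p.1.1 + p.1.2 - 1) (p.1.1 - 1) := fun p => by
    have := p.2
    simp only [F]
    rw [dif_pos ⟨by omega, by omega⟩, gcSystem]
  obtain ⟨p, hp, h⟩ := gcArray_index hi hk
  rw [h, hF, hp]
  dsimp only
  rw [(by omega : i + 1 + (k - i) - 1 = k), Nat.add_sub_cancel]
  exact dif_pos ⟨hi, hk⟩

/-- The rows of a point of the polytope are decreasing, so prescribing the sorted eigenvalues of a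
leading block is the same as prescribing its spectrum with multiplicity; the top row encodes
membership in the orbit. -/
theorem gcFiber_eq_gcTower (hu : u ∈ gcPolytope lam) : gcFiber lam u = gcTower (gcArray u) n := by
  have htop : (fun i : Fin n => gcArray u n i) = lam := funext (mem_gcPolytope_iff.1 hu).1
  ext x
  rw [mem_gcTower_iff]
  constructor
  · rintro ⟨hx, rfl⟩ k hk
    have hx : HasSpectrum x lam := hasSpectrum_iff.2 hx
    have h1 : (leadingSubmatrix x k hk).IsHermitian := hx.1.submatrix _
    have h2 : (fun i : Fin k => gcArray (gcSystem x) k i) =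
        sortedEigenvalue (leadingSubmatrix x k hk) := funext fun i => gcArray_gcSystem x i.2 hk
    rw [h2]
    exact h1.hasSpectrum_sortedEigenvalue
  · intro h
    refine ⟨hasSpectrum_iff.1 (htop ▸ h n le_rfl), funext fun p => ?_⟩
    have hp := p.2
    have hk : p.1.1 + p.1.2 - 1 ≤ n := by omega
    rw [← gcArray_eq (u := gcSystem x) (k := p.1.1 + p.1.2 - 1) (i := p.1.1 - 1) p (by omega) (by omega),
      ← gcArray_eq (u := u) (k := p.1.1 + p.1.2 - 1) (i := p.1.1 - 1) p (by omega) (by omega),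
      gcArray_gcSystem x (by omega) hk, (h _ hk).sortedEigenvalue_eq]
    exact fun i j hij => gcArray_le hu hk hij j.2

theorem diffeomorphic_gcFiber (hn : 1 ≤ n) {w : GCIndex n → ℝ} (hu : u ∈ gcPolytope lam)
    (hw : w ∈ gcPolytope lam) (h : SamePattern u w) :
    Diffeomorphic (gcFiber lam u) (gcFiber lam w) := by
  rw [gcFiber_eq_gcTower hu, gcFiber_eq_gcTower hw]
  have key : ∀ {u w : GCIndex n → ℝ}, u ∈ gcPolytope lam → SamePattern u w → ∀ m < n, ∃ p : ℝ[X],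
      (∀ i : Fin m, p.eval (gcArray u m i) = gcArray w m i) ∧
      ∀ i : Fin (m + 1), p.eval (gcArray u (m + 1) i) = gcArray w (m + 1) i := by
    intro u w hu h m hm
    obtain ⟨p, h1, h2⟩ := exists_polynomial_of_interlacing ((mem_gcPolytope_iff.1 hu).2 m hm)
      fun i hi => ⟨(h m hm i hi).1.1, (h m hm i hi).2.1⟩
    exact ⟨p, fun i => h1 i i.2, fun i => h2 i i.2⟩
  have h' : SamePattern w u := fun k hk i hi => ⟨(h k hk i hi).1.symm, (h k hk i hi).2.symm⟩
  refine diffeomorphic_gcTower (fun m hm => gcArray_antitone hu hm)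
    (fun m hm => gcArray_antitone hw hm) (fun m hm => ?_) ?_
  · obtain ⟨p, h1, h2⟩ := key hu h m hm
    obtain ⟨p', h3, h4⟩ := key hw h' m hm
    exact ⟨p, p', h1, h2, h3, h4⟩
  · obtain ⟨m, rfl⟩ : ∃ m, n = m + 1 := ⟨n - 1, by omega⟩
    obtain ⟨p, -, h2⟩ := key hu h m (by omega)
    obtain ⟨p', -, h4⟩ := key hw h' m (by omega)
    exact ⟨p, p', h2, h4⟩

end Fiber

/-! ### The iterated bundle -/

section IteratedBundle

theorem isSmoothSubmanifold_singleton {V : Type*} [NormedAddCommGroup V] [NormedSpace ℝ V] (v : V) :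
    IsSmoothSubmanifold 0 {v} := by
  intro x hx
  refine ⟨univ, isOpen_univ, mem_univ x, univ, isOpen_univ, fun _ => 0, fun _ => v, contDiffOn_const,
    contDiffOn_const, fun _ _ => mem_univ _, fun _ _ => ⟨rfl, mem_univ _⟩, fun y hy => ?_,
    fun y _ => Subsingleton.elim _ _⟩
  exact hy.1.symm

theorem isSmoothSubmanifold_blockSpace (γ : gridGraph.Subgraph) (k : ℕ) :
    IsSmoothSubmanifold (blockDim γ k) (blockSpace γ k) := by
  refine isSmoothSubmanifold_pi (S := fun D : Region γ k => D.space) fun D => ?_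
  rcases Nat.eq_zero_or_pos D.size with h | h
  · have : IsEmpty (Fin (2 * D.size)) := by rw [h]; exact Fin.isEmpty
    have e : D.space = {0} := by
      ext z
      simp only [Region.space, h, ne_eq, not_true_eq_false, false_implies, mem_ofPred_eq,
        mem_singleton_iff, true_iff]
      exact Subsingleton.elim _ _
    rw [e, h]
    exact isSmoothSubmanifold_singleton 0
  · have e : D.space = {z | ‖z‖ = 1} := by
      ext z
      simp only [Region.space, h.ne', ne_eq, not_false_eq_true, true_implies, mem_ofPred_eq]
    rw [e]
    exact isSmoothSubmanifold_sphere (by rw [finrank_euclideanSpace_fin]; omega)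

/-- A matrix of size one is scalar and unchanged by unitary conjugation. This is the base point of
the tower. -/
theorem exists_gcTower_one_eq (a : ℕ → ℕ → ℝ) : ∃ x, gcTower a 1 = {x} := by
  have hd := hasSpectrum_diagonal fun i : Fin 1 => a 1 i
  refine ⟨Matrix.diagonal fun i : Fin 1 => (a 1 i : ℂ), ?_⟩
  ext x
  refine ⟨fun h => ?_, fun h => ?_⟩
  · obtain ⟨g, hg, hx⟩ := hasSpectrum_iff.1 h.1
    have e : Matrix.diagonal (fun i : Fin 1 => (a 1 i : ℂ)) =
        (a 1 0 : ℂ) • (1 : Matrix (Fin 1) (Fin 1) ℂ) := by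
      rw [Matrix.smul_one_eq_diagonal]
      congr 1
      ext i
      rw [Subsingleton.elim i 0]
      rfl
    rw [mem_singleton_iff, hx, e, Matrix.mul_smul, Matrix.smul_mul, Matrix.mul_one]
    congr 1
    exact Matrix.mem_unitaryGroup_iff.1 hg
  · rw [mem_singleton_iff.1 h]
    exact ⟨hd, trivial⟩

variable {n : ℕ} {γ : gridGraph.Subgraph} {a : ℕ → ℕ → ℝ}

/-- Regions stand for eigenvalues through their common entry. Distinct regions have distinct
entries, and regions of nonzero size are exactly the values whose multiplicity drops from row `k` to
row `k + 1`. -/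
theorem isSmoothFiberBundle_gcTower {k : ℕ} (hk : 1 ≤ k)
    (h : SeparatesPattern γ k (a k) (a (k + 1))) :
    IsSmoothFiberBundle (lead (k := k) (m := k)) (gcTower a (k + 1)) (gcTower a k)
      (blockSpace γ k) :=
  isSmoothFiberBundle_lead (fun _ hy => hasSpectrum_of_mem_gcTower hy)
    (fun i => ⟨h.upper i i.2, h.lower i i.2⟩) Region.size (regionValue (a k) (a (k + 1)))
    h.regionValue_injective (fun _ hD => h.mult_of_size_ne_zero hk hD) fun _ hc => h.exists_region hc

theorem isSmoothSubmanifold_gcTower {m : ℕ}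
    (h : ∀ k, 1 ≤ k → k ≤ m → SeparatesPattern γ k (a k) (a (k + 1))) :
    IsSmoothSubmanifold (∑ k ∈ Finset.Icc 1 m, blockDim γ k) (gcTower a (m + 1)) := by
  induction m with
  | zero =>
    obtain ⟨x, hx⟩ := exists_gcTower_one_eq a
    rw [hx]
    exact isSmoothSubmanifold_singleton x
  | succ m ih =>
    rw [Finset.sum_Icc_succ_top (by omega)]
    exact (isSmoothFiberBundle_gcTower (by omega) (h (m + 1) (by omega) le_rfl)).isSmoothSubmanifold
      (ih fun k hk hkm => h k hk (by omega)) (isSmoothSubmanifold_blockSpace γ (m + 1))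

/-- Level `k` of the iterated bundle is the tower of matrices of size `k + 1`, so that level zero is
the one-point tower of size one. -/
theorem isIteratedBundle_gcTower {m : ℕ}
    (h : ∀ k, 1 ≤ k → k ≤ m → SeparatesPattern γ k (a k) (a (k + 1))) :
    IsIteratedBundle (gcTower a (m + 1)) m fun k => blockSpace γ k :=
  ⟨fun k => Matrix (Fin (k + 1)) (Fin (k + 1)) ℂ, fun _ => inferInstance, fun _ => inferInstance,
    fun k => gcTower a (k + 1), fun _ => lead, fun _ => inferInstance,
    fun _ hk => ⟨_, isSmoothSubmanifold_gcTower fun l hl hlk => h l hl (hlk.trans hk)⟩,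
    exists_gcTower_one_eq a,
    fun k hk => isSmoothFiberBundle_gcTower (by omega) (h (k + 1) (by omega) hk),
    Diffeomorphic.refl _⟩

end IteratedBundle

/-- The topology of the fibres of the Gelfand-Cetlin system on a coadjoint orbit of `U(n)`. -/
theorem theoremA (n r : ℕ) (N : Fin (r + 2) → ℕ) (hN : StrictMono N) (hN0 : N 0 = 0)
    (hNlast : N (Fin.last (r + 1)) = n) (lam : Fin n → ℝ)
    -- the eigenvalues are constant on the blocks `n_{j-1} < i ≤ n_j` and drop from block to block
    (hlam : ∀ i i' : Fin n, lam i' < lam i ↔ ∃ j, (i : ℕ) < N j ∧ N j ≤ (i' : ℕ)) :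
    -- every point of the polytope lies in the relative interior of a face `f_γ`
    (∀ u ∈ gcPolytope lam, ∃ γ, IsLadderFace n N γ ∧ u ∈ intrinsicInterior ℝ (gcFace lam γ)) ∧
    -- the fibre over such a point: isotropic submanifold, dimension, iterated bundle
    (∀ γ, IsLadderFace n N γ → ∀ u ∈ intrinsicInterior ℝ (gcFace lam γ),
      IsIsotropicSubmanifold lam (∑ k ∈ Finset.Icc 1 (n - 1), blockDim γ k) (gcFiber lam u) ∧
      IsIteratedBundle (gcFiber lam u) (n - 1) (fun k => blockSpace γ k)) ∧
    -- fibres over the same open face are diffeomorphic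
    (∀ γ, IsLadderFace n N γ → ∀ u₁ ∈ intrinsicInterior ℝ (gcFace lam γ),
      ∀ u₂ ∈ intrinsicInterior ℝ (gcFace lam γ),
        Diffeomorphic (gcFiber lam u₁) (gcFiber lam u₂)) ∧
    (∀ f : Set (GCIndex n → ℝ), IsExposed ℝ (gcPolytope lam) f →
      ∀ u₁ ∈ intrinsicInterior ℝ f, ∀ u₂ ∈ intrinsicInterior ℝ f,
        Diffeomorphic (gcFiber lam u₁) (gcFiber lam u₂)) := by
  have hn : 1 ≤ n := by
    have := hN (Fin.last_pos : (0 : Fin (r + 2)) < Fin.last (r + 1))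
    omega
  -- Only `f ⊆ gcPolytope lam` matters here, so one argument covers both the faces `f_γ` and the
  -- exposed faces.
  have hdiff : ∀ f : Set (GCIndex n → ℝ), f ⊆ gcPolytope lam →
      ∀ u₁ ∈ intrinsicInterior ℝ f, ∀ u₂ ∈ intrinsicInterior ℝ f,
        Diffeomorphic (gcFiber lam u₁) (gcFiber lam u₂) := fun f hf u₁ h₁ u₂ h₂ =>
    diffeomorphic_gcFiber hn (hf (intrinsicInterior_subset h₁)) (hf (intrinsicInterior_subset h₂))
      (samePattern_of_intrinsicInterior hf h₁ h₂)
  refine ⟨fun u hu => exists_mem_intrinsicInterior_gcFace hN hN0 hNlast hlam hu,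
    fun γ hγ u hu => ?_, fun γ _ => hdiff _ fun v hv => hv.1, fun f hf => hdiff f hf.subset⟩
  have hmem : u ∈ gcPolytope lam := (intrinsicInterior_subset hu).1
  obtain ⟨m, rfl⟩ : ∃ m, n = m + 1 := ⟨n - 1, by omega⟩
  have hsep : ∀ k, 1 ≤ k → k ≤ m → SeparatesPattern γ k (gcArray u k) (gcArray u (k + 1)) :=
    fun k _ hk => {
      upper := fun i hi => ((mem_gcPolytope_iff.1 hmem).2 k (by omega) i hi).1
      lower := fun i hi => ((mem_gcPolytope_iff.1 hmem).2 k (by omega) i hi).2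
      upWall := fun i hi =>
        (wall_iff_of_mem_intrinsicInterior hN hN0 hNlast hlam hγ hu (by omega) hi).1
      rightWall := fun i hi =>
        (wall_iff_of_mem_intrinsicInterior hN hN0 hNlast hlam hγ hu (by omega) hi).2 }
  have hsub : gcFiber lam u ⊆ coadjointOrbit lam := fun x hx => hx.1
  rw [IsIsotropicSubmanifold]
  refine ⟨⟨hsub, ?_⟩, ?_⟩ <;> rw [gcFiber_eq_gcTower hmem]
  · exact ⟨isSmoothSubmanifold_gcTower hsep, fun x _ v w hv hw =>
      kksForm_eq_zero_of_mem_gcTower (fun k hk => gcArray_antitone hmem hk) hv hw⟩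
  · exact isIteratedBundle_gcTower hsep
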